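/- For $\lambda\in\mathbb{R}$ and $0<\alpha\le 1$ let $L(\lambda,\alpha,s)$ be the Lerch zeta-function, $L(\lambda,\alpha,s)=\sum_{n\ge0}e^{2\pi i\lambda n}(n+\alpha)^{-s}$ for $\Re s>0$ if $\lambda\notin\mathbb{Z}$, and for $\Re s>1$ if $\lambda\in\mathbb{Z}$, continued analytically to $\mathbb{C}\setminus\{1\}$ in the latter case (the Hurwitz zeta-function). Let $S$ be the set of all $\alpha\in(0,1]$ such that (1) the numbers $\log(n+\alpha)$, $n\ge0$, are linearly independent over $\mathbb{Q}$; and (2) there are constants $\Omega(\alpha)>0$ and $X(\alpha)$ such that for all $X\ge X(\alpha)$, all $N$, all integers $0\le n_1,\dots,n_N\le X$ and all $\epsilon_1,\dots,\epsilon_N\in\{1,-1\}$ with $\sum_{j=1}^N\epsilon_j\log(n_j+\alpha)\ne0$ one has $\bigl|\sum_{j=1}^N\epsilon_j\log(n_j+\alpha)\bigr|\ge X^{-\Omega(\alpha)N^2}$. Write $|dz|=(2\pi)^{-1}dx\,dy$ on $\mathbb{C}$, $\psi_z(w)=e^{i\Re(z\overline{w})}$ and $\tilde f(z)=\int_{\mathbb{C}}f(w)\psi_z(w)|dw|$.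 Let $\Lambda$ be the class of all $f\colon\mathbb{C}\to\mathbb{C}$ with $f,\tilde f\in L^1(\mathbb{C})\cap L^\infty(\mathbb{C})$ and $f(z)=\int_{\mathbb{C}}\tilde f(w)\psi_{-z}(w)|dw|$ for all $z\in\mathbb{C}$. For $\sigma>1/2$ let $M_\sigma(\,\cdot\,;\alpha)$ be the non-negative continuous density with respect to $|dz|$ of the infinite convolution $\phi_0*\phi_1*\cdots$ (the weak limit of $\phi_0*\cdots*\phi_n$ as $n\to\infty$), where $\phi_n$ is the uniform probability measure on the circle $|z|=(n+\alpha)^{-\sigma}$; this density exists and is unique. Theorem. Let $\lambda\in\mathbb{R}$, $\alpha\in S$, $\sigma_1>0$, and let $\theta,\delta>0$ with $\theta+\delta<1/4$. There exist $T_0=T_0(\alpha,\theta,\delta)>0$, depending only on $\alpha,\theta,\delta$, and $C=C(\lambda,\sigma_1)>0$, depending only on $\lambda,\sigma_1$, such that for all $T\ge T_0$, all $\sigma\in[1/2+(\log T)^{-\theta},\sigma_1]$ and all $\Phi\in\Lambda$, \[\Bigl|\frac1T\int_0^T\Phi(L(\lambda,\alpha,\sigma+it))\,dt-\int_{\mathbb{C}}\Phi(z)M_\sigma(z;\alpha)|dz|\Bigr|\le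 C\Bigl(\exp\bigl(-\tfrac12(\log T)^{\theta/2}\bigr)\int_{\Omega}|\tilde\Phi(z)||dz|+\int_{\mathbb{C}\setminus\Omega}|\tilde\Phi(z)||dz|\Bigr),\] where $\Omega=\{x+iy\in\mathbb{C}: |x|\le(\log T)^\delta,\ |y|\le(\log T)^\delta\}$. -/

import Mathlib

namespace LerchMean

open MeasureTheory Filter Topology

/-- The Lerch zeta-function `L(lam, α, s)` on the half-plane `Re s > 0` (for `0 < α ≤ 1`, `lam` real).
For `lam ∉ ℤ` it is the sum `∑_{n ≥ 0} e^{2πi lam n} (n + α)^{-s}`, which converges (conditionally,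
hence the limit of partial sums) for `Re s > 0`.
For `lam ∈ ℤ` it is the (analytically continued) Hurwitz zeta-function; Mathlib's `hurwitzZeta`
is the continuation of `∑_{n ≥ 0} (n + α)^{-s}` for `0 < α ≤ 1` (the class of `α = 1` in `ℝ/ℤ`
gives the Riemann zeta-function `∑_{n ≥ 0} (n + 1)^{-s}`). -/
noncomputable def lerchZeta (lam α : ℝ) (s : ℂ) : ℂ :=
  open Classical in
  if ∃ k : ℤ, lam = k then
    HurwitzZeta.hurwitzZeta (α : UnitAddCircle) s
  else
    limUnder atTop fun N : ℕ => ∑ n ∈ Finset.range N,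
      Complex.exp (2 * Real.pi * Complex.I * lam * n) / ((n : ℂ) + (α : ℂ)) ^ s

/-- The admissible set `S ⊆ (0, 1]`. The threshold for `X` in the spacing condition depends on `α`
only; it is uniform in the number `N` of terms. -/
def admissibleSet : Set ℝ :=
  {α | (0 < α ∧ α ≤ 1) ∧
    LinearIndependent ℚ (fun n : ℕ => Real.log (n + α)) ∧
    ∃ Ω : ℝ, 0 < Ω ∧ ∀ᶠ X : ℝ in atTop,
      ∀ (N : ℕ) (n : Fin N → ℕ) (ε : Fin N → ℝ),
        (∀ j, (n j : ℝ) ≤ X) → (∀ j, ε j = 1 ∨ ε j = -1) →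
        ∑ j, ε j * Real.log (n j + α) ≠ 0 →
        X ^ (-(Ω * (N : ℝ) ^ 2)) ≤ |∑ j, ε j * Real.log (n j + α)|}

/-- The measure `|dz| = (2π)⁻¹ dx dy` on `ℂ`. -/
noncomputable def dz : Measure ℂ := ENNReal.ofReal (2 * Real.pi)⁻¹ • (volume : Measure ℂ)

/-- The additive character `ψ_z(w) = exp(i Re(z w̄))`. -/
noncomputable def psi (z w : ℂ) : ℂ :=
  Complex.exp (Complex.I * ((z * (starRingEnd ℂ) w).re : ℂ))

/-- The Fourier transform `f̃(z) = ∫ f(w) ψ_z(w) |dw|`. -/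
noncomputable def fourierT (f : ℂ → ℂ) (z : ℂ) : ℂ := ∫ w, f w * psi z w ∂dz

/-- The class `Λ`: `f` and `f̃` lie in `L¹ ∩ L^∞`, and Fourier inversion holds at every point. -/
structure ClassLambda (f : ℂ → ℂ) : Prop where
  memL1 : MemLp f 1 dz
  memLinf : MemLp f ⊤ dz
  fourier_memL1 : MemLp (fourierT f) 1 dz
  fourier_memLinf : MemLp (fourierT f) ⊤ dz
  inversion : ∀ z : ℂ, f z = ∫ w, fourierT f w * psi (-z) w ∂dz

/-- The equidistribution on the circle `|z| = r`: the image of normalized Haar measure on `ℝ/ℤ`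
under `x ↦ r e^{2πix}`. -/
noncomputable def circleEquidist (r : ℝ) : ProbabilityMeasure ℂ :=
  ⟨(AddCircle.haarAddCircle : Measure UnitAddCircle).map
      (fun x => (r : ℂ) * (AddCircle.toCircle x : ℂ)),
    Measure.isProbabilityMeasure_map (by
      have h : Continuous fun x : UnitAddCircle => (r : ℂ) * (AddCircle.toCircle x : ℂ) :=
        continuous_const.mul (continuous_subtype_val.comp AddCircle.continuous_toCircle)
      exact h.measurable.aemeasurable)⟩

/-- The finite convolution `φ_0 ∗ φ_1 ∗ ⋯ ∗ φ_n`, where `φ_k` is the equidistribution on the circle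
`|z| = (k + α)^{-σ}`. -/
noncomputable def partialConv (σ α : ℝ) : ℕ → ProbabilityMeasure ℂ
  | 0 => circleEquidist (((0 : ℕ) + α) ^ (-σ))
  | n + 1 =>
    ⟨Measure.conv (partialConv σ α n : Measure ℂ)
        (circleEquidist ((((n + 1 : ℕ) : ℝ) + α) ^ (-σ)) : Measure ℂ), inferInstance⟩

/-- `M` is the continuous density, with respect to `|dz|`, of the infinite convolution
`φ_0 ∗ φ_1 ∗ ⋯` (the weak limit of the finite convolutions). Such an `M` is unique. -/
structure IsLimitDensity (σ α : ℝ) (M : ℂ → ℝ) : Prop where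
  continuous : Continuous M
  nonneg : ∀ z, 0 ≤ M z
  isLimit : ∃ φ : ProbabilityMeasure ℂ, Tendsto (partialConv σ α) atTop (𝓝 φ) ∧
    (φ : Measure ℂ) = dz.withDensity (fun z => ENNReal.ofReal (M z))

/-- The density function `M_σ(z; α)`, i.e. the function `M` with `IsLimitDensity σ α M`
(which exists for `σ > 1/2` and `0 < α ≤ 1`). -/
noncomputable def densityM (σ α : ℝ) : ℂ → ℝ := Classical.epsilon (IsLimitDensity σ α)

/-- The square `Ω = {x + iy : |x| ≤ (log T)^δ, |y| ≤ (log T)^δ}`. -/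
def squareΩ (δ T : ℝ) : Set ℂ :=
  {z | |z.re| ≤ Real.log T ^ δ ∧ |z.im| ≤ Real.log T ^ δ}

end LerchMean

/-! By Fourier inversion, the mean of Φ(L(λ,α,σ+it)) over [0,T] and the integral of Φ against the
density are both integrals of Φ̃(w) against a characteristic function taken at -w: that of the
values of L on the segment, and that of φ_0 * φ_1 * ⋯. It therefore suffices that these two differ
by O(exp(-(log T)^{θ/2}/2)) for |w| ≤ 2(log T)^δ; off the square the trivial bound 2 is enough.

Write l = log T. By summation by parts, L is close to its partial sum of length M ≍ Tl
(`norm_lerchZeta_sub_sum_le`). The mean value theorem `integral_normSq_dirichlet_le` shortens this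
sum to length N ≈ exp(l^{3θ/2}): as σ - 1/2 ≥ l^{-θ}, the discarded coefficients have square sum
about N^{-2l^{-θ}} = exp(-2l^{θ/2}), up to a power of l. The same tail bounds the error in
truncating the product ∏ J_0(|w|(n+α)^{-σ}), the characteristic function of the limit.

There remains a Dirichlet polynomial whose frequencies log(n+α) are independent over ℚ, to be
compared with a sum of independent variables uniform on circles. Both exponentials are expanded to
order 2k (`norm_integral_exp_sub_integral_exp_le`). The moments differ only by monomials of non-zero
frequency, which the spacing condition keeps at least N^{-Ω(2k)²} in size (`abs_moment_sub_le`). The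
Taylor remainder is controlled by the subgaussian moments of the random model, once k dominates the
variance, which is O(l^{2δ+θ}). With k ≈ l^{2δ+5θ/4} the moment error is harmless as long as k² log
N ≈ l^{4δ+4θ} is small against l, and this is where θ + δ < 1/4 comes from.

The density exists because J_0 decays at least like u^{-1/3}, so that seven factors of the product
already make the characteristic function integrable on the plane; a Gaussian regularisation then
yields a continuous non-negative density.

T₀ may depend neither on λ nor on σ₁. The argument needs log T to exceed a threshold in λ and σ₁;
below that threshold the constant C absorbs the trivial bound. -/

namespace LerchMean
open MeasureTheory Filter Topology

/-! ### Characteristic function of the unit circle (the Bessel function J_0). -/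

/-- The point `e^{2πix}` of the unit circle. -/
noncomputable def unitPt (x : UnitAddCircle) : ℂ := (AddCircle.toCircle x : ℂ)

lemma unitPt_add (x y : UnitAddCircle) : unitPt (x + y) = unitPt x * unitPt y := by
  rw [unitPt, AddCircle.toCircle_add, Circle.coe_mul]; rfl

lemma norm_unitPt (x : UnitAddCircle) : ‖unitPt x‖ = 1 := Circle.norm_coe _

lemma unitPt_coe (x : ℝ) : unitPt (x : UnitAddCircle) =
    Complex.exp (((2 * Real.pi * x : ℝ) : ℂ) * Complex.I) := by
  rw [unitPt, AddCircle.toCircle_apply_mk, Circle.coe_exp, div_one]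

lemma continuous_unitPt : Continuous unitPt :=
  continuous_subtype_val.comp AddCircle.continuous_toCircle

/-- The characteristic function of the uniform distribution on the unit circle. -/
noncomputable def circleChar (u : ℝ) : ℂ :=
  ∫ x : UnitAddCircle, Complex.exp (((u * (unitPt x).re : ℝ) : ℂ) * Complex.I)
    ∂AddCircle.haarAddCircle

lemma haarAddCircle_eq_volume :
    (AddCircle.haarAddCircle : Measure UnitAddCircle) = volume := by
  rw [AddCircle.volume_eq_smul_haarAddCircle]; simp

lemma integrable_haar_of_continuous {E : Type*} [NormedAddCommGroup E]
    {f : UnitAddCircle → E} (hf : Continuous f) :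
    Integrable f AddCircle.haarAddCircle :=
  hf.integrable_of_hasCompactSupport (HasCompactSupport.of_compactSpace f)

/-- Haar measure is rotation invariant, so the argument of c can be translated away. -/
lemma integral_toCircle_mul (f : ℂ → ℂ) (c : ℂ) :
    ∫ x : UnitAddCircle, f (c * unitPt x) ∂AddCircle.haarAddCircle
      = ∫ x : UnitAddCircle, f (‖c‖ * unitPt x) ∂AddCircle.haarAddCircle := by
  obtain ⟨y, hy⟩ : ∃ y : UnitAddCircle, c = ‖c‖ * unitPt y := by
    refine ⟨((Complex.arg c / (2 * Real.pi) : ℝ) : UnitAddCircle), ?_⟩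
    rw [unitPt_coe]
    have : ((2 * Real.pi * (Complex.arg c / (2 * Real.pi)) : ℝ) : ℂ) = Complex.arg c := by
      congr 1; field_simp
    rw [this, Complex.norm_mul_exp_arg_mul_I]
  conv_lhs => rw [hy]
  rw [← integral_add_left_eq_self (μ := (AddCircle.haarAddCircle : Measure UnitAddCircle))
    (fun x => f (‖c‖ * unitPt x)) y]
  simp only [unitPt_add, mul_assoc]

/-- Only the modulus of a coefficient is visible in the random model. This is why the phases
e^{2πiλn} leave no trace in the limit law. -/
lemma integral_exp_re_mul_toCircle (c : ℂ) :
    ∫ x : UnitAddCircle, Complex.exp ((((c * unitPt x).re : ℝ) : ℂ) * Complex.I)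
      ∂AddCircle.haarAddCircle = circleChar ‖c‖ := by
  have := integral_toCircle_mul (fun z => Complex.exp (((z.re : ℝ) : ℂ) * Complex.I)) c
  rw [this, circleChar]
  congr 1; ext x
  rw [Complex.re_ofReal_mul]

lemma norm_circleChar_le_one (u : ℝ) : ‖circleChar u‖ ≤ 1 := by
  refine (norm_integral_le_of_norm_le_const (C := 1) (ae_of_all _ fun x => ?_)).trans ?_
  · rw [Complex.norm_exp_ofReal_mul_I]
  · simp

lemma unitPt_half_add (x : UnitAddCircle) :
    unitPt ((((1 / 2 : ℝ)) : UnitAddCircle) + x) = -unitPt x := by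
  rw [unitPt_add, unitPt_coe]
  have : ((2 * Real.pi * (1 / 2) : ℝ) : ℂ) = Real.pi := by congr 1; ring
  rw [this, Complex.exp_pi_mul_I]; simp

lemma integral_toCircle_re :
    ∫ x : UnitAddCircle, (unitPt x).re ∂AddCircle.haarAddCircle = 0 := by
  have h := integral_add_left_eq_self (μ := (AddCircle.haarAddCircle : Measure UnitAddCircle))
    (fun x => (unitPt x).re) (((1 / 2 : ℝ)) : UnitAddCircle)
  simp only [unitPt_half_add, Complex.neg_re, integral_neg] at h
  linarith

/-- The derivative of the remainder of order n + 1 is i times the remainder of order n, so the bound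
integrates up by induction. For imaginary arguments no factor e^{|x|} appears; a bound by a pure
power is needed since it will be averaged as a moment. -/
lemma norm_exp_mul_I_sub_sum_le_of_nonneg (n : ℕ) {x : ℝ} (hx : 0 ≤ x) :
    ‖Complex.exp (x * Complex.I) - ∑ m ∈ Finset.range n, (x * Complex.I) ^ m / (m.factorial : ℂ)‖
      ≤ x ^ n / n.factorial := by
  induction n generalizing x with
  | zero => simp [Complex.norm_exp_ofReal_mul_I]
  | succ n ih =>
    set f : ℝ → ℂ := fun y => Complex.exp (y * Complex.I)
      - ∑ m ∈ Finset.range (n + 1), (y * Complex.I) ^ m / (m.factorial : ℂ) with hf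
    have hd : ∀ y : ℝ, HasDerivAt f (Complex.I * (Complex.exp (y * Complex.I)
        - ∑ m ∈ Finset.range n, (y * Complex.I) ^ m / (m.factorial : ℂ))) y := by
      intro y
      have hlin : HasDerivAt (fun y : ℝ => (y : ℂ) * Complex.I) Complex.I y := by
        simpa using (Complex.ofRealCLM.hasDerivAt (x := y)).mul_const Complex.I
      have h1 := hlin.cexp
      have h2 : HasDerivAt (fun y : ℝ => ∑ m ∈ Finset.range (n + 1),
          ((y : ℂ) * Complex.I) ^ m / (m.factorial : ℂ))
          (∑ m ∈ Finset.range (n + 1),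
            ((m : ℂ) * ((y : ℂ) * Complex.I) ^ (m - 1) * Complex.I) / (m.factorial : ℂ)) y := by
        apply HasDerivAt.fun_sum
        intro m _
        exact (hlin.pow m).div_const _
      refine (h1.sub h2).congr_deriv ?_
      symm
      -- The constant term is peeled off: its derivative vanishes, and the other terms shift down by
      -- one degree.
      rw [Finset.sum_range_succ', mul_sub, Finset.mul_sum]
      simp only [Nat.cast_zero, zero_mul, zero_div, add_zero, Nat.add_sub_cancel]
      congr 1
      · ring
      · refine Finset.sum_congr rfl fun m _ => ?_
        rw [Nat.factorial_succ]
        have : (m.factorial : ℂ) ≠ 0 := by exact_mod_cast m.factorial_ne_zero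
        have h' : ((m : ℂ) + 1) ≠ 0 := by exact_mod_cast m.succ_ne_zero
        push_cast
        field_simp
    have hB : ∀ y : ℝ, HasDerivAt (fun y : ℝ => y ^ (n + 1) / ((n + 1).factorial : ℝ))
        (y ^ n / (n.factorial : ℝ)) y := by
      intro y
      have := (hasDerivAt_pow (n + 1) y).div_const ((n + 1).factorial : ℝ)
      refine this.congr_deriv ?_
      rw [Nat.factorial_succ]
      have : (n.factorial : ℝ) ≠ 0 := by exact_mod_cast n.factorial_ne_zero
      push_cast
      field_simp
    have := image_norm_le_of_norm_deriv_right_le_deriv_boundary (a := 0) (b := x)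
      (f := f) (fun y _ => (hd y).continuousAt.continuousWithinAt)
      (fun y _ => (hd y).hasDerivWithinAt)
      (B := fun y : ℝ => y ^ (n + 1) / ((n + 1).factorial : ℝ)) (by
        simp [hf, Finset.sum_range_succ'])
      (hB) (fun y hy => by
        rw [norm_mul, Complex.norm_I, one_mul]
        exact ih hy.1)
    exact this ⟨hx, le_rfl⟩

lemma norm_exp_mul_I_sub_sum_le (n : ℕ) (x : ℝ) :
    ‖Complex.exp (x * Complex.I) - ∑ m ∈ Finset.range n, (x * Complex.I) ^ m / (m.factorial : ℂ)‖
      ≤ |x| ^ n / n.factorial := by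
  rcases le_total 0 x with hx | hx
  · rw [abs_of_nonneg hx]; exact norm_exp_mul_I_sub_sum_le_of_nonneg n hx
  · rw [abs_of_nonpos hx]
    have h := norm_exp_mul_I_sub_sum_le_of_nonneg n (x := -x) (by linarith)
    rw [← Complex.norm_conj] at h
    convert h using 2
    simp only [map_sub, map_sum, map_div₀, map_pow, map_mul, ← Complex.exp_conj, Complex.conj_I,
      Complex.conj_ofReal, map_natCast]
    simp

/-- The linear Taylor term averages to zero by symmetry. The quadratic bound makes the product over
n converge as soon as the radii are square summable. -/
lemma norm_circleChar_sub_one_le (u : ℝ) : ‖circleChar u - 1‖ ≤ u ^ 2 / 2 := by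
  have hc : Continuous fun x : UnitAddCircle => (unitPt x).re :=
    Complex.continuous_re.comp continuous_unitPt
  have h1 : Integrable (fun x : UnitAddCircle =>
      Complex.exp (((u * (unitPt x).re : ℝ) : ℂ) * Complex.I))
      AddCircle.haarAddCircle := integrable_haar_of_continuous (by fun_prop)
  have h2 : Integrable (fun x : UnitAddCircle =>
      1 + ((u * (unitPt x).re : ℝ) : ℂ) * Complex.I)
      AddCircle.haarAddCircle := integrable_haar_of_continuous (by fun_prop)
  have h3 : ∫ x : UnitAddCircle, (1 + ((u * (unitPt x).re : ℝ) : ℂ) * Complex.I)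
      ∂AddCircle.haarAddCircle = 1 := by
    rw [integral_add (integrable_const _) (integrable_haar_of_continuous (by fun_prop)),
      integral_mul_const, integral_complex_ofReal, integral_const_mul, integral_toCircle_re]
    simp
  rw [circleChar, ← h3, ← integral_sub h1 h2]
  refine (norm_integral_le_of_norm_le_const (C := u ^ 2 / 2) (ae_of_all _ fun x => ?_)).trans ?_
  · have := norm_exp_mul_I_sub_sum_le 2 (u * (unitPt x).re)
    simp only [Finset.sum_range_succ, Finset.sum_range_zero, Nat.factorial] at this
    simp only [pow_zero, Nat.cast_one, div_one, pow_one, zero_add] at this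
    simp only [mul_one, Nat.cast_one, div_one] at this
    refine this.trans ?_
    have h4 : |(unitPt x).re| ≤ 1 :=
      (Complex.abs_re_le_norm _).trans (norm_unitPt x).le
    rw [sq_abs, mul_pow]
    have h5 : (unitPt x).re ^ 2 ≤ 1 := by
      rw [← sq_abs]; exact pow_le_one₀ (abs_nonneg _) h4
    norm_num
    nlinarith [sq_nonneg u]
  · simp

/-- Non-stationary phase: one integration by parts, dividing by the derivative of the phase. Each of
the two boundary terms is at most 1/(2um²), and the remaining integral at most 1/(um²). -/
lemma norm_integral_exp_cos_le {u m a b : ℝ} (hu : 0 < u) (hm : 0 < m) (hm1 : m ≤ 1) (hab : a ≤ b)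
    (hab1 : b - a ≤ 1) (hs : ∀ x ∈ Set.Icc a b, m ≤ |Real.sin (2 * Real.pi * x)|) :
    ‖∫ x in a..b, Complex.exp (((u * Real.cos (2 * Real.pi * x) : ℝ) : ℂ) * Complex.I)‖
      ≤ 2 / (u * m ^ 2) := by
  set F : ℝ → ℂ := fun x => Complex.exp (((u * Real.cos (2 * Real.pi * x) : ℝ) : ℂ) * Complex.I)
    with hF
  have hFn : ∀ x, ‖F x‖ = 1 := fun x => Complex.norm_exp_ofReal_mul_I _
  -- The reciprocal of the phase derivative up to sign, chosen so that (F·iq)' = F + F·iq'.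
  set q : ℝ → ℝ := fun x => 1 / (2 * Real.pi * u * Real.sin (2 * Real.pi * x)) with hq
  have hpi := Real.pi_pos
  have hne : ∀ x ∈ Set.Icc a b, Real.sin (2 * Real.pi * x) ≠ 0 := fun x hx h => by
    have := hs x hx; rw [h, abs_zero] at this; linarith
  set q' : ℝ → ℝ := fun x => - Real.cos (2 * Real.pi * x) / (u * Real.sin (2 * Real.pi * x) ^ 2)
    with hq'
  have hdlin : ∀ x : ℝ, HasDerivAt (fun x : ℝ => 2 * Real.pi * x) (2 * Real.pi) x := fun x => by
    simpa using (hasDerivAt_id x).const_mul (2 * Real.pi)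
  have hdq : ∀ x ∈ Set.Icc a b, HasDerivAt q (q' x) x := by
    intro x hx
    have h1 := ((hdlin x).sin.const_mul (2 * Real.pi * u)).inv
      (by have := hne x hx; positivity)
    simp only [hq, one_div]
    refine h1.congr_deriv ?_
    have := hne x hx
    simp only [hq']
    field_simp
  have hdF : ∀ x, HasDerivAt F (F x * ((u * (-Real.sin (2 * Real.pi * x) * (2 * Real.pi)) : ℝ)
      * Complex.I)) x := by
    intro x
    exact (((hdlin x).cos.const_mul u).ofReal_comp.mul_const Complex.I).cexp
  have hdG : ∀ x ∈ Set.uIcc a b, HasDerivAt (fun x => F x * ((q x : ℂ) * Complex.I))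
      (F x + F x * ((q' x : ℂ) * Complex.I)) x := by
    intro x hx
    rw [Set.uIcc_of_le hab] at hx
    refine ((hdF x).mul ((hdq x hx).ofReal_comp.mul_const Complex.I)).congr_deriv ?_
    congr 1
    symm
    have h0 := hne x hx
    have : ((u * (-Real.sin (2 * Real.pi * x) * (2 * Real.pi)) : ℝ) : ℂ) * (q x : ℂ) = -1 := by
      rw [← Complex.ofReal_mul]
      have : u * (-Real.sin (2 * Real.pi * x) * (2 * Real.pi)) * q x = -1 := by
        simp only [hq]; field_simp
      rw [this]; simp
    calc F x = F x * ((-1) * (Complex.I * Complex.I)) := by simp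
      _ = _ := by rw [← this]; ring
  have hcF : Continuous F := by simp only [hF]; fun_prop
  have hcq' : ContinuousOn q' (Set.uIcc a b) := by
    rw [Set.uIcc_of_le hab]
    simp only [hq']
    refine ContinuousOn.div (by fun_prop) (by fun_prop) fun x hx => ?_
    have := hne x hx; positivity
  have hci : ContinuousOn (fun x => F x * ((q' x : ℂ) * Complex.I)) (Set.uIcc a b) :=
    hcF.continuousOn.mul ((Complex.continuous_ofReal.comp_continuousOn hcq').mul
      continuousOn_const)
  have hftc := intervalIntegral.integral_eq_sub_of_hasDerivAt hdG
    ((hcF.intervalIntegrable _ _).add hci.intervalIntegrable)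
  rw [intervalIntegral.integral_add (hcF.intervalIntegrable _ _) hci.intervalIntegrable] at hftc
  have heq : ∫ x in a..b, F x = F b * ((q b : ℂ) * Complex.I) - F a * ((q a : ℂ) * Complex.I)
      - ∫ x in a..b, F x * ((q' x : ℂ) * Complex.I) := by rw [← hftc]; ring
  rw [heq]
  have hqb : ∀ x ∈ Set.Icc a b, ‖F x * ((q x : ℂ) * Complex.I)‖ ≤ 1 / (2 * u * m ^ 2) := by
    intro x hx
    rw [norm_mul, norm_mul, hFn, Complex.norm_I, Complex.norm_real, one_mul, mul_one]
    simp only [hq, norm_div, norm_mul, Real.norm_eq_abs, abs_one, Nat.abs_ofNat, abs_of_pos hpi,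
      abs_of_pos hu]
    have := hs x hx
    refine one_div_le_one_div_of_le (by positivity) ?_
    calc 2 * u * m ^ 2 = 2 * 1 * u * (m * m) := by ring
      _ ≤ 2 * Real.pi * u * (1 * |Real.sin (2 * Real.pi * x)|) := by
          gcongr
          linarith [Real.pi_gt_three]
      _ = _ := by ring
  have hq'b : ‖∫ x in a..b, F x * ((q' x : ℂ) * Complex.I)‖ ≤ 1 / (u * m ^ 2) := by
    refine (intervalIntegral.norm_integral_le_of_norm_le_const (C := 1 / (u * m ^ 2))
      fun x hx => ?_).trans ?_
    · rw [Set.uIoc_of_le hab] at hx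
      have hx' : x ∈ Set.Icc a b := ⟨hx.1.le, hx.2⟩
      rw [norm_mul, norm_mul, hFn, Complex.norm_I, Complex.norm_real, one_mul, mul_one]
      simp only [hq', norm_div, norm_mul, norm_pow, norm_neg, Real.norm_eq_abs, abs_of_pos hu]
      have := hs x hx'
      gcongr
      exact Real.abs_cos_le_one _
    · rw [abs_of_nonneg (by linarith)]
      have : 0 ≤ 1 / (u * m ^ 2) := by positivity
      nlinarith
  calc _ ≤ 1 / (2 * u * m ^ 2) + 1 / (2 * u * m ^ 2) + 1 / (u * m ^ 2) := by
        refine (norm_sub_le _ _).trans (add_le_add ((norm_sub_le _ _).trans (add_le_add ?_ ?_)) hq'b)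
        · exact hqb b ⟨hab, le_rfl⟩
        · exact hqb a ⟨le_rfl, hab⟩
    _ = 2 / (u * m ^ 2) := by field_simp; norm_num

lemma circleChar_eq_intervalIntegral (u : ℝ) : circleChar u =
    ∫ x in (0 : ℝ)..1, Complex.exp (((u * Real.cos (2 * Real.pi * x) : ℝ) : ℂ) * Complex.I) := by
  rw [circleChar, haarAddCircle_eq_volume, ← UnitAddCircle.intervalIntegral_preimage 0, zero_add]
  congr 1; ext x
  rw [unitPt_coe, Complex.exp_ofReal_mul_I_re]

/-- Jordan's inequality, applied directly up to 1/4 and after reflection beyond. -/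
lemma four_mul_le_sin {η x : ℝ} (hx : x ∈ Set.Icc η (1 / 2 - η)) (hη : 0 ≤ η) :
    4 * η ≤ Real.sin (2 * Real.pi * x) := by
  have hpi := Real.pi_pos
  rcases le_total x (1 / 4) with h | h
  · have := Real.mul_le_sin (x := 2 * Real.pi * x) (by have := hx.1; have : 0 ≤ x := by linarith
                                                       positivity) (by nlinarith)
    have h2 : 2 / Real.pi * (2 * Real.pi * x) = 4 * x := by field_simp; ring
    linarith [hx.1]
  · have := Real.mul_le_sin (x := Real.pi - 2 * Real.pi * x) (by nlinarith [hx.2])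
      (by nlinarith)
    have h2 : 2 / Real.pi * (Real.pi - 2 * Real.pi * x) = 2 - 4 * x := by field_simp; ring
    rw [Real.sin_pi_sub] at this
    linarith [hx.2]

/-- Neighbourhoods of the stationary points 0, 1/2, 1 of the phase are estimated by their length,
the rest by integration by parts. The exponent -1/2 is the true one, but any power saving will do:
more factors of the product can be used. -/
lemma norm_circleChar_le_rpow {u : ℝ} (hu : 1 ≤ u) :
    ‖circleChar u‖ ≤ 5 * u ^ (-(1 / 3) : ℝ) := by
  rw [circleChar_eq_intervalIntegral]
  set F : ℝ → ℂ := fun x => Complex.exp (((u * Real.cos (2 * Real.pi * x) : ℝ) : ℂ) * Complex.I)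
    with hF
  have hu0 : 0 < u := by linarith
  -- This width balances the short pieces, of total length v, against 2/(uv²) for each long one.
  set v : ℝ := u ^ (-(1 / 3) : ℝ) with hv
  have hv0 : 0 < v := Real.rpow_pos_of_pos hu0 _
  have hv1 : v ≤ 1 := Real.rpow_le_one_of_one_le_of_nonpos hu (by norm_num)
  have hv3 : u * v ^ 3 = 1 := by
    rw [hv, ← Real.rpow_natCast, ← Real.rpow_mul hu0.le]
    norm_num
    rw [Real.rpow_neg_one]; field_simp
  have hFi : ∀ a b, IntervalIntegrable F volume a b := fun a b =>
    Continuous.intervalIntegrable (by simp only [hF]; fun_prop) _ _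
  have hshort : ∀ a b, a ≤ b → ‖∫ x in a..b, F x‖ ≤ b - a := fun a b hab => by
    have := intervalIntegral.norm_integral_le_of_norm_le_const (a := a) (b := b) (C := 1) (f := F)
      fun x _ => (Complex.norm_exp_ofReal_mul_I _).le
    rwa [abs_of_nonneg (by linarith), one_mul] at this
  have hlong : ∀ a b, a ≤ b → b - a ≤ 1 →
      (∀ x ∈ Set.Icc a b, v ≤ |Real.sin (2 * Real.pi * x)|) → ‖∫ x in a..b, F x‖ ≤ 2 * v :=
    fun a b hab hab1 h => by
      refine (norm_integral_exp_cos_le hu0 hv0 hv1 hab hab1 h).trans (le_of_eq ?_)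
      rw [div_eq_iff (by positivity)]
      linear_combination (-2) * hv3
  have hsplit : ∫ x in (0 : ℝ)..1, F x = (∫ x in (0 : ℝ)..(v / 4), F x)
      + (∫ x in (v / 4)..(1 / 2 - v / 4), F x) + (∫ x in (1 / 2 - v / 4)..(1 / 2 + v / 4), F x)
      + (∫ x in (1 / 2 + v / 4)..(1 - v / 4), F x) + (∫ x in (1 - v / 4)..1, F x) := by
    rw [intervalIntegral.integral_add_adjacent_intervals (hFi _ _) (hFi _ _),
      intervalIntegral.integral_add_adjacent_intervals (hFi _ _) (hFi _ _),
      intervalIntegral.integral_add_adjacent_intervals (hFi _ _) (hFi _ _),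
      intervalIntegral.integral_add_adjacent_intervals (hFi _ _) (hFi _ _)]
  rw [hsplit]
  have e1 := hshort 0 (v / 4) (by linarith)
  have e3 := hshort (1 / 2 - v / 4) (1 / 2 + v / 4) (by linarith)
  have e5 := hshort (1 - v / 4) 1 (by linarith)
  have e2 := hlong (v / 4) (1 / 2 - v / 4) (by linarith) (by linarith) fun x hx => by
    have := four_mul_le_sin hx (by linarith)
    exact le_trans (by linarith) (le_abs_self _)
  have e4 := hlong (1 / 2 + v / 4) (1 - v / 4) (by linarith) (by linarith) fun x hx => by
    have := four_mul_le_sin (η := v / 4) (x := x - 1 / 2)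
      ⟨by linarith [hx.1], by linarith [hx.2]⟩ (by linarith)
    have h2 : Real.sin (2 * Real.pi * x) = - Real.sin (2 * Real.pi * (x - 1 / 2)) := by
      rw [← Real.sin_add_pi]; congr 1; ring
    rw [h2, abs_neg]
    exact le_trans (by linarith) (le_abs_self _)
  calc _ ≤ v / 4 + 2 * v + (v / 4 + v / 4) + 2 * v + v / 4 := by
        refine (norm_add_le _ _).trans (add_le_add ((norm_add_le _ _).trans (add_le_add
          ((norm_add_le _ _).trans (add_le_add ((norm_add_le _ _).trans (add_le_add ?_ e2)) ?_))
          e4)) ?_) <;> linarith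
    _ = 5 * v := by ring

end LerchMean

/-! ### Probability measures on the plane with integrable characteristic function. -/

namespace LerchMean
open MeasureTheory Filter Topology

open scoped FourierTransform RealInnerProductSpace in
-- With a Gaussian factor inserted, Fubini turns the Fourier integral into a positive Gaussian
-- integrated against μ. The non-negative reals are closed in ℂ, so positivity survives removal of
-- the factor.
lemma re_nonneg_fourier_charFun (μ : Measure ℂ) [IsProbabilityMeasure μ]
    (h : Integrable fun ξ : ℂ => charFun μ ((2 * Real.pi) • ξ)) (v : ℂ) :
    (𝓕 (fun ξ : ℂ => charFun μ ((2 * Real.pi) • ξ)) v).im = 0 ∧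
      0 ≤ (𝓕 (fun ξ : ℂ => charFun μ ((2 * Real.pi) • ξ)) v).re := by
  set H : ℂ → ℂ := fun ξ : ℂ => charFun μ ((2 * Real.pi) • ξ) with hH
  set f : ℂ → ℂ := fun w => Complex.exp (((-2 * Real.pi * ⟪w, v⟫ : ℝ) : ℂ) * Complex.I) • H w
    with hf
  have hfint : Integrable f := by
    refine h.bdd_mul (c := 1) (by fun_prop) (ae_of_all _ fun w => ?_)
    rw [Complex.norm_exp_ofReal_mul_I]
  have hlim := Real.tendsto_integral_cexp_sq_smul hfint
  rw [← Real.fourier_eq'] at hlim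
  have hclosed : IsClosed {z : ℂ | z.im = 0 ∧ 0 ≤ z.re} :=
    (isClosed_eq Complex.continuous_im continuous_const).inter
      (isClosed_le continuous_const Complex.continuous_re)
  refine hclosed.mem_of_tendsto hlim ?_
  filter_upwards [eventually_gt_atTop 0] with c hc
  have hb : 0 < ((c⁻¹ : ℝ) : ℂ).re := by simpa using hc
  have hgauss : Integrable (fun w : ℂ => Complex.exp (-((c⁻¹ : ℝ) : ℂ) * ‖w‖ ^ 2)) := by
    simpa using GaussianFourier.integrable_cexp_neg_mul_sq_norm_add hb 0 (0 : ℂ)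
  have key : ∀ w : ℂ, Complex.exp (-((c⁻¹ : ℝ) : ℂ) * ‖w‖ ^ 2) • f w =
      ∫ x, Complex.exp (-((c⁻¹ : ℝ) : ℂ) * ‖w‖ ^ 2 + (2 * Real.pi * Complex.I) * ⟪x - v, w⟫) ∂μ := by
    intro w
    simp only [hf, hH, charFun_apply, smul_eq_mul]
    rw [← integral_const_mul, ← integral_const_mul]
    congr 1; ext x
    rw [← Complex.exp_add, ← Complex.exp_add]
    congr 1
    rw [inner_smul_right, inner_sub_left, real_inner_comm w v]
    push_cast
    ring
  simp only [key]
  rw [integral_integral_swap]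
  · have : ∀ x : ℂ, ∫ w : ℂ, Complex.exp (-((c⁻¹ : ℝ) : ℂ) * ‖w‖ ^ 2 +
        (2 * Real.pi * Complex.I) * ⟪x - v, w⟫)
        = ((Real.pi / c⁻¹ * Real.exp (-(Real.pi ^ 2 * ‖x - v‖ ^ 2 / c⁻¹)) : ℝ) : ℂ) := by
      intro x
      rw [GaussianFourier.integral_cexp_neg_mul_sq_norm_add hb]
      rw [Complex.finrank_real_complex]
      push_cast
      rw [div_self (two_ne_zero), Complex.cpow_one]
      congr 2
      rw [mul_pow, Complex.I_sq]
      ring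
    simp only [this]
    rw [integral_complex_ofReal]
    refine ⟨Complex.ofReal_im _, ?_⟩
    rw [Complex.ofReal_re]
    exact integral_nonneg fun x => by positivity
  · have hp : Integrable (fun p : ℂ × ℂ => Complex.exp (-((c⁻¹ : ℝ) : ℂ) * ‖p.1‖ ^ 2) * (1 : ℂ))
        (volume.prod μ) := hgauss.mul_prod (integrable_const (1 : ℂ))
    refine hp.mono (by fun_prop) (ae_of_all _ fun p => ?_)
    simp only [Function.uncurry, mul_one]
    rw [Complex.exp_add, norm_mul]
    have : (2 * Real.pi * Complex.I) * ((⟪p.2 - v, p.1⟫ : ℝ) : ℂ)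
        = ((2 * Real.pi * ⟪p.2 - v, p.1⟫ : ℝ) : ℂ) * Complex.I := by push_cast; ring
    rw [this, Complex.norm_exp_ofReal_mul_I, mul_one]

open scoped FourierTransform RealInnerProductSpace in
-- Moving the transform onto a Gaussian weight g gives ∫ g·𝓕H = ∫ 𝓕g·H, which is at most ∫ 𝓕g = 1 in
-- modulus because |H| ≤ 1. As 𝓕H is non-negative, Fatou's lemma lets the weight tend to 1.
lemma integrable_fourier_charFun (μ : Measure ℂ) [IsProbabilityMeasure μ]
    (h : Integrable fun ξ : ℂ => charFun μ ((2 * Real.pi) • ξ)) :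
    Integrable (𝓕 (fun ξ : ℂ => charFun μ ((2 * Real.pi) • ξ))) := by
  set H : ℂ → ℂ := fun ξ : ℂ => charFun μ ((2 * Real.pi) • ξ) with hH
  have hpos : ∀ v, 𝓕 H v = (((𝓕 H v).re : ℝ) : ℂ) ∧ 0 ≤ (𝓕 H v).re := fun v => by
    have := re_nonneg_fourier_charFun μ h v
    exact ⟨Complex.ext rfl (by rw [Complex.ofReal_im]; exact this.1), this.2⟩
  have hcont : Continuous (𝓕 H) :=
    VectorFourier.fourierIntegral_continuous Real.continuous_fourierChar
      (by exact continuous_inner) h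
  have hgauss : ∀ b : ℝ, 0 < b → ∫⁻ v, ENNReal.ofReal (Real.exp (-b * ‖v‖ ^ 2) * (𝓕 H v).re) ≤ 1 := by
    intro b hb
    have hb' : 0 < (b : ℂ).re := hb
    set g : ℂ → ℂ := fun v => Complex.exp (-(b : ℂ) * ‖v‖ ^ 2) with hg
    have hgi : Integrable g := by
      simpa [hg] using GaussianFourier.integrable_cexp_neg_mul_sq_norm_add hb' 0 (0 : ℂ)
    have hflip : ∫ ξ, (𝓕 g ξ) • H ξ = ∫ v, g v • 𝓕 H v := by
      simpa using! (VectorFourier.integral_fourierIntegral_smul_eq_flip (L := innerₗ ℂ)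
        Real.continuous_fourierChar continuous_inner hgi h)
    have hFg : ∀ ξ, 𝓕 g ξ = ((Real.pi / b * Real.exp (-(Real.pi ^ 2 / b) * ‖ξ‖ ^ 2) : ℝ) : ℂ) := by
      intro ξ
      rw [hg, fourier_gaussian_innerProductSpace hb', Complex.finrank_real_complex]
      push_cast
      rw [div_self (two_ne_zero), Complex.cpow_one]
      congr 2
      ring
    have hgre : ∀ v, g v = ((Real.exp (-b * ‖v‖ ^ 2) : ℝ) : ℂ) := fun v => by
      simp only [hg]; push_cast; rfl
    have hFHb : ∃ C, ∀ v, ‖𝓕 H v‖ ≤ C :=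
      ⟨_, fun v => VectorFourier.norm_fourierIntegral_le_integral_norm _ _ _ _ v⟩
    obtain ⟨C, hC⟩ := hFHb
    have hprod : Integrable (fun v => g v • 𝓕 H v) := by
      simp only [smul_eq_mul]
      exact hgi.mul_bdd (c := C) hcont.aestronglyMeasurable (ae_of_all _ hC)
    have hreal : ∀ v, g v • 𝓕 H v = ((Real.exp (-b * ‖v‖ ^ 2) * (𝓕 H v).re : ℝ) : ℂ) := by
      intro v
      rw [hgre, smul_eq_mul]
      conv_lhs => rw [(hpos v).1]
      push_cast; rfl
    have hbound : ‖∫ ξ, (𝓕 g ξ) • H ξ‖ ≤ 1 := by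
      have hInt : Integrable fun ξ : ℂ => Real.pi / b * Real.exp (-(Real.pi ^ 2 / b) * ‖ξ‖ ^ 2) := by
        have hb2 : 0 < ((Real.pi ^ 2 / b : ℝ) : ℂ).re := by
          rw [Complex.ofReal_re]; positivity
        have := (GaussianFourier.integrable_cexp_neg_mul_sq_norm_add hb2 0 (0 : ℂ)).re
        refine (this.const_mul (Real.pi / b)).congr (ae_of_all _ fun x => ?_)
        simp only [zero_mul, add_zero]
        congr 1
        rw [← Complex.ofReal_pow, ← Complex.ofReal_neg, ← Complex.ofReal_mul]
        exact Complex.exp_ofReal_re _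
      have h1 : ∫ ξ : ℂ, Real.pi / b * Real.exp (-(Real.pi ^ 2 / b) * ‖ξ‖ ^ 2) = 1 := by
        rw [integral_const_mul, GaussianFourier.integral_rexp_neg_mul_sq_norm (by positivity),
          Complex.finrank_real_complex]
        have := Real.pi_pos
        norm_num
        field_simp
      rw [← h1]
      refine norm_integral_le_of_norm_le hInt (ae_of_all _ fun ξ => ?_)
      rw [norm_smul, hFg, Complex.norm_real, Real.norm_of_nonneg (by positivity)]
      exact mul_le_of_le_one_right (by positivity) (norm_charFun_le_one _)
    rw [hflip] at hbound
    simp only [hreal] at hbound hprod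
    rw [integral_complex_ofReal, Complex.norm_real] at hbound
    rw [← ofReal_integral_eq_lintegral_ofReal]
    · rw [← ENNReal.ofReal_one]
      exact ENNReal.ofReal_le_ofReal ((le_abs_self _).trans hbound)
    · exact hprod.re.congr (ae_of_all _ fun v => Complex.ofReal_re _)
    · exact ae_of_all _ fun v => mul_nonneg (Real.exp_pos _).le (hpos v).2
  refine ⟨hcont.aestronglyMeasurable, ?_⟩
  rw [hasFiniteIntegral_iff_norm]
  have hnorm : ∀ v, ‖𝓕 H v‖ = (𝓕 H v).re := fun v => by
    conv_lhs => rw [(hpos v).1]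
    rw [Complex.norm_real, Real.norm_of_nonneg (hpos v).2]
  simp only [hnorm]
  refine lt_of_le_of_lt ?_ ENNReal.one_lt_top
  have hlim : ∀ v : ℂ, Tendsto (fun n : ℕ => ENNReal.ofReal
      (Real.exp (-(1 / ((n : ℝ) + 1)) * ‖v‖ ^ 2) * (𝓕 H v).re)) atTop
      (𝓝 (ENNReal.ofReal ((𝓕 H v).re))) := by
    intro v
    refine ENNReal.tendsto_ofReal ?_
    have h0 := tendsto_one_div_add_atTop_nhds_zero_nat (𝕜 := ℝ)
    have := ((Real.continuous_exp.tendsto _).comp (h0.neg.mul_const (‖v‖ ^ 2))).mul_const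
      ((𝓕 H v).re)
    simpa using this
  have hmeas : ∀ n : ℕ, Measurable fun v : ℂ => ENNReal.ofReal
      (Real.exp (-(1 / ((n : ℝ) + 1)) * ‖v‖ ^ 2) * (𝓕 H v).re) := by
    intro n
    have := hcont.measurable
    fun_prop
  have hfatou := lintegral_liminf_le (μ := (volume : Measure ℂ)) (u := atTop) hmeas
  rw [lintegral_congr fun v => (hlim v).liminf_eq] at hfatou
  refine hfatou.trans (liminf_le_of_frequently_le' (Frequently.of_forall fun n => ?_))
  exact hgauss _ (by positivity)

open scoped FourierTransform RealInnerProductSpace in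
/-- A probability measure on `ℂ` with integrable characteristic function has a continuous
density. -/
lemma exists_continuous_density (μ : Measure ℂ) [IsProbabilityMeasure μ]
    (hμ : Integrable (charFun μ)) :
    ∃ M : ℂ → ℝ, Continuous M ∧ (∀ z, 0 ≤ M z) ∧
      μ = dz.withDensity fun z => ENNReal.ofReal (M z) := by
  have hpi : (2 * Real.pi) ≠ 0 := by positivity
  have h : Integrable fun ξ : ℂ => charFun μ ((2 * Real.pi) • ξ) := hμ.comp_smul hpi
  set H : ℂ → ℂ := fun ξ : ℂ => charFun μ ((2 * Real.pi) • ξ) with hH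
  have hpos := re_nonneg_fourier_charFun μ h
  have hInt := integrable_fourier_charFun μ h
  have hcont : Continuous (𝓕 H) :=
    VectorFourier.fourierIntegral_continuous Real.continuous_fourierChar
      (by exact continuous_inner) h
  have hHcont : Continuous H := continuous_charFun.comp (by fun_prop)
  have hinv : 𝓕⁻ (𝓕 H) = H := hHcont.fourierInv_fourier_eq h hInt
  set m : ℂ → ℝ := fun v => (𝓕 H v).re with hm
  have hmc : Continuous m := Complex.continuous_re.comp hcont
  have hm0 : ∀ v, 0 ≤ m v := fun v => (hpos v).2
  have hmi : Integrable m := hInt.re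
  have hFm : ∀ v, 𝓕 H v = (m v : ℂ) := fun v => Complex.ext rfl (by rw [Complex.ofReal_im]; exact (hpos v).1)
  set ν : Measure ℂ := volume.withDensity fun z => ENNReal.ofReal (m z) with hν
  have hνfin : IsFiniteMeasure ν := isFiniteMeasure_withDensity_ofReal hmi.2
  -- Fourier inversion says precisely that ν has the characteristic function of μ; the dilation by
  -- 2π reconciles the two normalisations of the character.
  have hμν : μ = ν := by
    refine Measure.ext_of_charFun ?_
    ext t
    have e1 : charFun μ t = H ((2 * Real.pi)⁻¹ • t) := by
      simp only [hH, smul_smul, mul_inv_cancel₀ hpi, one_smul]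
    rw [e1, ← hinv, Real.fourierInv_eq', charFun_apply, hν,
      integral_withDensity_eq_integral_toReal_smul (by fun_prop) (ae_of_all _ fun x => by simp)]
    congr 1; ext x
    rw [hFm, ENNReal.toReal_ofReal (hm0 x), inner_smul_right, smul_eq_mul, Complex.real_smul,
      mul_comm]
    congr 3
    field_simp
  -- The factor 2π compensates the (2π)⁻¹ in `dz`.
  refine ⟨fun z => 2 * Real.pi * m z, by fun_prop, fun z => mul_nonneg (by positivity) (hm0 z), ?_⟩
  rw [hμν, hν, dz, withDensity_smul_measure, ← withDensity_smul _ (by fun_prop)]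
  congr 1; ext z
  simp only [Pi.smul_apply, smul_eq_mul]
  rw [← ENNReal.ofReal_mul (by positivity)]
  congr 1
  field_simp

end LerchMean

/-! ### The infinite convolution and its density. -/

namespace LerchMean
open MeasureTheory Filter Topology

lemma charFun_circleEquidist (r : ℝ) (hr : 0 ≤ r) (w : ℂ) :
    charFun (circleEquidist r : Measure ℂ) w = circleChar (‖w‖ * r) := by
  have hm : Measurable fun x : UnitAddCircle => (r : ℂ) * unitPt x :=
    (continuous_const.mul continuous_unitPt).measurable
  have h1 : (circleEquidist r : Measure ℂ)
      = (AddCircle.haarAddCircle : Measure UnitAddCircle).map (fun x => (r : ℂ) * unitPt x) := rfl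
  rw [h1, charFun_apply, integral_map hm.aemeasurable (by fun_prop)]
  have h2 := integral_exp_re_mul_toCircle ((starRingEnd ℂ) w * r)
  rw [norm_mul, RCLike.norm_conj, Complex.norm_real, Real.norm_of_nonneg hr] at h2
  rw [← h2]
  congr 1; ext x
  congr 3
  rw [real_inner_comm, Complex.inner]
  ring_nf

/-- The radius `(k + α)^{-σ}` of the `k`-th circle. -/
noncomputable def radius (σ α : ℝ) (k : ℕ) : ℝ := ((k : ℝ) + α) ^ (-σ)

lemma radius_pos {α : ℝ} (hα : 0 < α) (σ : ℝ) (k : ℕ) : 0 < radius σ α k :=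
  Real.rpow_pos_of_pos (by positivity) _

lemma charFun_partialConv {σ α : ℝ} (hα : 0 < α) (n : ℕ) (w : ℂ) :
    charFun (partialConv σ α n : Measure ℂ) w
      = ∏ k ∈ Finset.range (n + 1), circleChar (‖w‖ * radius σ α k) := by
  induction n with
  | zero =>
    rw [Finset.prod_range_one]
    exact charFun_circleEquidist _ (radius_pos hα σ 0).le w
  | succ n ih =>
    rw [Finset.prod_range_succ, ← ih]
    have : (partialConv σ α (n + 1) : Measure ℂ)
      = Measure.conv (partialConv σ α n : Measure ℂ)
        (circleEquidist (radius σ α (n + 1)) : Measure ℂ) := rfl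
    rw [this, charFun_conv, charFun_circleEquidist _ (radius_pos hα σ (n + 1)).le w]

lemma norm_prod_le_one {ι : Type*} (s : Finset ι) {a : ι → ℂ} (ha : ∀ i, ‖a i‖ ≤ 1) :
    ‖∏ i ∈ s, a i‖ ≤ 1 := by
  rw [norm_prod]
  exact Finset.prod_le_one (fun _ _ => norm_nonneg _) fun i _ => ha i

/-- Factors are added one at a time; each step changes the product by at most the distance of the
new factor from 1. -/
lemma norm_prod_range_sub_le {a : ℕ → ℂ} (ha : ∀ i, ‖a i‖ ≤ 1) {N M : ℕ} (hNM : N ≤ M) :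
    ‖∏ i ∈ Finset.range M, a i - ∏ i ∈ Finset.range N, a i‖
      ≤ ∑ i ∈ Finset.Ico N M, ‖a i - 1‖ := by
  induction M, hNM using Nat.le_induction with
  | base => simp
  | succ M hNM ih =>
    rw [Finset.sum_Ico_succ_top hNM, Finset.prod_range_succ]
    have : (∏ i ∈ Finset.range M, a i) * a M - ∏ i ∈ Finset.range N, a i
        = (∏ i ∈ Finset.range M, a i - ∏ i ∈ Finset.range N, a i)
          + (∏ i ∈ Finset.range M, a i) * (a M - 1) := by ring
    rw [this]
    refine (norm_add_le _ _).trans (add_le_add ih ?_)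
    rw [norm_mul]
    exact mul_le_of_le_one_left (norm_nonneg _) (norm_prod_le_one _ ha)

lemma norm_prod_circleChar_sub_le (r : ℕ → ℝ) (x : ℝ) {N M : ℕ} (hNM : N ≤ M) :
    ‖∏ k ∈ Finset.range M, circleChar (x * r k) - ∏ k ∈ Finset.range N, circleChar (x * r k)‖
      ≤ x ^ 2 / 2 * ∑ k ∈ Finset.Ico N M, r k ^ 2 := by
  refine (norm_prod_range_sub_le (fun i => norm_circleChar_le_one _) hNM).trans ?_
  rw [Finset.mul_sum]
  refine Finset.sum_le_sum fun i _ => (norm_circleChar_sub_one_le _).trans (le_of_eq ?_)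
  ring

lemma summable_radius_sq {σ α : ℝ} (hα : 0 < α) (hσ : 1 / 2 < σ) :
    Summable fun k => radius σ α k ^ 2 := by
  have h := (Real.summable_nat_rpow (p := -(2 * σ))).2 (by linarith)
  rw [← summable_nat_add_iff 1] at h ⊢
  refine Summable.of_nonneg_of_le (fun k => sq_nonneg _) (fun k => ?_) h
  rw [radius, ← Real.rpow_natCast, ← Real.rpow_mul (by positivity)]
  have : (-σ * ((2 : ℕ) : ℝ)) = -(2 * σ) := by push_cast; ring
  rw [this]
  exact Real.rpow_le_rpow_of_nonpos (by positivity) (by linarith) (by linarith)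

lemma exists_tendsto_prod_circleChar {r : ℕ → ℝ} (hr : Summable fun k => r k ^ 2) (x : ℝ) :
    ∃ z : ℂ, Tendsto (fun n => ∏ k ∈ Finset.range n, circleChar (x * r k)) atTop (𝓝 z) := by
  refine cauchySeq_tendsto_of_complete ?_
  rw [Metric.cauchySeq_iff']
  intro ε hε
  have h1 := hr.hasSum.tendsto_sum_nat.const_mul (x ^ 2 / 2)
  have h2 := h1.cauchySeq
  rw [Metric.cauchySeq_iff'] at h2
  obtain ⟨N, hN⟩ := h2 ε hε
  refine ⟨N, fun n hn => ?_⟩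
  rw [dist_eq_norm]
  refine (norm_prod_circleChar_sub_le r x hn).trans_lt ?_
  have := hN n hn
  rw [dist_eq_norm, ← mul_sub, ← Finset.sum_Ico_eq_sub _ hn] at this
  exact (le_abs_self _).trans_lt this

/-- Lévy's continuity theorem, where f is not known beforehand to be a characteristic function.
Continuity at 0 gives tightness, Prokhorov's theorem a cluster point, and its characteristic
function must be f. -/
lemma exists_tendsto_of_charFun {μ : ℕ → ProbabilityMeasure ℂ} {f : ℂ → ℂ}
    (hf : ContinuousAt f 0)
    (h : ∀ t, Tendsto (fun n => charFun (μ n : Measure ℂ) t) atTop (𝓝 (f t))) :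
    ∃ φ : ProbabilityMeasure ℂ, Tendsto μ atTop (𝓝 φ) := by
  have htight := isTightMeasureSet_of_tendsto_charFun hf h
  have hcomp : IsCompact (closure (Set.range μ)) := by
    refine isCompact_closure_of_isTightMeasureSet ?_
    convert htight using 1
    ext ν
    simp
  obtain ⟨φ, -, hφ⟩ := hcomp.exists_mapClusterPt (f := atTop) (u := μ)
    (by
      rw [Filter.le_principal_iff]
      exact Filter.mem_map.2 (Filter.univ_mem' fun n => subset_closure ⟨n, rfl⟩))
  refine ⟨φ, ProbabilityMeasure.tendsto_of_tendsto_charFun fun t => ?_⟩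
  have hc : Continuous fun ν : ProbabilityMeasure ℂ => charFun (ν : Measure ℂ) t := by
    rw [continuous_iff_continuousAt]
    intro ν
    have h1 : Tendsto (fun ν : ProbabilityMeasure ℂ => ν) (𝓝 ν) (𝓝 ν) := tendsto_id
    rw [ProbabilityMeasure.tendsto_iff_forall_integral_rclike_tendsto ℂ] at h1
    have h2 := h1 (BoundedContinuousFunction.innerProbChar t)
    simp only [← charFun_eq_integral_innerProbChar] at h2
    exact h2
  have h3 : MapClusterPt (charFun (φ : Measure ℂ) t) atTop
      ((fun ν : ProbabilityMeasure ℂ => charFun (ν : Measure ℂ) t) ∘ μ) :=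
    hφ.continuousAt_comp hc.continuousAt
  have h4 : charFun (φ : Measure ℂ) t = f t :=
    eq_of_nhds_neBot (h3.clusterPt.mono (h t))
  rw [h4]; exact h t

lemma norm_circleChar_le {u : ℝ} (hu : 0 ≤ u) :
    ‖circleChar u‖ ≤ 10 * (1 + u) ^ (-(1 / 3) : ℝ) := by
  have h2 : (2 : ℝ) ^ (-(1 / 3) : ℝ) ≥ 1 / 2 := by
    have := Real.rpow_le_rpow_of_exponent_le (x := 2) (by norm_num) (show (-1 : ℝ) ≤ -(1 / 3) by norm_num)
    rw [Real.rpow_neg_one] at this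
    linarith
  rcases le_total u 1 with h | h
  · refine (norm_circleChar_le_one u).trans ?_
    have := Real.rpow_le_rpow_of_nonpos (x := 1 + u) (y := 2) (z := (-(1 / 3) : ℝ)) (by linarith)
      (by linarith) (by norm_num)
    linarith
  · refine (norm_circleChar_le_rpow h).trans ?_
    have := Real.rpow_le_rpow_of_nonpos (x := 1 + u) (y := 2 * u) (z := (-(1 / 3) : ℝ))
      (by linarith) (by linarith) (by norm_num)
    rw [Real.mul_rpow (by norm_num) hu] at this
    have hp : 0 ≤ u ^ (-(1 / 3) : ℝ) := Real.rpow_nonneg hu _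
    nlinarith

/-- Seven factors of decay 1/3 give the exponent 7/3, which exceeds the real dimension 2; six would
not suffice. -/
lemma integrable_of_norm_le_prod {f : ℂ → ℂ} (hf : Continuous f) {r : ℕ → ℝ} (hr : ∀ k, 0 < r k)
    (h : ∀ w, ‖f w‖ ≤ ∏ k ∈ Finset.range 7, ‖circleChar (‖w‖ * r k)‖) : Integrable f := by
  have hbd : ∀ k, ∀ w : ℂ, ‖circleChar (‖w‖ * r k)‖
      ≤ 10 * min 1 (r k) ^ (-(1 / 3) : ℝ) * (1 + ‖w‖) ^ (-(1 / 3) : ℝ) := by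
    intro k w
    have hm : 0 < min 1 (r k) := lt_min one_pos (hr k)
    refine (norm_circleChar_le (mul_nonneg (norm_nonneg _) (hr k).le)).trans ?_
    rw [mul_assoc, ← Real.mul_rpow hm.le (by positivity)]
    refine mul_le_mul_of_nonneg_left
      (Real.rpow_le_rpow_of_nonpos (by positivity) ?_ (by norm_num)) (by norm_num)
    have h1 := min_le_left 1 (r k)
    have h2 := mul_le_mul_of_nonneg_right (min_le_right 1 (r k)) (norm_nonneg w)
    linarith
  have hInt : Integrable fun w : ℂ => (∏ k ∈ Finset.range 7, 10 * min 1 (r k) ^ (-(1 / 3) : ℝ))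
      * (1 + ‖w‖) ^ (-(7 / 3) : ℝ) := by
    refine (integrable_one_add_norm (r := 7 / 3) ?_).const_mul _
    rw [Complex.finrank_real_complex]; norm_num
  refine hInt.mono' hf.aestronglyMeasurable (ae_of_all _ fun w => (h w).trans ?_)
  refine (Finset.prod_le_prod (fun _ _ => norm_nonneg _) fun k _ => hbd k w).trans (le_of_eq ?_)
  rw [Finset.prod_mul_distrib, Finset.prod_const, Finset.card_range, ← Real.rpow_natCast,
    ← Real.rpow_mul (by positivity)]
  norm_num

/-- For σ > 1/2 the radii are square summable, so the finite products converge, to a limit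
continuous at 0 with value 1. Any seven factors dominate the limit and make it integrable. -/
lemma exists_isLimitDensity {σ α : ℝ} (hα : 0 < α) (hσ : 1 / 2 < σ) :
    ∃ M, IsLimitDensity σ α M := by
  have hs := summable_radius_sq hα hσ
  choose g hg using fun x : ℝ => exists_tendsto_prod_circleChar hs x
  have hch : ∀ w : ℂ, Tendsto (fun n => charFun (partialConv σ α n : Measure ℂ) w) atTop
      (𝓝 (g ‖w‖)) := fun w => by
    simp only [charFun_partialConv hα]
    exact (hg ‖w‖).comp (tendsto_add_atTop_nat 1)
  have hg0 : ∀ x : ℝ, ‖g x - 1‖ ≤ x ^ 2 / 2 * ∑' k, radius σ α k ^ 2 := by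
    intro x
    have h1 : Tendsto (fun n => ‖∏ k ∈ Finset.range n, circleChar (x * radius σ α k) - 1‖) atTop
      (𝓝 ‖g x - 1‖) := ((hg x).sub_const 1).norm
    refine le_of_tendsto h1 (Eventually.of_forall fun n => ?_)
    have := norm_prod_circleChar_sub_le (radius σ α) x (Nat.zero_le n)
    rw [Finset.prod_range_zero] at this
    refine this.trans (mul_le_mul_of_nonneg_left ?_ (by positivity))
    exact hs.sum_le_tsum _ fun _ _ => sq_nonneg _
  have hcont : ContinuousAt (fun w : ℂ => g ‖w‖) 0 := by
    have hg1 : g 0 = 1 := by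
      have := hg0 0
      simp only [ne_eq, OfNat.ofNat_ne_zero, not_false_eq_true, zero_pow, zero_div, zero_mul,
        norm_le_zero_iff] at this
      exact sub_eq_zero.1 this
    rw [ContinuousAt, norm_zero, hg1, tendsto_iff_norm_sub_tendsto_zero]
    refine squeeze_zero (fun _ => norm_nonneg _) (fun w => hg0 ‖w‖) ?_
    have : Continuous fun w : ℂ => ‖w‖ ^ 2 / 2 * ∑' k, radius σ α k ^ 2 := by fun_prop
    simpa using this.tendsto 0
  obtain ⟨φ, hφ⟩ := exists_tendsto_of_charFun hcont hch
  have hφc := ProbabilityMeasure.tendsto_iff_tendsto_charFun.1 hφ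
  have hInt : Integrable (charFun (φ : Measure ℂ)) := by
    refine integrable_of_norm_le_prod continuous_charFun (radius_pos hα σ) fun w => ?_
    refine le_of_tendsto (hφc w).norm ?_
    -- The n-th convolution has n + 1 factors, hence at least seven.
    filter_upwards [eventually_ge_atTop 6] with n hn
    rw [charFun_partialConv hα, norm_prod]
    rw [← Finset.prod_range_mul_prod_Ico _ (show 7 ≤ n + 1 by omega)]
    exact mul_le_of_le_one_right (Finset.prod_nonneg fun _ _ => norm_nonneg _)
      (Finset.prod_le_one (fun _ _ => norm_nonneg _) fun _ _ => norm_circleChar_le_one _)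
  obtain ⟨M, hM, hM0, hMd⟩ := exists_continuous_density (φ : Measure ℂ) hInt
  exact ⟨M, hM, hM0, φ, hφ, hMd⟩

lemma isLimitDensity_densityM {σ α : ℝ} (hα : 0 < α) (hσ : 1 / 2 < σ) :
    IsLimitDensity σ α (densityM σ α) :=
  Classical.epsilon_spec (exists_isLimitDensity hα hσ)

/-- The characteristic function of the limit distribution is close to a finite product. -/
lemma norm_charFun_limit_sub_prod_le {σ α : ℝ} (hα : 0 < α)
    {φ : ProbabilityMeasure ℂ} (hφ : Tendsto (partialConv σ α) atTop (𝓝 φ)) {N : ℕ} {B : ℝ}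
    (hB : ∀ M, ∑ k ∈ Finset.Ico N M, radius σ α k ^ 2 ≤ B) (w : ℂ) :
    ‖charFun (φ : Measure ℂ) w - ∏ k ∈ Finset.range N, circleChar (‖w‖ * radius σ α k)‖
      ≤ ‖w‖ ^ 2 / 2 * B := by
  have h := ProbabilityMeasure.tendsto_iff_tendsto_charFun.1 hφ w
  refine le_of_tendsto (h.sub_const _).norm ?_
  filter_upwards [eventually_ge_atTop N] with n hn
  rw [charFun_partialConv hα]
  refine (norm_prod_circleChar_sub_le _ _ (by omega)).trans ?_
  gcongr
  exact hB _

end LerchMean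

/-! ### Method of moments: trigonometric polynomials and their random model. -/

namespace LerchMean
open MeasureTheory Filter Topology

/-- The uniform probability measure on `(0, T]`. -/
noncomputable def avg (T : ℝ) : Measure ℝ :=
  ENNReal.ofReal T⁻¹ • (volume.restrict (Set.Ioc 0 T))

lemma isProbabilityMeasure_avg {T : ℝ} (hT : 0 < T) : IsProbabilityMeasure (avg T) := by
  constructor
  rw [avg, Measure.smul_apply, Measure.restrict_apply MeasurableSet.univ, Set.univ_inter,
    Real.volume_Ioc, sub_zero, smul_eq_mul, ← ENNReal.ofReal_mul (by positivity),
    inv_mul_cancel₀ hT.ne', ENNReal.ofReal_one]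

lemma integral_avg {E : Type*} [NormedAddCommGroup E] [NormedSpace ℝ E] {T : ℝ} (hT : 0 < T)
    (f : ℝ → E) : ∫ t, f t ∂avg T = T⁻¹ • ∫ t in (0 : ℝ)..T, f t := by
  rw [avg, integral_smul_measure, intervalIntegral.integral_of_le hT.le,
    ENNReal.toReal_ofReal (by positivity)]

lemma integrable_avg_of_continuous {E : Type*} [NormedAddCommGroup E] {T : ℝ} {f : ℝ → E}
    (hf : Continuous f) : Integrable f (avg T) := by
  refine Integrable.smul_measure ?_ ENNReal.ofReal_ne_top
  exact (hf.integrableOn_Icc (a := 0) (b := T)).mono_set Set.Ioc_subset_Icc_self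

lemma norm_integral_avg_exp_le {T f : ℝ} (hT : 0 < T) (hf : f ≠ 0) :
    ‖∫ t, Complex.exp (((-(t * f) : ℝ) : ℂ) * Complex.I) ∂avg T‖ ≤ 2 / (T * |f|) := by
  rw [integral_avg hT]
  have hc : (-(f : ℂ) * Complex.I) ≠ 0 := by simpa using hf
  have h1 : ∀ t : ℝ, (((-(t * f) : ℝ) : ℂ) * Complex.I) = (-(f : ℂ) * Complex.I) * t := fun t => by
    push_cast; ring
  simp only [h1]
  rw [integral_exp_mul_complex hc, norm_smul, norm_div, norm_mul, norm_neg, Complex.norm_I, mul_one,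
    Complex.norm_real, Real.norm_eq_abs f, Real.norm_of_nonneg (inv_nonneg.2 hT.le)]
  have h2 : ‖Complex.exp (-(f : ℂ) * Complex.I * (T : ℝ)) - Complex.exp (-(f : ℂ) * Complex.I * (0 : ℝ))‖
      ≤ 2 := by
    refine (norm_sub_le _ _).trans ?_
    rw [← h1, ← h1, Complex.norm_exp_ofReal_mul_I, Complex.norm_exp_ofReal_mul_I]
    norm_num
  rw [inv_mul_eq_div, div_div, mul_comm |f|]
  gcongr

lemma norm_integral_exp_sub_sum_le {X : Type*} [MeasurableSpace X] (μ : Measure X)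
    [IsProbabilityMeasure μ] {P : X → ℝ} (hP : ∀ m : ℕ, Integrable (fun x => P x ^ m) μ) (n : ℕ) :
    ‖∫ x, Complex.exp (P x * Complex.I) ∂μ
      - ∑ m ∈ Finset.range n, Complex.I ^ m / (m.factorial : ℂ) * ((∫ x, P x ^ m ∂μ : ℝ) : ℂ)‖
      ≤ (∫ x, |P x| ^ n ∂μ) / n.factorial := by
  have hPm : AEStronglyMeasurable P μ := by simpa using (hP 1).1
  have he : Integrable (fun x => Complex.exp (P x * Complex.I)) μ := by
    refine Integrable.of_bound (C := 1) ?_ (ae_of_all _ fun x => ?_)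
    · exact (Complex.continuous_exp.comp_aestronglyMeasurable
        ((Complex.continuous_ofReal.comp_aestronglyMeasurable hPm).mul_const _))
    · rw [Complex.norm_exp_ofReal_mul_I]
  have hterm : ∀ m : ℕ, Integrable (fun x => (P x * Complex.I) ^ m / (m.factorial : ℂ)) μ := by
    intro m
    have := ((hP m).ofReal (𝕜 := ℂ)).const_mul (Complex.I ^ m / (m.factorial : ℂ))
    refine this.congr (ae_of_all _ fun x => ?_)
    simp only [Complex.coe_algebraMap, mul_pow]
    push_cast
    ring
  have hsum : ∑ m ∈ Finset.range n, Complex.I ^ m / (m.factorial : ℂ) * ((∫ x, P x ^ m ∂μ : ℝ) : ℂ)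
      = ∫ x, ∑ m ∈ Finset.range n, (P x * Complex.I) ^ m / (m.factorial : ℂ) ∂μ := by
    rw [integral_finsetSum _ fun m _ => hterm m]
    refine Finset.sum_congr rfl fun m _ => ?_
    rw [← integral_complex_ofReal, ← integral_const_mul]
    congr 1; ext x
    push_cast
    ring
  rw [hsum, ← integral_sub he (integrable_finsetSum _ fun m _ => hterm m), ← integral_div]
  refine norm_integral_le_of_norm_le ?_ (ae_of_all _ fun x => norm_exp_mul_I_sub_sum_le n (P x))
  have := (hP n).norm
  simp only [norm_pow, Real.norm_eq_abs] at this
  exact this.div_const _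

/-- Both exponentials are expanded to the even order 2k, so that the remainders are genuine moments
without absolute values. The remainder for P is traded for that of R at the cost D/(2k)!; together
with the lower moments this costs at most D·e ≤ 3D. -/
lemma norm_integral_exp_sub_integral_exp_le {X Y : Type*} [MeasurableSpace X] [MeasurableSpace Y]
    (μ : Measure X) [IsProbabilityMeasure μ] (ν : Measure Y) [IsProbabilityMeasure ν]
    {P : X → ℝ} {R : Y → ℝ} (hP : ∀ m : ℕ, Integrable (fun x => P x ^ m) μ)
    (hR : ∀ m : ℕ, Integrable (fun x => R x ^ m) ν) (k : ℕ) {D : ℝ}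
    (hD : ∀ m ≤ 2 * k, |∫ x, P x ^ m ∂μ - ∫ y, R y ^ m ∂ν| ≤ D) :
    ‖∫ x, Complex.exp (P x * Complex.I) ∂μ - ∫ y, Complex.exp (R y * Complex.I) ∂ν‖
      ≤ 3 * D + 2 * ((∫ y, R y ^ (2 * k) ∂ν) / (2 * k).factorial) := by
  have h1 := norm_integral_exp_sub_sum_le μ hP (2 * k)
  have h2 := norm_integral_exp_sub_sum_le ν hR (2 * k)
  have heven : ∀ y : ℝ, |y| ^ (2 * k) = y ^ (2 * k) := fun y => Even.pow_abs ⟨k, by ring⟩ y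
  simp only [heven] at h1 h2
  have hD0 : 0 ≤ D := (abs_nonneg _).trans (hD 0 (by omega))
  set fk : ℝ := ((2 * k).factorial : ℝ) with hfk
  have hfk0 : 0 < fk := by rw [hfk]; positivity
  have h3 : ‖∑ m ∈ Finset.range (2 * k), Complex.I ^ m / (m.factorial : ℂ) * ((∫ x, P x ^ m ∂μ : ℝ) : ℂ)
      - ∑ m ∈ Finset.range (2 * k), Complex.I ^ m / (m.factorial : ℂ) * ((∫ x, R x ^ m ∂ν : ℝ) : ℂ)‖
      ≤ ∑ m ∈ Finset.range (2 * k), D * (1 ^ m / m.factorial) := by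
    rw [← Finset.sum_sub_distrib]
    refine norm_sum_le_of_le _ fun m hm => ?_
    rw [← mul_sub, norm_mul, ← Complex.ofReal_sub, Complex.norm_real, norm_div, norm_pow,
      Complex.norm_I, mul_comm, Complex.norm_natCast]
    exact mul_le_mul_of_nonneg_right (hD m (Finset.mem_range.1 hm).le) (by positivity)
  have h4 : (∫ x, P x ^ (2 * k) ∂μ) / fk ≤ (∫ y, R y ^ (2 * k) ∂ν) / fk + D / fk := by
    rw [← add_div]
    gcongr
    linarith [(abs_le.1 (hD (2 * k) le_rfl)).2]
  have h5 : ∑ m ∈ Finset.range (2 * k), D * (1 ^ m / m.factorial) + D / fk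
      ≤ D * 3 := by
    have : D / fk = D * (1 ^ (2 * k) / ((2 * k).factorial : ℝ)) := by rw [← hfk, one_pow]; ring
    rw [this, ← Finset.sum_range_succ (fun m : ℕ => D * (1 ^ m / (m.factorial : ℝ))),
      ← Finset.mul_sum]
    gcongr
    refine (Real.sum_le_exp_of_nonneg zero_le_one _).trans ?_
    linarith [Real.exp_one_lt_d9]
  have h6 := norm_sub_le_norm_sub_add_norm_sub
    (∫ x, Complex.exp (P x * Complex.I) ∂μ)
    (∑ m ∈ Finset.range (2 * k), Complex.I ^ m / (m.factorial : ℂ) * ((∫ x, P x ^ m ∂μ : ℝ) : ℂ))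
    (∫ y, Complex.exp (R y * Complex.I) ∂ν)
  have h7 := norm_sub_le_norm_sub_add_norm_sub
    (∑ m ∈ Finset.range (2 * k), Complex.I ^ m / (m.factorial : ℂ) * ((∫ x, P x ^ m ∂μ : ℝ) : ℂ))
    (∑ m ∈ Finset.range (2 * k), Complex.I ^ m / (m.factorial : ℂ) * ((∫ x, R x ^ m ∂ν : ℝ) : ℂ))
    (∫ y, Complex.exp (R y * Complex.I) ∂ν)
  rw [norm_sub_rev] at h2
  linarith

lemma pow_div_factorial_le_cosh (y : ℝ) (k : ℕ) :
    y ^ (2 * k) / (2 * k).factorial ≤ Real.cosh y :=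
  le_hasSum (Real.hasSum_cosh y) k fun j _ => by
    have : 0 ≤ y ^ (2 * j) := by rw [pow_mul]; positivity
    positivity

section Torus

variable {N : ℕ}

/-- The product Haar measure on the torus `(ℝ/ℤ)^N`. -/
noncomputable def torus (N : ℕ) : Measure (Fin N → UnitAddCircle) :=
  Measure.pi fun _ => AddCircle.haarAddCircle

instance : IsProbabilityMeasure (torus N) := by unfold torus; infer_instance

lemma integrable_torus_of_continuous {E : Type*} [NormedAddCommGroup E]
    {f : (Fin N → UnitAddCircle) → E} (hf : Continuous f) : Integrable f (torus N) :=
  hf.integrable_of_hasCompactSupport (HasCompactSupport.of_compactSpace f)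

/-- The random trigonometric sum `∑ Re (c_n X_n)`, with the `X_n` independent and uniform on the
unit circle. -/
noncomputable def randSum (c : Fin N → ℂ) (x : Fin N → UnitAddCircle) : ℝ :=
  ∑ n, (c n * unitPt (x n)).re

/-- The trigonometric polynomial `∑ Re (c_n e^{-itω_n})`. -/
noncomputable def trigSum (c : Fin N → ℂ) (ω : Fin N → ℝ) (t : ℝ) : ℝ :=
  ∑ n, (c n * Complex.exp (((-(t * ω n) : ℝ) : ℂ) * Complex.I)).re

lemma continuous_randSum (c : Fin N → ℂ) : Continuous (randSum c) := by
  unfold randSum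
  have := continuous_unitPt
  fun_prop

lemma continuous_trigSum (c : Fin N → ℂ) (ω : Fin N → ℝ) : Continuous (trigSum c ω) := by
  unfold trigSum
  fun_prop

lemma integral_exp_randSum (c : Fin N → ℂ) :
    ∫ x, Complex.exp (randSum c x * Complex.I) ∂torus N = ∏ n, circleChar ‖c n‖ := by
  simp only [randSum, Complex.ofReal_sum, Finset.sum_mul, Complex.exp_sum]
  rw [torus, integral_fintype_prod_eq_prod (f := fun n (y : UnitAddCircle) =>
    Complex.exp (((c n * unitPt y).re : ℂ) * Complex.I))]
  exact Finset.prod_congr rfl fun n _ => integral_exp_re_mul_toCircle (c n)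

/-- The half turn x ↦ x + 1/2 changes the sign of the exponent, which replaces exp by cosh; then
cosh y ≤ e^{y²/2}. -/
lemma integral_rexp_re_mul_unitPt_le (c : ℂ) :
    ∫ x : UnitAddCircle, Real.exp ((c * unitPt x).re) ∂AddCircle.haarAddCircle
      ≤ Real.exp (‖c‖ ^ 2 / 2) := by
  have hc : Continuous fun x : UnitAddCircle => (c * unitPt x).re := by
    have := continuous_unitPt
    fun_prop
  have h := integral_add_left_eq_self (μ := (AddCircle.haarAddCircle : Measure UnitAddCircle))
    (fun x => Real.exp ((c * unitPt x).re)) (((1 / 2 : ℝ)) : UnitAddCircle)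
  simp only [unitPt_half_add, mul_neg, Complex.neg_re] at h
  have h2 : ∫ x : UnitAddCircle, Real.exp ((c * unitPt x).re) ∂AddCircle.haarAddCircle
      = ∫ x : UnitAddCircle, Real.cosh ((c * unitPt x).re) ∂AddCircle.haarAddCircle := by
    simp only [Real.cosh_eq]
    rw [integral_div, integral_add (integrable_haar_of_continuous (by fun_prop))
      (integrable_haar_of_continuous (by fun_prop)), h]
    ring
  rw [h2]
  have h3 : ∫ x : UnitAddCircle, Real.cosh ((c * unitPt x).re) ∂AddCircle.haarAddCircle
      ≤ ∫ x : UnitAddCircle, Real.exp (‖c‖ ^ 2 / 2) ∂AddCircle.haarAddCircle := by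
    refine integral_mono (integrable_haar_of_continuous (by fun_prop)) (integrable_const _)
      fun x => ?_
    refine (Real.cosh_le_exp_half_sq _).trans ?_
    have : |(c * unitPt x).re| ≤ ‖c‖ := (Complex.abs_re_le_norm _).trans (by
      rw [norm_mul, norm_unitPt, mul_one])
    have h4 : (c * unitPt x).re ^ 2 ≤ ‖c‖ ^ 2 := by
      rw [← sq_abs]; gcongr
    gcongr
  simpa using h3

lemma integral_rexp_randSum_le (c : Fin N → ℂ) :
    ∫ x, Real.exp (randSum c x) ∂torus N ≤ Real.exp ((∑ n, ‖c n‖ ^ 2) / 2) := by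
  simp only [randSum, Real.exp_sum]
  rw [torus, integral_fintype_prod_eq_prod (f := fun n (y : UnitAddCircle) =>
    Real.exp ((c n * unitPt y).re)), Finset.sum_div, Real.exp_sum]
  exact Finset.prod_le_prod (fun n _ => integral_nonneg fun _ => (Real.exp_pos _).le)
    fun n _ => integral_rexp_re_mul_unitPt_le (c n)

/-- Subgaussian moment bound for the random trigonometric sum. -/
lemma integral_randSum_pow_le (c : Fin N → ℂ) (k : ℕ) {s : ℝ} (hs : 0 < s) :
    (∫ x, randSum c x ^ (2 * k) ∂torus N) / (2 * k).factorial
      ≤ Real.exp (s ^ 2 * (∑ n, ‖c n‖ ^ 2) / 2) / s ^ (2 * k) := by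
  rw [le_div_iff₀ (by positivity), ← integral_div, ← integral_mul_const]
  have hcont := continuous_randSum c
  have hscale : ∀ a : ℝ, ∀ x, a * randSum c x = randSum (fun n => (a : ℂ) * c n) x := by
    intro a x
    simp only [randSum, Finset.mul_sum, mul_assoc, Complex.re_ofReal_mul]
  have hE : ∀ a : ℝ, a ^ 2 = s ^ 2 → ∫ x, Real.exp (a * randSum c x) ∂torus N
      ≤ Real.exp (s ^ 2 * (∑ n, ‖c n‖ ^ 2) / 2) := by
    intro a ha
    simp only [hscale a]
    refine (integral_rexp_randSum_le _).trans (le_of_eq ?_)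
    simp only [norm_mul, mul_pow, Complex.norm_real, Real.norm_eq_abs, sq_abs, ha, Finset.mul_sum]
  have h1 := hE s rfl
  have h2 := hE (-s) (by ring)
  -- One term of the power series of cosh is at most the whole; cosh is then the average of the
  -- moment generating function at s and -s.
  calc _ ≤ ∫ x, Real.cosh (s * randSum c x) ∂torus N := by
        refine integral_mono (integrable_torus_of_continuous (by fun_prop))
          (integrable_torus_of_continuous (by fun_prop)) fun x => ?_
        refine le_trans (le_of_eq ?_) (pow_div_factorial_le_cosh (s * randSum c x) k)
        simp only [mul_pow]; ring
    _ = ((∫ x, Real.exp (s * randSum c x) ∂torus N)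
          + ∫ x, Real.exp (-s * randSum c x) ∂torus N) / 2 := by
        simp only [Real.cosh_eq, neg_mul]
        rw [integral_div, integral_add (integrable_torus_of_continuous (by fun_prop))
          (integrable_torus_of_continuous (by fun_prop))]
    _ ≤ _ := by linarith

/-- The sign `±1` attached to a Boolean. -/
def sgn (b : Bool) : ℤ := if b then 1 else -1

/-- The coefficients of `2 Re (c_n z)` in terms of `z` and its conjugate. -/
noncomputable def signedCoeff (c : Fin N → ℂ) (p : Fin N × Bool) : ℂ :=
  if p.2 then c p.1 / 2 else (starRingEnd ℂ) (c p.1) / 2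

lemma norm_signedCoeff (c : Fin N → ℂ) (p : Fin N × Bool) :
    ‖signedCoeff c p‖ = ‖c p.1‖ / 2 := by
  unfold signedCoeff; split_ifs <;> simp

lemma sum_norm_signedCoeff (c : Fin N → ℂ) : ∑ p, ‖signedCoeff c p‖ = ∑ n, ‖c n‖ := by
  rw [Fintype.sum_prod_type]
  simp [norm_signedCoeff, mul_div_cancel₀]

/-- On the unit circle conjugation is inversion, so powers of the sum expand into monomials with
exponents ±1, matching the signs in the spacing condition. -/
lemma ofReal_re_mul_eq (c z : ℂ) (hz : ‖z‖ = 1) :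
    (((c * z).re : ℝ) : ℂ) = c / 2 * z ^ (1 : ℤ) + (starRingEnd ℂ) c / 2 * z ^ (-1 : ℤ) := by
  rw [zpow_one, zpow_neg_one, Complex.inv_eq_conj hz, Complex.re_eq_add_conj, map_mul]
  ring

lemma ofReal_randSum (c : Fin N → ℂ) (x : Fin N → UnitAddCircle) :
    (randSum c x : ℂ) = ∑ p : Fin N × Bool, signedCoeff c p * unitPt (x p.1) ^ sgn p.2 := by
  rw [Fintype.sum_prod_type, randSum, Complex.ofReal_sum]
  refine Finset.sum_congr rfl fun n _ => ?_
  rw [ofReal_re_mul_eq _ _ (norm_unitPt _)]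
  simp [signedCoeff, sgn]

lemma ofReal_trigSum (c : Fin N → ℂ) (ω : Fin N → ℝ) (t : ℝ) :
    (trigSum c ω t : ℂ) = ∑ p : Fin N × Bool, signedCoeff c p *
      Complex.exp (((-(t * (sgn p.2 * ω p.1)) : ℝ) : ℂ) * Complex.I) := by
  rw [Fintype.sum_prod_type, trigSum, Complex.ofReal_sum]
  refine Finset.sum_congr rfl fun n _ => ?_
  rw [ofReal_re_mul_eq _ _ (Complex.norm_exp_ofReal_mul_I _)]
  simp [signedCoeff, sgn, ← Complex.exp_neg]

/-- The frequency of a monomial. -/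
noncomputable def freq {m : ℕ} (ω : Fin N → ℝ) (p : Fin m → Fin N × Bool) : ℝ :=
  ∑ j, (sgn (p j).2 : ℝ) * ω (p j).1

lemma freq_eq_sum {m : ℕ} (ω : Fin N → ℝ) (p : Fin m → Fin N × Bool) :
    freq ω p = ∑ n, ((∑ j with (p j).1 = n, sgn (p j).2 : ℤ) : ℝ) * ω n := by
  rw [freq, ← Finset.sum_fiberwise (s := Finset.univ) (g := fun j => (p j).1)]
  refine Finset.sum_congr rfl fun n _ => ?_
  rw [Int.cast_sum, Finset.sum_mul]
  refine Finset.sum_congr rfl fun j hj => ?_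
  rw [(Finset.mem_filter.1 hj).2]

lemma integral_unitPt_zpow (k : ℤ) :
    ∫ x : UnitAddCircle, unitPt x ^ k ∂AddCircle.haarAddCircle = if k = 0 then 1 else 0 := by
  have h : ∀ x : UnitAddCircle, unitPt x ^ k = fourier k x := fun x => by
    rw [fourier_apply, AddCircle.toCircle_zsmul, Circle.coe_zpow]; rfl
  simp only [h]
  split_ifs with hk
  · subst hk; simp
  · exact integral_eq_zero_of_add_right_eq_neg
      (μ := (AddCircle.haarAddCircle : Measure UnitAddCircle))
      (fourier_add_half_inv_index hk one_pos)

/-- The net exponent of the n-th variable equals the coefficient of ω n in the frequency. By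
independence over ℚ the frequency vanishes exactly when all exponents do, which is when the integral
over the torus does not vanish. -/
lemma integral_monomial_eq {m : ℕ} {ω : Fin N → ℝ} (hω : LinearIndependent ℚ ω)
    (p : Fin m → Fin N × Bool) :
    ∫ x, ∏ j, unitPt (x (p j).1) ^ sgn (p j).2 ∂torus N = if freq ω p = 0 then 1 else 0 := by
  have h1 : ∀ x : Fin N → UnitAddCircle, ∏ j, unitPt (x (p j).1) ^ sgn (p j).2
      = ∏ n, unitPt (x n) ^ (∑ j with (p j).1 = n, sgn (p j).2) := by
    intro x
    rw [← Finset.prod_fiberwise (s := Finset.univ) (g := fun j => (p j).1)]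
    refine Finset.prod_congr rfl fun n _ => ?_
    have hne : unitPt (x n) ≠ 0 := by
      rw [← norm_ne_zero_iff, norm_unitPt]; exact one_ne_zero
    have hz : ∀ s : Finset (Fin m), unitPt (x n) ^ (∑ j ∈ s, sgn (p j).2)
        = ∏ j ∈ s, unitPt (x n) ^ sgn (p j).2 := by
      intro s
      induction s using Finset.induction_on with
      | empty => simp
      | insert a s ha ih => rw [Finset.sum_insert ha, Finset.prod_insert ha, zpow_add₀ hne, ih]
    rw [hz]
    refine Finset.prod_congr rfl fun j hj => ?_
    rw [(Finset.mem_filter.1 hj).2]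
  simp only [h1]
  rw [torus, integral_fintype_prod_eq_prod (f := fun n (y : UnitAddCircle) =>
    unitPt y ^ (∑ j with (p j).1 = n, sgn (p j).2))]
  simp only [integral_unitPt_zpow]
  split_ifs with h
  · rw [freq_eq_sum] at h
    have h2 := (Fintype.linearIndependent_iff.1 hω)
      (fun n => ((∑ j with (p j).1 = n, sgn (p j).2 : ℤ) : ℚ)) (by
        rw [← h]
        refine Finset.sum_congr rfl fun n _ => ?_
        rw [Rat.smul_def]; push_cast; rfl)
    refine Finset.prod_eq_one fun n _ => if_pos ?_
    exact_mod_cast h2 n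
  · by_contra hne
    apply h
    rw [freq_eq_sum]
    refine Finset.sum_eq_zero fun n _ => ?_
    have : (∑ j with (p j).1 = n, sgn (p j).2 : ℤ) = 0 := by
      by_contra h0
      exact hne (Finset.prod_eq_zero (Finset.mem_univ n) (if_neg h0))
    rw [this]; simp

/-- Both moments expand over the same monomials. Those of frequency zero agree exactly; the others
vanish on the torus and have time average at most 2/(Tη). The moduli of the coefficients sum to (∑‖c
n‖)^m. -/
lemma abs_moment_sub_le {ω : Fin N → ℝ} (hω : LinearIndependent ℚ ω) (c : Fin N → ℂ)
    {T η : ℝ} (hT : 0 < T) (hη : 0 < η) (m : ℕ)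
    (hgap : ∀ p : Fin m → Fin N × Bool, freq ω p ≠ 0 → η ≤ |freq ω p|) :
    |∫ t, trigSum c ω t ^ m ∂avg T - ∫ x, randSum c x ^ m ∂torus N|
      ≤ (∑ n, ‖c n‖) ^ m * (2 / (T * η)) := by
  have := isProbabilityMeasure_avg hT
  have hT' : ((∫ t, trigSum c ω t ^ m ∂avg T : ℝ) : ℂ) = ∑ p : Fin m → Fin N × Bool,
      (∏ j, signedCoeff c (p j)) *
        ∫ t, Complex.exp (((-(t * freq ω p) : ℝ) : ℂ) * Complex.I) ∂avg T := by
    rw [← integral_complex_ofReal]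
    simp only [Complex.ofReal_pow, ofReal_trigSum, Fintype.sum_pow, Finset.prod_mul_distrib,
      ← Complex.exp_sum]
    rw [integral_finsetSum _ fun p _ => integrable_avg_of_continuous (by fun_prop)]
    refine Finset.sum_congr rfl fun p _ => ?_
    rw [integral_const_mul]
    congr 2; ext t
    rw [← Finset.sum_mul, ← Complex.ofReal_sum, Finset.sum_neg_distrib, ← Finset.mul_sum]
    rfl
  have hR' : ((∫ x, randSum c x ^ m ∂torus N : ℝ) : ℂ) = ∑ p : Fin m → Fin N × Bool,
      (∏ j, signedCoeff c (p j)) * if freq ω p = 0 then 1 else 0 := by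
    have hcz : ∀ (n : Fin N) (k : ℤ), Continuous fun x : Fin N → UnitAddCircle =>
        unitPt (x n) ^ k := fun n k =>
      (continuous_unitPt.comp (continuous_apply n)).zpow₀ k fun x => Or.inl (by
        change unitPt (x n) ≠ 0
        rw [← norm_ne_zero_iff, norm_unitPt]; exact one_ne_zero)
    rw [← integral_complex_ofReal]
    simp only [Complex.ofReal_pow, ofReal_randSum, Fintype.sum_pow, Finset.prod_mul_distrib]
    rw [integral_finsetSum _ fun p _ => ?_]
    swap
    · exact integrable_torus_of_continuous
        (continuous_const.mul (continuous_finsetProd _ fun j _ => hcz _ _))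
    refine Finset.sum_congr rfl fun p _ => ?_
    rw [integral_const_mul, integral_monomial_eq hω]
  rw [← Real.norm_eq_abs, ← Complex.norm_real, Complex.ofReal_sub, hT', hR',
    ← Finset.sum_sub_distrib, ← sum_norm_signedCoeff, Fintype.sum_pow, Finset.sum_mul]
  refine norm_sum_le_of_le _ fun p _ => ?_
  rw [← mul_sub, norm_mul, norm_prod]
  refine mul_le_mul_of_nonneg_left ?_ (Finset.prod_nonneg fun _ _ => norm_nonneg _)
  split_ifs with h
  · simp only [h, mul_zero, neg_zero, Complex.ofReal_zero, zero_mul, Complex.exp_zero,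
      integral_const, probReal_univ, one_smul, sub_self, norm_zero]
    positivity
  · rw [sub_zero]
    refine (norm_integral_avg_exp_le hT h).trans ?_
    have := hgap p h
    gcongr

/-- The characteristic function of a trigonometric polynomial with independent frequencies is
close to that of its random model. -/
lemma norm_integral_exp_trigSum_sub_le {ω : Fin N → ℝ} (hω : LinearIndependent ℚ ω) (c : Fin N → ℂ)
    {T η A V : ℝ} (hT : 0 < T) (hη : 0 < η) (k : ℕ)
    (hgap : ∀ m ≤ 2 * k, ∀ p : Fin m → Fin N × Bool, freq ω p ≠ 0 → η ≤ |freq ω p|)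
    (hA : ∑ n, ‖c n‖ ≤ A) (hA1 : 1 ≤ A) (hV : ∑ n, ‖c n‖ ^ 2 ≤ V) :
    ‖∫ t, Complex.exp (trigSum c ω t * Complex.I) ∂avg T - ∏ n, circleChar ‖c n‖‖
      ≤ 6 * A ^ (2 * k) / (T * η) + 2 * Real.exp (4 * V - 2 * k) := by
  have := isProbabilityMeasure_avg hT
  have hct := continuous_trigSum c ω
  have hcr := continuous_randSum c
  have h := norm_integral_exp_sub_integral_exp_le (avg T) (torus N) (P := trigSum c ω)
    (R := randSum c) (fun m => integrable_avg_of_continuous (by fun_prop))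
    (fun m => integrable_torus_of_continuous (by fun_prop)) k
    (D := A ^ (2 * k) * (2 / (T * η))) fun m hm => by
      refine (abs_moment_sub_le hω c hT hη m (hgap m hm)).trans ?_
      gcongr
      calc (∑ n, ‖c n‖) ^ m ≤ A ^ m := by
            gcongr
        _ ≤ A ^ (2 * k) := pow_le_pow_right₀ hA1 hm
  rw [integral_exp_randSum] at h
  refine h.trans (add_le_add (le_of_eq (by ring)) ?_)
  -- With s = e the denominator is e^{2k}, and e²/2 ≤ 4 gives the exponent 4V - 2k.
  have h2 := integral_randSum_pow_le c k (Real.exp_pos 1)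
  refine mul_le_mul_of_nonneg_left (h2.trans ?_) zero_le_two
  rw [← Real.exp_nat_mul 1 (2 * k), ← Real.exp_sub]
  refine Real.exp_le_exp.2 ?_
  have he : Real.exp 1 ^ 2 ≤ 8 := by
    have := Real.exp_one_lt_d9
    have h0 := Real.exp_pos 1
    nlinarith
  have hV0 : 0 ≤ ∑ n, ‖c n‖ ^ 2 := Finset.sum_nonneg fun _ _ => sq_nonneg _
  push_cast
  nlinarith

end Torus

end LerchMean

/-! ### Partial sums of the Lerch series for non-integral λ. -/

namespace LerchMean
open MeasureTheory Filter Topology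

lemma hasDerivAt_ofReal_cpow_neg {s : ℂ} (hs : s ≠ 0) {y : ℝ} (hy : y ≠ 0) :
    HasDerivAt (fun y : ℝ => (y : ℂ) ^ (-s)) (-s * (y : ℂ) ^ (-s - 1)) y :=
  hasDerivAt_ofReal_cpow_const hy (neg_ne_zero.2 hs)

lemma norm_cpow_neg_sub_le {s : ℂ} (hs : 0 ≤ s.re) {a b : ℝ} (ha : 1 ≤ a) (hb : 1 ≤ b) :
    ‖(a : ℂ) ^ (-s) - (b : ℂ) ^ (-s)‖ ≤ ‖s‖ * |a - b| := by
  rcases eq_or_ne s 0 with rfl | hs0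
  · simp
  have := (convex_Ici (1 : ℝ)).norm_image_sub_le_of_norm_hasDerivWithin_le
    (f := fun y : ℝ => (y : ℂ) ^ (-s)) (f' := fun y : ℝ => -s * (y : ℂ) ^ (-s - 1)) (C := ‖s‖)
    (x := b) (y := a)
    (fun y hy => (hasDerivAt_ofReal_cpow_neg hs0
      (by have : (1 : ℝ) ≤ y := hy; linarith)).hasDerivWithinAt)
    (fun y hy => by
      have hy1 : (1 : ℝ) ≤ y := hy
      rw [norm_mul, norm_neg, Complex.norm_cpow_eq_rpow_re_of_pos (by linarith)]
      refine mul_le_of_le_one_right (norm_nonneg _)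
        (Real.rpow_le_one_of_one_le_of_nonpos hy1 ?_)
      simp only [Complex.sub_re, Complex.neg_re, Complex.one_re]
      linarith) hb ha
  rwa [Real.norm_eq_abs] at this

/-- The mean `∫₀¹ (1 + uv)^{-s} dv`. -/
noncomputable def meanCpow (s : ℂ) (u : ℝ) : ℂ := ∫ v in (0 : ℝ)..1, ((1 + u * v : ℝ) : ℂ) ^ (-s)

lemma continuousOn_cpow_one_add (s : ℂ) {u : ℝ} (hu : 0 ≤ u) :
    ContinuousOn (fun v : ℝ => ((1 + u * v : ℝ) : ℂ) ^ (-s)) (Set.uIcc 0 1) := by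
  refine ContinuousOn.cpow_const (by fun_prop) fun v hv => ?_
  rw [Set.uIcc_of_le zero_le_one] at hv
  rw [Complex.ofReal_mem_slitPlane]
  have := mul_nonneg hu hv.1
  linarith

lemma norm_meanCpow_sub_le {s : ℂ} (hs : 0 ≤ s.re) {u u' : ℝ} (hu : 0 ≤ u) (hu' : 0 ≤ u') :
    ‖meanCpow s u - meanCpow s u'‖ ≤ ‖s‖ * |u - u'| := by
  rw [meanCpow, meanCpow, ← intervalIntegral.integral_sub
    (continuousOn_cpow_one_add s hu).intervalIntegrable
    (continuousOn_cpow_one_add s hu').intervalIntegrable]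
  have := intervalIntegral.norm_integral_le_of_norm_le_const (a := 0) (b := 1)
    (C := ‖s‖ * |u - u'|)
    (f := fun v : ℝ => ((1 + u * v : ℝ) : ℂ) ^ (-s) - ((1 + u' * v : ℝ) : ℂ) ^ (-s)) fun v hv => ?_
  · simpa using this
  · rw [Set.uIoc_of_le zero_le_one] at hv
    have h1 := mul_nonneg hu hv.1.le
    have h2 := mul_nonneg hu' hv.1.le
    refine (norm_cpow_neg_sub_le hs (by linarith) (by linarith)).trans ?_
    refine mul_le_mul_of_nonneg_left ?_ (norm_nonneg _)
    have : 1 + u * v - (1 + u' * v) = (u - u') * v := by ring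
    rw [this, abs_mul, abs_of_pos hv.1]
    exact mul_le_of_le_one_right (abs_nonneg _) hv.2

lemma meanCpow_zero (s : ℂ) : meanCpow s 0 = 1 := by simp [meanCpow]

/-- The fundamental theorem of calculus for (1+uv)^{1-s}. With u = 1/x it writes the increment of
x^{1-s} as x^{-s} times a slowly varying factor, as summation by parts requires. -/
lemma meanCpow_eq {s : ℂ} (hs : s ≠ 1) {u : ℝ} (hu : 0 ≤ u) :
    (u : ℂ) * ((1 - s) * meanCpow s u) = ((1 + u : ℝ) : ℂ) ^ (1 - s) - 1 := by
  have hs' : s - 1 ≠ 0 := sub_ne_zero.2 hs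
  have hd : ∀ v ∈ Set.uIcc (0 : ℝ) 1, HasDerivAt (fun v : ℝ => ((1 + u * v : ℝ) : ℂ) ^ (1 - s))
      ((u : ℂ) * ((1 - s) * ((1 + u * v : ℝ) : ℂ) ^ (-s))) v := by
    intro v hv
    rw [Set.uIcc_of_le zero_le_one] at hv
    have h1 := mul_nonneg hu hv.1
    have hin : HasDerivAt (fun v : ℝ => 1 + u * v) u v := by
      simpa using ((hasDerivAt_id v).const_mul u).const_add 1
    have h2 := (hasDerivAt_ofReal_cpow_neg hs' (y := 1 + u * v) (by positivity)).scomp v hin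
    simp only [neg_sub, Function.comp_def] at h2
    refine h2.congr_deriv ?_
    rw [Complex.real_smul]
    ring_nf
  have := intervalIntegral.integral_eq_sub_of_hasDerivAt hd
    (((continuousOn_cpow_one_add s hu).intervalIntegrable.const_mul _).const_mul _)
  rw [intervalIntegral.integral_const_mul, intervalIntegral.integral_const_mul] at this
  rw [meanCpow, this]
  simp

/-- Here g is the difference of H up to a factor v of small variation, which need not be constant.
-/
lemma sum_Ico_by_parts {g H v : ℕ → ℂ} {M : ℕ} (h : ∀ n, M ≤ n → g n = (H (n + 1) - H n) * v n)
    {Z : ℕ} (hZ : M ≤ Z) :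
    ∑ n ∈ Finset.Ico M Z, g n = H Z * v Z - H M * v M
      - ∑ n ∈ Finset.Ico M Z, H (n + 1) * (v (n + 1) - v n) := by
  induction Z, hZ using Nat.le_induction with
  | base => simp
  | succ Z hZ ih =>
    rw [Finset.sum_Ico_succ_top hZ, Finset.sum_Ico_succ_top hZ, ih, h Z hZ]
    ring

lemma norm_inv_sub_inv_le {a b : ℂ} {c : ℝ} (hc : 0 < c) (ha : c ≤ ‖a‖) (hb : c ≤ ‖b‖) :
    ‖a⁻¹ - b⁻¹‖ ≤ ‖a - b‖ / c ^ 2 := by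
  have ha0 : a ≠ 0 := norm_pos_iff.1 (hc.trans_le ha)
  have hb0 : b ≠ 0 := norm_pos_iff.1 (hc.trans_le hb)
  rw [inv_sub_inv ha0 hb0, norm_div, norm_mul, norm_sub_rev]
  rw [sq]
  gcongr

/-- The `n`-th term of the Lerch zeta function. -/
noncomputable def lerchTerm (lam α : ℝ) (s : ℂ) (n : ℕ) : ℂ :=
  Complex.exp (2 * Real.pi * Complex.I * lam * n) / ((n : ℂ) + (α : ℂ)) ^ s

lemma norm_exp_two_pi (x : ℝ) : ‖Complex.exp (2 * Real.pi * Complex.I * x)‖ = 1 := by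
  have : (2 * Real.pi * Complex.I * x : ℂ) = ((2 * Real.pi * x : ℝ) : ℂ) * Complex.I := by
    push_cast; ring
  rw [this, Complex.norm_exp_ofReal_mul_I]

lemma lerchTerm_eq (lam α : ℝ) (s : ℂ) (n : ℕ) :
    lerchTerm lam α s n = Complex.exp (2 * Real.pi * Complex.I * lam) ^ n
      * (((n : ℝ) + α : ℝ) : ℂ) ^ (-s) := by
  rw [lerchTerm, Complex.cpow_neg, ← Complex.exp_nat_mul, div_eq_mul_inv]
  push_cast
  ring_nf

lemma norm_lerchTerm {lam α : ℝ} (hα : 0 < α) (s : ℂ) (n : ℕ) :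
    ‖lerchTerm lam α s n‖ = ((n : ℝ) + α) ^ (-s.re) := by
  rw [lerchTerm_eq, norm_mul, norm_pow, norm_exp_two_pi, one_pow, one_mul,
    Complex.norm_cpow_eq_rpow_re_of_pos (by positivity), Complex.neg_re]

lemma cpow_succ_eq {α : ℝ} (hα : 0 < α) (n : ℕ) (s : ℂ) :
    (((n + 1 : ℕ) : ℝ) + α : ℝ) ^ s = (((n : ℝ) + α : ℝ) : ℂ) ^ s
      * ((1 + ((n : ℝ) + α)⁻¹ : ℝ) : ℂ) ^ s := by
  have hx : 0 < (n : ℝ) + α := by positivity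
  rw [← Complex.mul_cpow_ofReal_nonneg hx.le (by positivity), ← Complex.ofReal_mul]
  congr 2
  push_cast
  field_simp
  ring

lemma sum_inv_sub_inv_le {α : ℝ} (hα : 0 < α) {M Z : ℕ} (hZ : M ≤ Z) :
    ∑ n ∈ Finset.Ico M Z, (((n : ℝ) + α)⁻¹ - (((n + 1 : ℕ) : ℝ) + α)⁻¹) ≤ ((M : ℝ) + α)⁻¹ := by
  have : ∑ n ∈ Finset.Ico M Z, (((n : ℝ) + α)⁻¹ - (((n + 1 : ℕ) : ℝ) + α)⁻¹)
      = ((M : ℝ) + α)⁻¹ - ((Z : ℝ) + α)⁻¹ := by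
    induction Z, hZ using Nat.le_induction with
    | base => simp
    | succ Z hZ ih => rw [Finset.sum_Ico_succ_top hZ, ih]; ring
  rw [this]
  have : 0 ≤ ((Z : ℝ) + α)⁻¹ := by positivity
  linarith

lemma inv_sub_inv_nonneg {α : ℝ} (hα : 0 < α) (n : ℕ) :
    0 ≤ ((n : ℝ) + α)⁻¹ - (((n + 1 : ℕ) : ℝ) + α)⁻¹ := by
  rw [sub_nonneg]
  apply inv_anti₀ (by positivity)
  push_cast; linarith

/-- Tail estimate for the Lerch series when `lam` is not an integer. -/
lemma norm_sum_Ico_lerchTerm_le {lam α κ : ℝ} (hα : 0 < α) (hκ : 0 < κ)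
    (hlam : κ ≤ ‖Complex.exp (2 * Real.pi * Complex.I * lam) - 1‖) {s : ℂ} (hs : 0 < s.re) {M Z : ℕ}
    (hZ : M ≤ Z) (hM : 2 * ‖s‖ ≤ κ * (M + α)) :
    ‖∑ n ∈ Finset.Ico M Z, lerchTerm lam α s n‖ ≤ 6 / κ * ((M : ℝ) + α) ^ (-s.re) := by
  set e := Complex.exp (2 * Real.pi * Complex.I * lam) with he
  have he1 : ‖e‖ = 1 := norm_exp_two_pi lam
  set q : ℕ → ℂ := fun n => ((1 + ((n : ℝ) + α)⁻¹ : ℝ) : ℂ) ^ (-s) with hq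
  -- The ratio of consecutive terms minus 1. Its limit is e^{2πiλ} - 1 ≠ 0, and the condition on M
  -- keeps it at least κ/2, so each term is itself a difference of terms up to the factor 1/d.
  set d : ℕ → ℂ := fun n => e * q n - 1 with hd
  have hx : ∀ n : ℕ, 0 < (n : ℝ) + α := fun n => by positivity
  have hqd : ∀ n, M ≤ n → κ / 2 ≤ ‖d n‖ := by
    intro n hn
    have h1 : ‖q n - 1‖ ≤ κ / 2 := by
      have := norm_cpow_neg_sub_le hs.le (a := 1 + ((n : ℝ) + α)⁻¹) (b := 1)
        (by have := hx n; have := inv_pos.2 this; linarith) le_rfl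
      rw [Complex.ofReal_one, Complex.one_cpow] at this
      refine this.trans ?_
      rw [add_sub_cancel_left, abs_of_pos (inv_pos.2 (hx n)), ← div_eq_mul_inv, div_le_iff₀ (hx n)]
      have : (M : ℝ) ≤ n := by exact_mod_cast hn
      nlinarith
    have h2 : e - 1 = d n - e * (q n - 1) := by simp only [hd]; ring
    have h3 := norm_sub_le (d n) (e * (q n - 1))
    rw [← h2, norm_mul, he1, one_mul] at h3
    linarith
  have hstep : ∀ n, M ≤ n → lerchTerm lam α s n
      = (lerchTerm lam α s (n + 1) - lerchTerm lam α s n) * (d n)⁻¹ := by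
    intro n hn
    have hdn : d n ≠ 0 := norm_pos_iff.1 (lt_of_lt_of_le (by positivity) (hqd n hn))
    rw [eq_mul_inv_iff_mul_eq₀ hdn, lerchTerm_eq, lerchTerm_eq, cpow_succ_eq hα, ← he]
    simp only [hd, hq]
    ring
  rw [sum_Ico_by_parts hstep hZ]
  have hxM : ∀ n, M ≤ n → ((n : ℝ) + α) ^ (-s.re) ≤ ((M : ℝ) + α) ^ (-s.re) := fun n hn =>
    Real.rpow_le_rpow_of_nonpos (hx M) (by
      have : (M : ℝ) ≤ n := by exact_mod_cast hn
      linarith) (by linarith)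
  set B := ((M : ℝ) + α) ^ (-s.re) with hB
  have hB0 : 0 ≤ B := Real.rpow_nonneg (hx M).le _
  have hbd : ∀ n, M ≤ n → ‖lerchTerm lam α s n * (d n)⁻¹‖ ≤ 2 / κ * B := by
    intro n hn
    rw [norm_mul, norm_lerchTerm hα, norm_inv, mul_comm (2 / κ)]
    have h1 : ‖d n‖⁻¹ ≤ 2 / κ := by
      rw [show (2 / κ) = (κ / 2)⁻¹ by field_simp]
      exact inv_anti₀ (by positivity) (hqd n hn)
    exact mul_le_mul (hxM n hn) h1 (by positivity) hB0
  -- The variation of 1/d is dominated by that of 1/(n+α), which telescopes to at most 1/(M+α); this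
  -- pays for ‖s‖.
  have hsum : ‖∑ n ∈ Finset.Ico M Z, lerchTerm lam α s (n + 1) * ((d (n + 1))⁻¹ - (d n)⁻¹)‖
      ≤ 2 / κ * B := by
    calc _ ≤ ∑ n ∈ Finset.Ico M Z, B * (4 / κ ^ 2 * ‖s‖) *
          (((n : ℝ) + α)⁻¹ - (((n + 1 : ℕ) : ℝ) + α)⁻¹) := by
          refine norm_sum_le_of_le _ fun n hn => ?_
          have hn' := (Finset.mem_Ico.1 hn).1
          rw [norm_mul, norm_lerchTerm hα, mul_assoc]
          refine mul_le_mul (hxM _ (by omega)) ?_ (norm_nonneg _) hB0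
          refine (norm_inv_sub_inv_le (c := κ / 2) (by positivity) (hqd _ (by omega))
            (hqd n hn')).trans ?_
          have h1 : d (n + 1) - d n = e * (q (n + 1) - q n) := by simp only [hd]; ring
          rw [h1, norm_mul, he1, one_mul]
          have h2 := norm_cpow_neg_sub_le hs.le (a := 1 + (((n + 1 : ℕ) : ℝ) + α)⁻¹)
            (b := 1 + ((n : ℝ) + α)⁻¹)
            (by have := inv_pos.2 (hx (n + 1)); linarith) (by have := inv_pos.2 (hx n); linarith)
          have h3 : |1 + (((n + 1 : ℕ) : ℝ) + α)⁻¹ - (1 + ((n : ℝ) + α)⁻¹)|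
              = ((n : ℝ) + α)⁻¹ - (((n + 1 : ℕ) : ℝ) + α)⁻¹ := by
            rw [add_sub_add_left_eq_sub, abs_sub_comm, abs_of_nonneg (inv_sub_inv_nonneg hα n)]
          rw [h3] at h2
          calc ‖q (n + 1) - q n‖ / (κ / 2) ^ 2 = 4 / κ ^ 2 * ‖q (n + 1) - q n‖ := by
                field_simp; norm_num
            _ ≤ 4 / κ ^ 2 * (‖s‖ * (((n : ℝ) + α)⁻¹ - (((n + 1 : ℕ) : ℝ) + α)⁻¹)) := by
                gcongr
            _ = _ := by ring
      _ ≤ B * (4 / κ ^ 2 * ‖s‖) * ((M : ℝ) + α)⁻¹ := by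
          rw [← Finset.mul_sum]
          exact mul_le_mul_of_nonneg_left (sum_inv_sub_inv_le hα hZ) (by positivity)
      _ ≤ 2 / κ * B := by
          rw [← div_eq_mul_inv, div_le_iff₀ (hx M)]
          have : 4 / κ ^ 2 * ‖s‖ ≤ 2 / κ * (M + α) := by
            rw [div_mul_eq_mul_div, div_mul_eq_mul_div, div_le_div_iff₀ (by positivity) hκ]
            nlinarith
          calc B * (4 / κ ^ 2 * ‖s‖) ≤ B * (2 / κ * (M + α)) := by gcongr
            _ = _ := by ring
  calc _ ≤ 2 / κ * B + 2 / κ * B + 2 / κ * B :=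
        (norm_sub_le _ _).trans (add_le_add ((norm_sub_le _ _).trans
          (add_le_add (hbd Z hZ) (hbd M le_rfl))) hsum)
    _ = _ := by ring

lemma exp_two_pi_ne_one {lam : ℝ} (hlam : ¬ ∃ k : ℤ, lam = k) :
    Complex.exp (2 * Real.pi * Complex.I * lam) ≠ 1 := by
  intro h
  obtain ⟨k, hk⟩ := Complex.exp_eq_one_iff.1 h
  apply hlam
  refine ⟨k, ?_⟩
  have : (2 * Real.pi * Complex.I) ≠ 0 := Complex.two_pi_I_ne_zero
  rw [mul_comm] at hk
  have := mul_right_cancel₀ this hk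
  exact_mod_cast this

lemma tendsto_sum_lerchTerm {lam α : ℝ} (hα : 0 < α) (hlam : ¬ ∃ k : ℤ, lam = k) {s : ℂ}
    (hs : 0 < s.re) :
    Tendsto (fun N : ℕ => ∑ n ∈ Finset.range N, lerchTerm lam α s n) atTop
      (𝓝 (lerchZeta lam α s)) := by
  have hdef : lerchZeta lam α s
      = limUnder atTop fun N : ℕ => ∑ n ∈ Finset.range N, lerchTerm lam α s n := by
    rw [lerchZeta, if_neg hlam]; rfl
  rw [hdef]
  refine CauchySeq.tendsto_limUnder ?_
  set κ := ‖Complex.exp (2 * Real.pi * Complex.I * lam) - 1‖ with hκd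
  have hκ : 0 < κ := norm_pos_iff.2 (sub_ne_zero.2 (exp_two_pi_ne_one hlam))
  rw [Metric.cauchySeq_iff']
  intro ε hε
  have h1 : Tendsto (fun M : ℕ => (M : ℝ) + α) atTop atTop :=
    tendsto_atTop_add_const_right _ _ tendsto_natCast_atTop_atTop
  have h2 : Tendsto (fun M : ℕ => 6 / κ * ((M : ℝ) + α) ^ (-s.re)) atTop (𝓝 0) := by
    simpa using ((tendsto_rpow_neg_atTop hs).comp h1).const_mul (6 / κ)
  obtain ⟨M, hM1, hM2⟩ := ((h2.eventually (gt_mem_nhds hε)).and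
    ((h1.const_mul_atTop hκ).eventually_ge_atTop (2 * ‖s‖))).exists
  refine ⟨M, fun Z hZ => ?_⟩
  rw [dist_eq_norm, ← Finset.sum_Ico_eq_sub _ hZ]
  exact (norm_sum_Ico_lerchTerm_le hα hκ le_rfl hs hZ hM2).trans_lt hM1

lemma norm_lerchZeta_sub_sum_le_of_not_int {lam α κ : ℝ} (hα : 0 < α) (hlam : ¬ ∃ k : ℤ, lam = k)
    (hκ : 0 < κ) (hκ' : κ ≤ ‖Complex.exp (2 * Real.pi * Complex.I * lam) - 1‖) {s : ℂ}
    (hs : 0 < s.re) {M : ℕ} (hM : 2 * ‖s‖ ≤ κ * (M + α)) :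
    ‖lerchZeta lam α s - ∑ n ∈ Finset.range M, lerchTerm lam α s n‖
      ≤ 6 / κ * ((M : ℝ) + α) ^ (-s.re) := by
  have h := ((tendsto_sum_lerchTerm hα hlam hs).sub_const
    (∑ n ∈ Finset.range M, lerchTerm lam α s n)).norm
  refine le_of_tendsto h ?_
  filter_upwards [eventually_ge_atTop M] with Z hZ
  rw [← Finset.sum_Ico_eq_sub _ hZ]
  exact norm_sum_Ico_lerchTerm_le hα hκ hκ' hs hZ hM

end LerchMean

/-! ### The Hurwitz case and the uniform approximation by partial sums. -/

namespace LerchMean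
open MeasureTheory Filter Topology

/-- The Euler–Maclaurin approximation to the Hurwitz zeta function. -/
noncomputable def hurwitzApprox (α : ℝ) (s : ℂ) (Z : ℕ) : ℂ :=
  ∑ n ∈ Finset.range Z, (((n : ℝ) + α : ℝ) : ℂ) ^ (-s)
    - (((Z : ℝ) + α : ℝ) : ℂ) ^ (1 - s) / (1 - s)

lemma cpow_one_sub_succ_sub {α : ℝ} (hα : 0 < α) {s : ℂ} (hs : s ≠ 1) (n : ℕ) :
    (((n + 1 : ℕ) : ℝ) + α : ℝ) ^ (1 - s) - (((n : ℝ) + α : ℝ) : ℂ) ^ (1 - s)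
      = (((n : ℝ) + α : ℝ) : ℂ) ^ (-s) * ((1 - s) * meanCpow s ((n : ℝ) + α)⁻¹) := by
  have hx : 0 < (n : ℝ) + α := by positivity
  have hx' : (((n : ℝ) + α : ℝ) : ℂ) ≠ 0 := by exact_mod_cast hx.ne'
  have h1 := meanCpow_eq hs (inv_pos.2 hx).le
  have h2 : (((n : ℝ) + α : ℝ) : ℂ) ^ (1 - s)
      = (((n : ℝ) + α : ℝ) : ℂ) ^ (-s) * (((n : ℝ) + α : ℝ) : ℂ) := by
    rw [sub_eq_neg_add, Complex.cpow_add _ _ hx', Complex.cpow_one]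
  have h3 : ((1 + ((n : ℝ) + α)⁻¹ : ℝ) : ℂ) ^ (1 - s)
      = 1 + ((((n : ℝ) + α)⁻¹ : ℝ) : ℂ) * ((1 - s) * meanCpow s ((n : ℝ) + α)⁻¹) := by
    rw [h1]; ring
  rw [cpow_succ_eq hα, h3, h2]
  have h4 : (((n : ℝ) + α : ℝ) : ℂ) * ((((n : ℝ) + α)⁻¹ : ℝ) : ℂ) = 1 := by
    rw [← Complex.ofReal_mul, mul_inv_cancel₀ hx.ne', Complex.ofReal_one]
  linear_combination ((((n : ℝ) + α : ℝ) : ℂ) ^ (-s) *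
    ((1 - s) * meanCpow s ((n : ℝ) + α)⁻¹)) * h4

/-- The increment carries the factor 1 - `meanCpow`, of order ‖s‖/Z, so the approximations converge
to the left of Re s = 1, where the series itself does not. -/
lemma hurwitzApprox_succ {α : ℝ} (hα : 0 < α) {s : ℂ} (hs : s ≠ 1) (Z : ℕ) :
    hurwitzApprox α s (Z + 1) = hurwitzApprox α s Z
      + (((Z : ℝ) + α : ℝ) : ℂ) ^ (-s) * (1 - meanCpow s ((Z : ℝ) + α)⁻¹) := by
  have h := cpow_one_sub_succ_sub hα hs Z
  have hs' : 1 - s ≠ 0 := sub_ne_zero.2 hs.symm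
  rw [hurwitzApprox, hurwitzApprox, Finset.sum_range_succ, eq_add_of_sub_eq h]
  field_simp
  ring

lemma norm_hurwitzApprox_term_le {α : ℝ} (hα : 0 < α) {s : ℂ} (hs : 0 ≤ s.re) (n : ℕ) :
    ‖(((n : ℝ) + α : ℝ) : ℂ) ^ (-s) * (1 - meanCpow s ((n : ℝ) + α)⁻¹)‖
      ≤ ‖s‖ * ((n : ℝ) + α) ^ (-s.re - 1) := by
  have hx : 0 < (n : ℝ) + α := by positivity
  rw [norm_mul, Complex.norm_cpow_eq_rpow_re_of_pos hx, Complex.neg_re, Real.rpow_sub_one hx.ne',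
    ← meanCpow_zero s, norm_sub_rev]
  have h1 := norm_meanCpow_sub_le hs (inv_pos.2 hx).le le_rfl
  rw [sub_zero, abs_of_pos (inv_pos.2 hx)] at h1
  calc _ ≤ ((n : ℝ) + α) ^ (-s.re) * (‖s‖ * ((n : ℝ) + α)⁻¹) := by gcongr
    _ = _ := by ring

lemma differentiableAt_cpow_ofReal {x : ℝ} (hx : 0 < x) {f : ℂ → ℂ} {s : ℂ}
    (hf : DifferentiableAt ℂ f s) : DifferentiableAt ℂ (fun s => (x : ℂ) ^ f s) s :=
  hf.const_cpow (Or.inl (by exact_mod_cast hx.ne'))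

lemma differentiableAt_hurwitzApprox {α : ℝ} (hα : 0 < α) {s : ℂ} (hs : s ≠ 1) (Z : ℕ) :
    DifferentiableAt ℂ (fun s => hurwitzApprox α s Z) s := by
  have hx : ∀ n : ℕ, 0 < (n : ℝ) + α := fun n => by positivity
  unfold hurwitzApprox
  refine DifferentiableAt.sub (DifferentiableAt.fun_sum fun n _ =>
    differentiableAt_cpow_ofReal (hx n) (by fun_prop)) ?_
  refine DifferentiableAt.div (differentiableAt_cpow_ofReal (hx Z) (by fun_prop)) (by fun_prop) ?_
  exact sub_ne_zero.2 hs.symm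

lemma tendsto_hurwitzApprox_of_one_lt {α : ℝ} (hα : 0 < α) (hα1 : α ≤ 1) {s : ℂ} (hs : 1 < s.re) :
    Tendsto (hurwitzApprox α s) atTop (𝓝 (HurwitzZeta.hurwitzZeta (α : UnitAddCircle) s)) := by
  have h1 := (HurwitzZeta.hasSum_hurwitzZeta_of_one_lt_re (a := α) ⟨hα.le, hα1⟩ hs).tendsto_sum_nat
  have h2 : Tendsto (fun Z : ℕ => (((Z : ℝ) + α : ℝ) : ℂ) ^ (1 - s) / (1 - s)) atTop (𝓝 0) := by
    rw [tendsto_zero_iff_norm_tendsto_zero]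
    have h3 : ∀ Z : ℕ, ‖(((Z : ℝ) + α : ℝ) : ℂ) ^ (1 - s) / (1 - s)‖
        = ((Z : ℝ) + α) ^ (-(s.re - 1)) / ‖1 - s‖ := fun Z => by
      rw [norm_div, Complex.norm_cpow_eq_rpow_re_of_pos (by positivity)]
      simp
    simp only [h3]
    have h4 : Tendsto (fun M : ℕ => (M : ℝ) + α) atTop atTop :=
      tendsto_atTop_add_const_right _ _ tendsto_natCast_atTop_atTop
    simpa using ((tendsto_rpow_neg_atTop (y := s.re - 1) (by linarith)).comp h4).div_const ‖1 - s‖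
  have h5 := h1.sub h2
  rw [sub_zero] at h5
  refine h5.congr fun Z => ?_
  rw [hurwitzApprox]
  congr 1
  refine Finset.sum_congr rfl fun n _ => ?_
  rw [Complex.cpow_neg, one_div]
  push_cast; rfl

/-- The Euler–Maclaurin approximations converge to the Hurwitz zeta function for `Re s > 1/2`. -/
lemma tendsto_hurwitzApprox {α : ℝ} (hα : 0 < α) (hα1 : α ≤ 1) {s₀ : ℂ} (hs : 1 / 2 < s₀.re)
    (hs' : 0 < s₀.im) :
    Tendsto (hurwitzApprox α s₀) atTop (𝓝 (HurwitzZeta.hurwitzZeta (α : UnitAddCircle) s₀)) := by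
  -- A convex domain that avoids the pole, bounds ‖s‖, and contains both s₀ and 2 + i, in whose
  -- neighbourhood the series converges absolutely.
  set U : Set ℂ := {s | 1 / 2 < s.re} ∩ {s | 0 < s.im} ∩ Metric.ball 0 (‖s₀‖ + 3) with hU
  have hUo : IsOpen U := ((isOpen_lt continuous_const Complex.continuous_re).inter
    (isOpen_lt continuous_const Complex.continuous_im)).inter Metric.isOpen_ball
  have hUc : Convex ℝ U := ((convex_halfSpace_re_gt _).inter (convex_halfSpace_im_gt _)).inter
    (convex_ball _ _)
  have hne : ∀ s ∈ U, s ≠ 1 := fun s hs h => by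
    have : 0 < s.im := hs.1.2
    rw [h] at this; simp at this
  -- Starting at index 1 keeps the base n + 1 + α above 1, which allows a majorant free of α.
  set E : ℕ → ℂ → ℂ := fun n s => hurwitzApprox α s (n + 1 + 1) - hurwitzApprox α s (n + 1) with hE
  have hEb : ∀ n, ∀ s ∈ U, ‖E n s‖ ≤ (‖s₀‖ + 3) * ((n + 1 : ℕ) : ℝ) ^ (-(3 / 2) : ℝ) := by
    intro n s hs
    have hre : 1 / 2 < s.re := hs.1.1
    have hx1 : (1 : ℝ) ≤ ((n + 1 : ℕ) : ℝ) := by push_cast; linarith [n.cast_nonneg (α := ℝ)]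
    simp only [hE]
    rw [hurwitzApprox_succ hα (hne s hs), add_sub_cancel_left]
    refine (norm_hurwitzApprox_term_le hα (by linarith) _).trans ?_
    have hb : ‖s‖ ≤ ‖s₀‖ + 3 := (mem_ball_zero_iff.1 hs.2).le
    refine mul_le_mul hb ?_ (by positivity) (by positivity)
    calc (((n + 1 : ℕ) : ℝ) + α) ^ (-s.re - 1) ≤ ((n + 1 : ℕ) : ℝ) ^ (-s.re - 1) :=
          Real.rpow_le_rpow_of_nonpos (by linarith) (by linarith) (by linarith)
      _ ≤ _ := Real.rpow_le_rpow_of_exponent_le hx1 (by linarith)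
  have hsumm : Summable fun n : ℕ => (‖s₀‖ + 3) * ((n + 1 : ℕ) : ℝ) ^ (-(3 / 2) : ℝ) := by
    refine Summable.mul_left _ ?_
    rw [summable_nat_add_iff 1 (f := fun n : ℕ => (n : ℝ) ^ (-(3 / 2) : ℝ))]
    exact Real.summable_nat_rpow.2 (by norm_num)
  have hEd : ∀ n, DifferentiableOn ℂ (E n) U := fun n s hs =>
    ((differentiableAt_hurwitzApprox hα (hne s hs) _).sub
      (differentiableAt_hurwitzApprox hα (hne s hs) _)).differentiableWithinAt
  have hsd := Complex.differentiableOn_tsum_of_summable_norm hsumm hEd hUo hEb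
  set F : ℂ → ℂ := fun s => hurwitzApprox α s 1 + ∑' n, E n s with hF
  have hFd : DifferentiableOn ℂ F U := DifferentiableOn.add (fun s hs =>
    (differentiableAt_hurwitzApprox hα (hne s hs) _).differentiableWithinAt) hsd
  have hFlim : ∀ s ∈ U, Tendsto (hurwitzApprox α s) atTop (𝓝 (F s)) := by
    intro s hs
    have h1 := (Summable.of_norm_bounded hsumm fun n => hEb n s hs).hasSum.tendsto_sum_nat
    have h2 := h1.const_add (hurwitzApprox α s 1)
    rw [← tendsto_add_atTop_iff_nat 1]
    refine h2.congr fun Z => ?_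
    simp only [hE]
    rw [Finset.sum_range_sub (fun n => hurwitzApprox α s (n + 1))]
    ring
  have hζ : DifferentiableOn ℂ (HurwitzZeta.hurwitzZeta (α : UnitAddCircle)) U := fun s hs =>
    (HurwitzZeta.differentiableAt_hurwitzZeta _ (hne s hs)).differentiableWithinAt
  have hz : (⟨2, 1⟩ : ℂ) ∈ U := by
    refine ⟨⟨by norm_num, by norm_num⟩, ?_⟩
    rw [mem_ball_zero_iff]
    have := Complex.norm_le_abs_re_add_abs_im (⟨2, 1⟩ : ℂ)
    simp only [abs_one, Nat.abs_ofNat] at this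
    have h0 := norm_nonneg s₀
    have h4 : s₀ ≠ 0 := fun h => by rw [h] at hs'; simp at hs'
    have := norm_pos_iff.2 h4
    linarith
  -- Identity theorem: the limit and the Hurwitz zeta function are holomorphic on U and agree near 2
  -- + i.
  have heq := (hFd.analyticOnNhd hUo).eqOn_of_preconnected_of_eventuallyEq
    (hζ.analyticOnNhd hUo) hUc.isPreconnected hz (by
      have hn : {s : ℂ | 1 < s.re} ∩ U ∈ 𝓝 (⟨2, 1⟩ : ℂ) :=
        ((isOpen_lt continuous_const Complex.continuous_re).inter hUo).mem_nhds
          ⟨by norm_num, hz⟩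
      filter_upwards [hn] with s hs
      exact tendsto_nhds_unique (hFlim s hs.2) (tendsto_hurwitzApprox_of_one_lt hα hα1 hs.1))
  have hs0 : s₀ ∈ U := ⟨⟨hs, hs'⟩, by rw [mem_ball_zero_iff]; linarith⟩
  rw [← heq hs0]
  exact hFlim s₀ hs0

/-- It amounts to 1 + 1/(4x) ≤ (1 + 1/x)^σ: Bernoulli for σ ≥ 1, the square root for 1/2 ≤ σ ≤ 1.
The right side telescopes, so the remainder of the summation by parts is bounded uniformly in σ. -/
lemma rpow_neg_div_le {σ x : ℝ} (hσ : 1 / 2 ≤ σ) (hx : 1 ≤ x) :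
    (x + 1) ^ (-σ) / x ≤ 4 * (x ^ (-σ) - (x + 1) ^ (-σ)) := by
  have hx0 : 0 < x := by linarith
  have hy0 : 0 < x + 1 := by linarith
  have hb : 1 + σ * (1 / x) ≤ (1 + 1 / x) ^ σ ∨ σ ≤ 1 := by
    rcases le_total σ 1 with h | h
    · exact Or.inr h
    · exact Or.inl (one_add_mul_self_le_rpow_one_add (by have : 0 < 1 / x := by positivity
                                                         linarith) h)
  have key : 1 + 1 / (4 * x) ≤ (1 + 1 / x) ^ σ := by
    rcases hb with h | h
    · refine le_trans ?_ h
      have : 1 / (4 * x) = (1 / 4) * (1 / x) := by field_simp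
      rw [this]
      have h1 : 0 < 1 / x := by positivity
      nlinarith
    · have h1 : (1 + 1 / (4 * x)) ^ (2 : ℕ) ≤ 1 + 1 / x := by
        have : (1 + 1 / (4 * x)) ^ 2 = 1 + (1 / 2) * (1 / x) + (1 / 16) * (1 / x) ^ 2 := by
          field_simp; ring
        rw [this]
        have h2 : 0 < 1 / x := by positivity
        have h3 : 1 / x ≤ 1 := by rw [div_le_one hx0]; exact hx
        nlinarith
      have h2 : (1 + 1 / x) ^ (1 / 2 : ℝ) ≤ (1 + 1 / x) ^ σ :=
        Real.rpow_le_rpow_of_exponent_le (by have : 0 < 1 / x := by positivity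
                                             linarith) hσ
      refine le_trans ?_ h2
      rw [← Real.sqrt_eq_rpow]
      exact Real.le_sqrt_of_sq_le h1
  have hfac : x ^ (-σ) = (x + 1) ^ (-σ) * (1 + 1 / x) ^ σ := by
    have : x + 1 = x * (1 + 1 / x) := by field_simp
    rw [this, Real.mul_rpow hx0.le (by positivity), mul_assoc, ← Real.rpow_add (by positivity)]
    simp
  rw [hfac]
  have hp : 0 < (x + 1) ^ (-σ) := Real.rpow_pos_of_pos hy0 _
  have h5 : (x + 1) ^ (-σ) / x = 4 * ((x + 1) ^ (-σ) * (1 / (4 * x))) := by field_simp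
  rw [h5]
  nlinarith

/-- For integral λ consecutive terms have ratio tending to 1, so the summation by parts uses x^{1-s}
instead. Its boundary term at infinity is cancelled by the correction in `hurwitzApprox`; the one at
M survives as the second error, large near the real axis. -/
lemma norm_hurwitz_sub_sum_le {α : ℝ} (hα : 0 < α) (hα1 : α ≤ 1) {s : ℂ} (hs : 1 / 2 < s.re)
    (hs' : 1 ≤ s.im) {M : ℕ} (hM1 : 1 ≤ M) (hM : 2 * ‖s‖ ≤ M + α) :
    ‖HurwitzZeta.hurwitzZeta (α : UnitAddCircle) s
        - ∑ n ∈ Finset.range M, (((n : ℝ) + α : ℝ) : ℂ) ^ (-s)‖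
      ≤ 32 * ((M : ℝ) + α) ^ (-s.re) + 2 * ((M : ℝ) + α) ^ (1 - s.re) / s.im := by
  have hx : ∀ n : ℕ, 0 < (n : ℝ) + α := fun n => by positivity
  have hx1 : ∀ n : ℕ, M ≤ n → 1 ≤ (n : ℝ) + α := fun n hn => by
    have : (1 : ℝ) ≤ n := by exact_mod_cast hM1.trans hn
    linarith
  have hs1 : s ≠ 1 := fun h => by rw [h] at hs'; norm_num at hs'
  have h1s : 1 - s ≠ 0 := sub_ne_zero.2 hs1.symm
  have him : s.im ≤ ‖1 - s‖ := by
    have := Complex.abs_im_le_norm (1 - s)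
    simp only [Complex.sub_im, Complex.one_im, zero_sub, abs_neg] at this
    exact (le_abs_self _).trans this
  have hratio : ‖s‖ ≤ 2 * ‖1 - s‖ := by
    have := norm_sub_norm_le s 1
    rw [norm_one, norm_sub_rev] at this
    linarith
  set k : ℕ → ℂ := fun n => meanCpow s ((n : ℝ) + α)⁻¹ with hk
  have hk1 : ∀ n : ℕ, ‖k n - 1‖ ≤ ‖s‖ * ((n : ℝ) + α)⁻¹ := fun n => by
    have h1 := norm_meanCpow_sub_le (s := s) (by linarith) (inv_pos.2 (hx n)).le le_rfl
    rwa [sub_zero, abs_of_pos (inv_pos.2 (hx n)), meanCpow_zero] at h1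
  have hkb : ∀ n, M ≤ n → 1 / 2 ≤ ‖k n‖ := by
    intro n hn
    have h1 : ‖k n - 1‖ ≤ 1 / 2 := by
      refine (hk1 n).trans ?_
      rw [← div_eq_mul_inv, div_le_iff₀ (hx n)]
      have : (M : ℝ) ≤ n := by exact_mod_cast hn
      linarith
    have h2 := norm_sub_norm_le 1 (k n)
    rw [norm_one, norm_sub_rev] at h2
    linarith
  set G : ℕ → ℂ := fun n => (((n : ℝ) + α : ℝ) : ℂ) ^ (1 - s) with hG
  set v : ℕ → ℂ := fun n => ((1 - s) * k n)⁻¹ with hv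
  have hGn : ∀ n : ℕ, ‖G n‖ = ((n : ℝ) + α) ^ (1 - s.re) := fun n => by
    simp only [hG]
    rw [Complex.norm_cpow_eq_rpow_re_of_pos (hx n)]; simp
  have hstep : ∀ n, M ≤ n → (((n : ℝ) + α : ℝ) : ℂ) ^ (-s) = (G (n + 1) - G n) * v n := by
    intro n hn
    have hkn : k n ≠ 0 := norm_pos_iff.1 (lt_of_lt_of_le (by norm_num) (hkb n hn))
    rw [eq_mul_inv_iff_mul_eq₀ (mul_ne_zero h1s hkn)]
    exact (cpow_one_sub_succ_sub hα hs1 n).symm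
  -- The subtracted term is the mismatch between the boundary term at Z and the correction. It tends
  -- to 0 because k Z = 1 + O(‖s‖/Z).
  have hlim : Tendsto (fun Z : ℕ => hurwitzApprox α s Z
      - ∑ n ∈ Finset.range M, (((n : ℝ) + α : ℝ) : ℂ) ^ (-s) - (G Z * v Z - G Z / (1 - s))) atTop
      (𝓝 (HurwitzZeta.hurwitzZeta (α : UnitAddCircle) s
        - ∑ n ∈ Finset.range M, (((n : ℝ) + α : ℝ) : ℂ) ^ (-s) - 0)) := by
    refine ((tendsto_hurwitzApprox hα hα1 hs (by linarith)).sub_const _).sub ?_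
    rw [tendsto_zero_iff_norm_tendsto_zero]
    have h4 : Tendsto (fun M : ℕ => (M : ℝ) + α) atTop atTop :=
      tendsto_atTop_add_const_right _ _ tendsto_natCast_atTop_atTop
    have h5 : Tendsto (fun Z : ℕ => (‖1 - s‖⁻¹ * (2 * ‖s‖)) * ((Z : ℝ) + α) ^ (-s.re)) atTop
        (𝓝 0) := by
      simpa using ((tendsto_rpow_neg_atTop (y := s.re) (by linarith)).comp h4).const_mul _
    refine squeeze_zero' (Eventually.of_forall fun _ => norm_nonneg _) ?_ h5
    filter_upwards [eventually_ge_atTop M] with Z hZ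
    have hkn : k Z ≠ 0 := norm_pos_iff.1 (lt_of_lt_of_le (by norm_num) (hkb Z hZ))
    have h6 : G Z * v Z - G Z / (1 - s) = G Z * (1 - s)⁻¹ * ((k Z)⁻¹ * (1 - k Z)) := by
      simp only [hv]; field_simp
    rw [h6, norm_mul, norm_mul, norm_mul, norm_inv, norm_inv, hGn, norm_sub_rev 1 (k Z)]
    have h7 : ‖k Z‖⁻¹ ≤ 2 := by
      rw [show (2 : ℝ) = (1 / 2)⁻¹ by norm_num]
      exact inv_anti₀ (by norm_num) (hkb Z hZ)
    have h8 : ((Z : ℝ) + α) ^ (1 - s.re) = ((Z : ℝ) + α) ^ (-s.re) * ((Z : ℝ) + α) := by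
      rw [sub_eq_neg_add, Real.rpow_add_one (hx Z).ne']
    calc _ ≤ ((Z : ℝ) + α) ^ (1 - s.re) * ‖1 - s‖⁻¹ * (2 * (‖s‖ * ((Z : ℝ) + α)⁻¹)) := by
          gcongr
          exact hk1 Z
      _ = _ := by
          rw [h8]
          have := (hx Z).ne'
          field_simp
  rw [sub_zero] at hlim
  refine le_of_tendsto hlim.norm ?_
  filter_upwards [eventually_ge_atTop M] with Z hZ
  have hid : hurwitzApprox α s Z - ∑ n ∈ Finset.range M, (((n : ℝ) + α : ℝ) : ℂ) ^ (-s)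
      - (G Z * v Z - G Z / (1 - s))
      = - (∑ n ∈ Finset.Ico M Z, G (n + 1) * (v (n + 1) - v n)) - G M * v M := by
    have h1 := sum_Ico_by_parts hstep hZ
    rw [Finset.sum_Ico_eq_sub _ hZ] at h1
    rw [hurwitzApprox]
    simp only [hG] at h1 ⊢
    linear_combination h1
  rw [hid]
  refine (norm_sub_le _ _).trans (add_le_add ?_ ?_)
  · rw [norm_neg]
    have h1s0 : 0 < ‖1 - s‖ := norm_pos_iff.2 h1s
    calc _ ≤ ∑ n ∈ Finset.Ico M Z, 32 * (((n : ℝ) + α) ^ (-s.re)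
          - (((n + 1 : ℕ) : ℝ) + α) ^ (-s.re)) := by
          refine norm_sum_le_of_le _ fun n hn => ?_
          have hn' := (Finset.mem_Ico.1 hn).1
          have hvd : ‖v (n + 1) - v n‖
              ≤ 8 * (((n : ℝ) + α)⁻¹ - (((n + 1 : ℕ) : ℝ) + α)⁻¹) := by
            have h2 : v (n + 1) - v n = (1 - s)⁻¹ * ((k (n + 1))⁻¹ - (k n)⁻¹) := by
              simp only [hv, mul_inv]; ring
            rw [h2, norm_mul, norm_inv]
            have h3 := norm_inv_sub_inv_le (c := 1 / 2) (by norm_num) (hkb _ (by omega : M ≤ n + 1))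
              (hkb n hn')
            have h4 := norm_meanCpow_sub_le (s := s) (by linarith) (inv_pos.2 (hx (n + 1))).le
              (inv_pos.2 (hx n)).le
            rw [abs_sub_comm, abs_of_nonneg (inv_sub_inv_nonneg hα n)] at h4
            have h5 := inv_sub_inv_nonneg hα n
            rw [inv_mul_le_iff₀ h1s0]
            have h6 : ‖k (n + 1) - k n‖ / (1 / 2) ^ 2 = 4 * ‖k (n + 1) - k n‖ := by ring
            rw [h6] at h3
            have h7 := mul_le_mul_of_nonneg_right hratio h5
            have h8 : ‖k (n + 1) - k n‖ ≤ ‖s‖ * (((n : ℝ) + α)⁻¹ - (((n + 1 : ℕ) : ℝ) + α)⁻¹) := h4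
            linarith
          rw [norm_mul, hGn]
          have h9 := rpow_neg_div_le hs.le (hx1 n hn')
          have h10 : (((n + 1 : ℕ) : ℝ) + α) = (n : ℝ) + α + 1 := by push_cast; ring
          rw [h10] at hvd ⊢
          set x := (n : ℝ) + α with hxd
          have hx0 : 0 < x := hx n
          have h11 : (x + 1) ^ (1 - s.re) = (x + 1) ^ (-s.re) * (x + 1) := by
            rw [sub_eq_neg_add, Real.rpow_add_one (by positivity)]
          rw [h11]
          calc _ ≤ (x + 1) ^ (-s.re) * (x + 1) * (8 * (x⁻¹ - (x + 1)⁻¹)) := by gcongr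
            _ = 8 * ((x + 1) ^ (-s.re) / x) := by field_simp; ring
            _ ≤ _ := by linarith
      _ ≤ 32 * ((M : ℝ) + α) ^ (-s.re) := by
          rw [← Finset.mul_sum]
          have htel : ∑ n ∈ Finset.Ico M Z, (((n : ℝ) + α) ^ (-s.re)
              - (((n + 1 : ℕ) : ℝ) + α) ^ (-s.re))
              = ((M : ℝ) + α) ^ (-s.re) - ((Z : ℝ) + α) ^ (-s.re) := by
            clear hid hlim
            induction Z, hZ using Nat.le_induction with
            | base => simp
            | succ Z hZ ih => rw [Finset.sum_Ico_succ_top hZ, ih]; ring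
          rw [htel]
          have : 0 ≤ ((Z : ℝ) + α) ^ (-s.re) := Real.rpow_nonneg (hx Z).le _
          linarith
  · rw [norm_mul, hGn]
    simp only [hv]
    rw [norm_inv, norm_mul]
    have h1 : (‖1 - s‖ * ‖k M‖)⁻¹ ≤ 2 / s.im := by
      rw [show 2 / s.im = (s.im * (1 / 2))⁻¹ by field_simp]
      have h0 : 0 < s.im := by linarith
      exact inv_anti₀ (by positivity) (mul_le_mul him (hkb M le_rfl) (by norm_num) (by positivity))
    calc _ ≤ ((M : ℝ) + α) ^ (1 - s.re) * (2 / s.im) :=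
          mul_le_mul_of_nonneg_left h1 (Real.rpow_nonneg (hx M).le _)
      _ = _ := by ring

/-- A bound for the inverse distance of `e^{2πi lam}` to `1`; it is `1` for integral `lam`. -/
noncomputable def lamBound (lam : ℝ) : ℝ :=
  open Classical in
  if ∃ k : ℤ, lam = k then 1 else max 1 ‖Complex.exp (2 * Real.pi * Complex.I * lam) - 1‖⁻¹

lemma one_le_lamBound (lam : ℝ) : 1 ≤ lamBound lam := by
  unfold lamBound; split_ifs
  · exact le_rfl
  · exact le_max_left _ _

lemma lerchTerm_int {lam : ℝ} (h : ∃ k : ℤ, lam = k) (α : ℝ) (s : ℂ) (n : ℕ) :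
    lerchTerm lam α s n = (((n : ℝ) + α : ℝ) : ℂ) ^ (-s) := by
  obtain ⟨k, rfl⟩ := h
  have : Complex.exp (2 * Real.pi * Complex.I * ((k : ℝ) : ℂ)) = 1 :=
    Complex.exp_eq_one_iff.2 ⟨k, by push_cast; ring⟩
  rw [lerchTerm_eq, this, one_pow, one_mul]

/-- Approximation of the Lerch zeta function by partial sums of its series. -/
lemma norm_lerchZeta_sub_sum_le {lam α K : ℝ} (hα : 0 < α) (hα1 : α ≤ 1) (hK : lamBound lam ≤ K)
    {s : ℂ} (hs : 1 / 2 < s.re) (hs' : 1 ≤ s.im) {M : ℕ} (hM1 : 1 ≤ M)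
    (hM : 2 * ‖s‖ * K ≤ M + α) :
    ‖lerchZeta lam α s - ∑ n ∈ Finset.range M, lerchTerm lam α s n‖
      ≤ 32 * K * ((M : ℝ) + α) ^ (-s.re) + 2 * ((M : ℝ) + α) ^ (1 - s.re) / s.im := by
  have hK1 : 1 ≤ K := (one_le_lamBound lam).trans hK
  have hx : 0 < (M : ℝ) + α := by positivity
  have hp := Real.rpow_nonneg hx.le (-s.re)
  have hp' := Real.rpow_nonneg hx.le (1 - s.re)
  by_cases h : ∃ k : ℤ, lam = k
  · have h1 : lerchZeta lam α s = HurwitzZeta.hurwitzZeta (α : UnitAddCircle) s := by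
      rw [lerchZeta, if_pos h]
    simp only [lerchTerm_int h]
    rw [h1]
    refine (norm_hurwitz_sub_sum_le hα hα1 hs hs' hM1 ?_).trans ?_
    · refine le_trans ?_ hM
      exact le_mul_of_one_le_right (by positivity) hK1
    · gcongr
      linarith
  · have hne := norm_pos_iff.2 (sub_ne_zero.2 (exp_two_pi_ne_one h))
    rw [lamBound, if_neg h] at hK
    have hK2 := (le_max_right _ _).trans hK
    have hK0 : 0 < K := by linarith
    have := norm_lerchZeta_sub_sum_le_of_not_int hα h (κ := K⁻¹) (by positivity)
      (inv_le_of_inv_le₀ hne hK2) (s := s) (by linarith) (M := M) (by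
        rw [inv_mul_eq_div, le_div_iff₀ hK0]; exact hM)
    refine this.trans ?_
    have h2 : 6 / K⁻¹ = 6 * K := by field_simp
    rw [h2]
    have h3 : 0 ≤ 2 * ((M : ℝ) + α) ^ (1 - s.re) / s.im :=
      div_nonneg (by linarith) (by linarith)
    nlinarith [mul_nonneg hK0.le hp]

lemma ae_avg_pos (T : ℝ) : ∀ᵐ t ∂avg T, t ∈ Set.Ioc 0 T :=
  Measure.ae_smul_measure (ae_restrict_mem measurableSet_Ioc) _

/-- For integral λ the function is continuous off s = 1, which t > 0 excludes; otherwise it is a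
pointwise limit of continuous partial sums. -/
lemma aestronglyMeasurable_lerchZeta {lam α : ℝ} (hα : 0 < α) {σ : ℝ}
    (hσ : 0 < σ) (T : ℝ) :
    AEStronglyMeasurable (fun t : ℝ => lerchZeta lam α ((σ : ℂ) + (t : ℂ) * Complex.I)) (avg T) := by
  by_cases h : ∃ k : ℤ, lam = k
  · have h1 : ∀ s, lerchZeta lam α s = HurwitzZeta.hurwitzZeta (α : UnitAddCircle) s := fun s => by
      rw [lerchZeta, if_pos h]
    simp only [h1]
    refine AEStronglyMeasurable.mono_ac (Measure.smul_absolutelyContinuous) ?_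
    refine ContinuousOn.aestronglyMeasurable (fun t ht => ?_) measurableSet_Ioc
    have hne : ((σ : ℂ) + (t : ℂ) * Complex.I) ≠ 1 := fun h => by
      have := congrArg Complex.im h
      simp at this
      linarith [ht.1]
    have hd := (HurwitzZeta.differentiableAt_hurwitzZeta (α : UnitAddCircle) hne).continuousAt
    exact (ContinuousAt.comp (f := fun t : ℝ => (σ : ℂ) + (t : ℂ) * Complex.I) hd
      (by fun_prop)).continuousWithinAt
  · refine aestronglyMeasurable_of_tendsto_ae atTop (f := fun (N : ℕ) (t : ℝ) =>
      ∑ n ∈ Finset.range N, lerchTerm lam α ((σ : ℂ) + (t : ℂ) * Complex.I) n) (fun N => ?_)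
      (ae_of_all _ fun t => tendsto_sum_lerchTerm hα h (by simpa using hσ))
    refine Continuous.aestronglyMeasurable (continuous_finsetSum _ fun n _ => ?_)
    simp only [lerchTerm_eq]
    refine continuous_const.mul (Continuous.const_cpow (by fun_prop) (Or.inl ?_))
    have : 0 < (n : ℝ) + α := by positivity
    exact_mod_cast this.ne'

end LerchMean

/-! ### Mean squares of Dirichlet polynomials and sums of squared radii. -/

namespace LerchMean
open MeasureTheory Filter Topology

/-- For m ≥ n, log((m+α)/(n+α)) ≥ 1 - (n+α)/(m+α) = (m-n)/(m+α), and m + α ≤ Y. -/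
lemma abs_sub_div_le_abs_log_sub {α : ℝ} (hα : 0 < α) (hα1 : α ≤ 1) {Y m n : ℕ} (hm : m < Y)
    (hn : n < Y) :
    |(m : ℝ) - n| / Y ≤ |Real.log (m + α) - Real.log (n + α)| := by
  wlog h : n ≤ m generalizing m n
  · rw [abs_sub_comm, abs_sub_comm (Real.log _)]
    exact this hn hm (by omega)
  have hm0 : 0 < (m : ℝ) + α := by positivity
  have hn0 : 0 < (n : ℝ) + α := by positivity
  have hnm : (n : ℝ) ≤ m := by exact_mod_cast h
  have hmY : (m : ℝ) + 1 ≤ Y := by exact_mod_cast hm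
  have h1 := Real.one_sub_inv_le_log_of_pos (x := ((m : ℝ) + α) / (n + α)) (by positivity)
  rw [Real.log_div hm0.ne' hn0.ne', inv_div] at h1
  refine le_trans ?_ (le_abs_self _)
  refine le_trans ?_ h1
  rw [abs_of_nonneg (by linarith), one_sub_div hm0.ne', add_sub_add_right_eq_sub]
  have : 0 ≤ (m : ℝ) - n := by linarith
  gcongr
  linarith

lemma sum_inv_abs_sub_le {Y m : ℕ} (hm : m < Y) :
    ∑ n ∈ Finset.range Y, (if m = n then 0 else 1 / |(m : ℝ) - n|) ≤ 2 * (1 + Real.log Y) := by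
  set h : ℕ → ℝ := fun j => ((j : ℝ) + 1)⁻¹ with hh
  have hharm : ∀ k ≤ Y, ∑ j ∈ Finset.range k, h j ≤ 1 + Real.log Y := by
    intro k hk
    have h1 := harmonic_le_one_add_log Y
    have h2 : ((harmonic Y : ℚ) : ℝ) = ∑ j ∈ Finset.range Y, h j := by
      simp [harmonic, hh]
    rw [h2] at h1
    refine le_trans ?_ h1
    exact Finset.sum_le_sum_of_subset_of_nonneg (Finset.range_subset_range.2 hk)
      fun j _ _ => by simp only [hh]; positivity
  rw [← Finset.sum_range_add_sum_Ico _ (show m + 1 ≤ Y by omega), Finset.sum_range_succ, if_pos rfl,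
    add_zero, two_mul]
  refine add_le_add ?_ ?_
  · refine le_trans (le_of_eq ?_) (hharm m hm.le)
    rw [← Finset.sum_range_reflect]
    refine Finset.sum_congr rfl fun n hn => ?_
    have hn' := Finset.mem_range.1 hn
    rw [if_neg (by omega)]
    simp only [hh]
    have : ((m - 1 - n : ℕ) : ℝ) = (m : ℝ) - 1 - n := by
      rw [Nat.cast_sub (by omega), Nat.cast_sub (by omega)]; simp
    rw [this]
    rw [one_div]
    congr 1
    rw [abs_of_pos (by linarith [n.cast_nonneg (α := ℝ)])]
    ring
  · rw [Finset.sum_Ico_eq_sum_range]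
    refine le_trans (le_of_eq ?_) (hharm (Y - (m + 1)) (by omega))
    refine Finset.sum_congr rfl fun n hn => ?_
    rw [if_neg (by omega)]
    simp only [hh, one_div]
    congr 1
    push_cast
    rw [abs_sub_comm, abs_of_pos (by linarith [n.cast_nonneg (α := ℝ)])]
    ring

/-- Mean value theorem for generalized Dirichlet polynomials. -/
lemma integral_normSq_dirichlet_le {α : ℝ} (hα : 0 < α) (hα1 : α ≤ 1) {T : ℝ} (hT : 0 < T)
    (N Y : ℕ) (a : ℕ → ℂ) :
    ∫ t, ‖∑ n ∈ Finset.Ico N Y, a n *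
        Complex.exp (((-(t * Real.log (n + α)) : ℝ) : ℂ) * Complex.I)‖ ^ 2 ∂avg T
      ≤ (1 + 4 * Y * (1 + Real.log Y) / T) * ∑ n ∈ Finset.Ico N Y, ‖a n‖ ^ 2 := by
  have := isProbabilityMeasure_avg hT
  set ω : ℕ → ℝ := fun n => Real.log (n + α) with hω
  set I : ℝ → ℂ := fun f => ∫ t, Complex.exp (((-(t * f) : ℝ) : ℂ) * Complex.I) ∂avg T with hI
  -- A symmetric majorant of the Gram matrix of the exponentials.
  set W : ℕ → ℕ → ℝ := fun m n => (if m = n then 1 else 0)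
    + 2 * Y / T * (if m = n then 0 else 1 / |(m : ℝ) - n|) with hW
  have hIW : ∀ m ∈ Finset.Ico N Y, ∀ n ∈ Finset.Ico N Y, ‖I (ω m - ω n)‖ ≤ W m n := by
    intro m hm n hn
    have hm' := (Finset.mem_Ico.1 hm).2
    have hn' := (Finset.mem_Ico.1 hn).2
    simp only [hW]
    split_ifs with h
    · subst h
      simp [hI]
    · have hY : (0 : ℝ) < Y := by
        have : 0 < Y := by omega
        exact_mod_cast this
      have hmn : (m : ℝ) - n ≠ 0 := sub_ne_zero.2 (by exact_mod_cast h)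
      have hmn' : 0 < |(m : ℝ) - n| := abs_pos.2 hmn
      have h1 := abs_sub_div_le_abs_log_sub hα hα1 hm' hn'
      have h2 : 0 < |ω m - ω n| := lt_of_lt_of_le (by positivity) h1
      refine (norm_integral_avg_exp_le hT (abs_pos.1 h2)).trans ?_
      rw [zero_add]
      calc 2 / (T * |ω m - ω n|) ≤ 2 / (T * (|(m : ℝ) - n| / Y)) := by
            gcongr
        _ = _ := by field_simp
  have hsq : ∀ t : ℝ, ((‖∑ n ∈ Finset.Ico N Y, a n *
      Complex.exp (((-(t * ω n) : ℝ) : ℂ) * Complex.I)‖ ^ 2 : ℝ) : ℂ)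
      = ∑ m ∈ Finset.Ico N Y, ∑ n ∈ Finset.Ico N Y, a m * (starRingEnd ℂ) (a n) *
        Complex.exp (((-(t * (ω m - ω n)) : ℝ) : ℂ) * Complex.I) := by
    intro t
    rw [Complex.ofReal_pow, ← Complex.mul_conj', map_sum, Finset.sum_mul_sum]
    refine Finset.sum_congr rfl fun m _ => Finset.sum_congr rfl fun n _ => ?_
    rw [map_mul, ← Complex.exp_conj, map_mul, Complex.conj_I, Complex.conj_ofReal]
    rw [show (((-(t * (ω m - ω n)) : ℝ) : ℂ) * Complex.I) = ((-(t * ω m) : ℝ) : ℂ) * Complex.I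
      + ((-(t * ω n) : ℝ) : ℂ) * -Complex.I by push_cast; ring, Complex.exp_add]
    ring
  have hInt : ((∫ t, ‖∑ n ∈ Finset.Ico N Y, a n *
      Complex.exp (((-(t * ω n) : ℝ) : ℂ) * Complex.I)‖ ^ 2 ∂avg T : ℝ) : ℂ)
      = ∑ m ∈ Finset.Ico N Y, ∑ n ∈ Finset.Ico N Y, a m * (starRingEnd ℂ) (a n) * I (ω m - ω n) := by
    rw [← integral_complex_ofReal]
    simp only [hsq]
    rw [integral_finsetSum _ fun m _ => integrable_avg_of_continuous (by fun_prop)]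
    refine Finset.sum_congr rfl fun m _ => ?_
    rw [integral_finsetSum _ fun m _ => integrable_avg_of_continuous (by fun_prop)]
    refine Finset.sum_congr rfl fun n _ => ?_
    rw [integral_const_mul]
  have hWs : ∀ m n, W m n = W n m := fun m n => by
    simp only [hW, eq_comm, abs_sub_comm]
  have hW0 : ∀ m n, 0 ≤ W m n := fun m n => by
    simp only [hW]
    split_ifs <;> positivity
  -- Schur's test: 2|a_m a_n| ≤ |a_m|² + |a_n|² and the symmetry of W reduce the quadratic form to
  -- row sums, which are harmonic sums.
  have hbound : ∫ t, ‖∑ n ∈ Finset.Ico N Y, a n *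
      Complex.exp (((-(t * ω n) : ℝ) : ℂ) * Complex.I)‖ ^ 2 ∂avg T
      ≤ ∑ m ∈ Finset.Ico N Y, ∑ n ∈ Finset.Ico N Y,
        (‖a m‖ ^ 2 * W m n / 2 + ‖a n‖ ^ 2 * W m n / 2) := by
    refine (le_abs_self _).trans ?_
    rw [← Real.norm_eq_abs, ← Complex.norm_real, hInt]
    refine norm_sum_le_of_le _ fun m hm => norm_sum_le_of_le _ fun n hn => ?_
    rw [norm_mul, norm_mul, RCLike.norm_conj]
    have h1 := hIW m hm n hn
    have h2 : ‖a m‖ * ‖a n‖ * ‖I (ω m - ω n)‖ ≤ ‖a m‖ * ‖a n‖ * W m n := by gcongr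
    have h3 := mul_nonneg (sq_nonneg (‖a m‖ - ‖a n‖)) (hW0 m n)
    nlinarith
  refine hbound.trans ?_
  have hsym : ∑ m ∈ Finset.Ico N Y, ∑ n ∈ Finset.Ico N Y,
      (‖a m‖ ^ 2 * W m n / 2 + ‖a n‖ ^ 2 * W m n / 2)
      = ∑ m ∈ Finset.Ico N Y, ‖a m‖ ^ 2 * ∑ n ∈ Finset.Ico N Y, W m n := by
    simp only [Finset.sum_add_distrib]
    rw [Finset.sum_comm (f := fun m n => ‖a n‖ ^ 2 * W m n / 2), ← Finset.sum_add_distrib]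
    refine Finset.sum_congr rfl fun m _ => ?_
    rw [Finset.mul_sum, ← Finset.sum_add_distrib]
    refine Finset.sum_congr rfl fun n _ => ?_
    rw [hWs n m]; ring
  rw [hsym, Finset.mul_sum]
  refine Finset.sum_le_sum fun m hm => ?_
  rw [mul_comm]
  refine mul_le_mul_of_nonneg_right ?_ (sq_nonneg _)
  have hm' := Finset.mem_Ico.1 hm
  calc ∑ n ∈ Finset.Ico N Y, W m n ≤ ∑ n ∈ Finset.range Y, W m n :=
        Finset.sum_le_sum_of_subset_of_nonneg (fun n hn => Finset.mem_range.2
          (Finset.mem_Ico.1 hn).2) fun n _ _ => hW0 m n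
    _ = 1 + 2 * Y / T * ∑ n ∈ Finset.range Y, (if m = n then 0 else 1 / |(m : ℝ) - n|) := by
        simp only [hW, Finset.sum_add_distrib, ← Finset.mul_sum]
        rw [Finset.sum_ite_eq, if_pos (Finset.mem_range.2 hm'.2)]
    _ ≤ 1 + 2 * Y / T * (2 * (1 + Real.log Y)) := by
        gcongr
        exact sum_inv_abs_sub_le hm'.2
    _ = _ := by ring

/-- The comparison with ∫ y^{-1-a} dy in discrete form: each term is at most the increment of
-y^{-a}/a from y - 1 to y. -/
lemma sum_rpow_le {a : ℝ} (ha : 0 < a) {N M : ℕ} (hN : 2 ≤ N) :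
    ∑ n ∈ Finset.Ico N M, (n : ℝ) ^ (-1 - a) ≤ ((N : ℝ) - 1) ^ (-a) / a := by
  rcases le_total M N with h | h
  · rw [Finset.Ico_eq_empty (by omega), Finset.sum_empty]
    have : (2 : ℝ) ≤ N := by exact_mod_cast hN
    have := Real.rpow_nonneg (show 0 ≤ (N : ℝ) - 1 by linarith) (-a)
    positivity
  have hterm : ∀ y : ℝ, 2 ≤ y → y ^ (-1 - a) ≤ ((y - 1) ^ (-a) - y ^ (-a)) / a := by
    intro y hy
    have hy0 : 0 < y := by linarith
    have h1 : 0 < 1 - 1 / y := by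
      rw [sub_pos, div_lt_one hy0]; linarith
    have h2 : (y - 1) ^ (-a) = y ^ (-a) * (1 - 1 / y) ^ (-a) := by
      rw [← Real.mul_rpow hy0.le h1.le]
      congr 1
      field_simp
    have h3 : 1 + a / y ≤ (1 - 1 / y) ^ (-a) := by
      rw [Real.rpow_def_of_pos h1]
      have h4 := Real.log_le_sub_one_of_pos h1
      have h5 := Real.add_one_le_exp (Real.log (1 - 1 / y) * -a)
      refine le_trans ?_ h5
      have : a / y = a * (1 / y) := by ring
      rw [this]
      nlinarith
    have h6 : y ^ (-1 - a) = y ^ (-a) / y := by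
      rw [show (-1 - a) = -a - 1 by ring, Real.rpow_sub_one hy0.ne']
    rw [h6, h2, le_div_iff₀ ha]
    have h7 : 0 < y ^ (-a) := Real.rpow_pos_of_pos hy0 _
    calc y ^ (-a) / y * a = y ^ (-a) * (1 + a / y) - y ^ (-a) := by ring
      _ ≤ _ := by gcongr
  have hsum : ∑ n ∈ Finset.Ico N M, (n : ℝ) ^ (-1 - a)
      ≤ (((N : ℝ) - 1) ^ (-a) - ((M : ℝ) - 1) ^ (-a)) / a := by
    induction M, h using Nat.le_induction with
    | base => simp
    | succ M hM ih =>
      rw [Finset.sum_Ico_succ_top hM]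
      have h2 : (2 : ℝ) ≤ M := by exact_mod_cast hN.trans hM
      have := hterm M h2
      refine (add_le_add ih this).trans (le_of_eq ?_)
      push_cast
      rw [add_sub_cancel_right]
      ring
  refine hsum.trans ?_
  gcongr
  have hM : (2 : ℝ) ≤ M := by exact_mod_cast hN.trans h
  have := Real.rpow_nonneg (show 0 ≤ (M : ℝ) - 1 by linarith) (-a)
  linarith

lemma radius_sq_le {α σ ε : ℝ} (hα : 0 < α) (hε : 0 < ε) (hσ : 1 / 2 + ε ≤ σ) {n : ℕ} (hn : 1 ≤ n) :
    radius σ α n ^ 2 ≤ (n : ℝ) ^ (-1 - 2 * ε) := by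
  have hn1 : (1 : ℝ) ≤ n := by exact_mod_cast hn
  rw [radius, ← Real.rpow_natCast, ← Real.rpow_mul (by positivity)]
  push_cast
  calc ((n : ℝ) + α) ^ (-σ * 2) ≤ (n : ℝ) ^ (-σ * 2) :=
        Real.rpow_le_rpow_of_nonpos (by linarith) (by linarith) (by linarith)
    _ ≤ _ := Real.rpow_le_rpow_of_exponent_le hn1 (by linarith)

lemma sum_radius_sq_tail_le {α σ ε : ℝ} (hα : 0 < α) (hε : 0 < ε) (hσ : 1 / 2 + ε ≤ σ) {N : ℕ}
    (hN : 2 ≤ N) (M : ℕ) :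
    ∑ n ∈ Finset.Ico N M, radius σ α n ^ 2 ≤ ((N : ℝ) - 1) ^ (-(2 * ε)) / (2 * ε) :=
  (Finset.sum_le_sum fun n hn => radius_sq_le hα hε hσ
    (by have := (Finset.mem_Ico.1 hn).1; omega)).trans (sum_rpow_le (by positivity) hN)

lemma sum_radius_sq_le {α σ ε : ℝ} (hα : 0 < α) (hε : 0 < ε) (hσ : 1 / 2 + ε ≤ σ) {N : ℕ}
    (hN : 2 ≤ N) :
    ∑ n ∈ Finset.range N, radius σ α n ^ 2 ≤ α ^ (-(2 * σ)) + 1 + 1 / (2 * ε) := by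
  -- The term n = 0 is kept apart: it is α^{-2σ}, unbounded as α → 0 or, for fixed α < 1, as σ
  -- grows.
  rw [← Finset.sum_range_add_sum_Ico _ hN, Finset.sum_range_succ, Finset.sum_range_one]
  have h1 := sum_radius_sq_tail_le hα hε hσ le_rfl N
  have h2 := radius_sq_le hα hε hσ (le_refl 1)
  have h3 : radius σ α 0 ^ 2 = α ^ (-(2 * σ)) := by
    rw [radius, ← Real.rpow_natCast, ← Real.rpow_mul (by positivity)]
    push_cast
    rw [zero_add]
    congr 1; ring
  rw [Nat.cast_one, Real.one_rpow] at h2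
  norm_num at h1
  rw [h3]
  refine add_le_add (add_le_add le_rfl h2) (h1.trans (le_of_eq ?_))
  field_simp

end LerchMean

/-! ### Comparison of characteristic functions with free parameters. -/

namespace LerchMean
open MeasureTheory Filter Topology
open scoped RealInnerProductSpace

lemma lerchTerm_vertical {lam α : ℝ} (hα : 0 < α) (σ t : ℝ) (n : ℕ) :
    lerchTerm lam α ((σ : ℂ) + (t : ℂ) * Complex.I) n =
      (Complex.exp (2 * Real.pi * Complex.I * lam) ^ n * (radius σ α n : ℂ)) *
        Complex.exp (((-(t * Real.log (n + α)) : ℝ) : ℂ) * Complex.I) := by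
  have hx : 0 < (n : ℝ) + α := by positivity
  have hx' : (((n : ℝ) + α : ℝ) : ℂ) ≠ 0 := by exact_mod_cast hx.ne'
  have h1 : (((n : ℝ) + α : ℝ) : ℂ) ^ (-((t : ℂ) * Complex.I))
      = Complex.exp (((-(t * Real.log (n + α)) : ℝ) : ℂ) * Complex.I) := by
    rw [Complex.cpow_def_of_ne_zero hx', ← Complex.ofReal_log hx.le]
    congr 1
    push_cast
    ring
  rw [lerchTerm_eq, neg_add, Complex.cpow_add _ _ hx', h1, radius, Complex.ofReal_cpow hx.le,
    Complex.ofReal_neg σ, ← mul_assoc]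

lemma norm_exp_mul_I_sub_exp_mul_I_le (a b : ℝ) :
    ‖Complex.exp (a * Complex.I) - Complex.exp (b * Complex.I)‖ ≤ |a - b| := by
  have h : Complex.exp (a * Complex.I) - Complex.exp (b * Complex.I)
      = Complex.exp (b * Complex.I) * (Complex.exp (Complex.I * ((a - b : ℝ) : ℂ)) - 1) := by
    rw [mul_sub, ← Complex.exp_add, mul_one]
    congr 2
    push_cast; ring
  rw [h, norm_mul, Complex.norm_exp_ofReal_mul_I, one_mul]
  exact Real.norm_exp_I_mul_ofReal_sub_one_le

lemma norm_exp_inner_sub_le (v z w : ℂ) :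
    ‖Complex.exp ((⟪z, v⟫ : ℝ) * Complex.I) - Complex.exp ((⟪w, v⟫ : ℝ) * Complex.I)‖
      ≤ ‖v‖ * ‖z - w‖ := by
  refine (norm_exp_mul_I_sub_exp_mul_I_le _ _).trans ?_
  rw [← inner_sub_left, mul_comm]
  exact abs_real_inner_le_norm _ _

lemma integral_le_sqrt_integral_sq {X : Type*} [MeasurableSpace X] (μ : Measure X)
    [IsProbabilityMeasure μ] {f : X → ℝ} (hf : Integrable f μ)
    (hf2 : Integrable (fun x => f x ^ 2) μ) :
    ∫ x, f x ∂μ ≤ Real.sqrt (∫ x, f x ^ 2 ∂μ) := by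
  refine Real.le_sqrt_of_sq_le ?_
  set m := ∫ x, f x ∂μ with hm
  have h1 : 0 ≤ ∫ x, (f x - m) ^ 2 ∂μ := integral_nonneg fun x => sq_nonneg _
  have h2 : ∫ x, (f x - m) ^ 2 ∂μ = ∫ x, f x ^ 2 ∂μ - m ^ 2 := by
    have : ∀ x, (f x - m) ^ 2 = (f x ^ 2 - 2 * m * f x) + m ^ 2 := fun x => by ring
    simp only [this]
    have hi : Integrable (fun x => f x ^ 2 - 2 * m * f x) μ := hf2.sub (hf.const_mul _)
    rw [integral_add hi (integrable_const _), integral_sub hf2 (hf.const_mul _), integral_const_mul, integral_const, probReal_univ, ← hm]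
    simp only [smul_eq_mul, one_mul]
    ring
  linarith

lemma avg_real_Iio_le {T a : ℝ} (hT : 0 < T) (ha : 0 ≤ a) : (avg T).real (Set.Iio a) ≤ a / T := by
  rw [avg, measureReal_ennreal_smul_apply, ENNReal.toReal_ofReal (by positivity),
    inv_mul_eq_div]
  gcongr
  rw [measureReal_restrict_apply measurableSet_Iio]
  calc volume.real (Set.Iio a ∩ Set.Ioc 0 T) ≤ volume.real (Set.Ico 0 a) := by
        refine measureReal_mono (fun t ht => ⟨ht.2.1.le, ht.1⟩) (by simp)
    _ = a := by rw [Real.volume_real_Ico_of_le ha, sub_zero]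

lemma integrable_exp_inner {X : Type*} [MeasurableSpace X] (μ : Measure X)
    [IsFiniteMeasure μ] {f : X → ℂ} (hf : AEStronglyMeasurable f μ) (v : ℂ) :
    Integrable (fun x => Complex.exp ((⟪f x, v⟫ : ℝ) * Complex.I)) μ := by
  refine Integrable.of_bound (C := 1) ?_ (ae_of_all _ fun x => ?_)
  · exact (show Continuous fun z : ℂ => Complex.exp ((⟪z, v⟫ : ℝ) * Complex.I) by
      fun_prop).comp_aestronglyMeasurable hf
  · rw [Complex.norm_exp_ofReal_mul_I]

lemma continuous_sum_lerchTerm {lam α : ℝ} (hα : 0 < α) (σ : ℝ) (F : Finset ℕ) :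
    Continuous fun t : ℝ => ∑ n ∈ F, lerchTerm lam α ((σ : ℂ) + (t : ℂ) * Complex.I) n := by
  simp only [lerchTerm_vertical hα]
  fun_prop

/-- Replacing the Lerch zeta function by a short partial sum in its characteristic function. -/
lemma norm_integral_exp_lerch_sub_le {lam α K σ T B : ℝ} (hα : 0 < α) (hα1 : α ≤ 1)
    (hK : lamBound lam ≤ K) (hσ : 1 / 2 < σ) (hT : 1 ≤ T) {N M : ℕ} (hM1 : 1 ≤ M) (hNM : N ≤ M)
    (hM : 2 * (σ + T) * K ≤ M + α) (hB : ∑ n ∈ Finset.Ico N M, radius σ α n ^ 2 ≤ B) (v : ℂ) :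
    ‖∫ t, Complex.exp ((⟪lerchZeta lam α ((σ : ℂ) + (t : ℂ) * Complex.I), v⟫ : ℝ) * Complex.I) ∂avg T
      - ∫ t, Complex.exp ((⟪∑ n ∈ Finset.range N,
          lerchTerm lam α ((σ : ℂ) + (t : ℂ) * Complex.I) n, v⟫ : ℝ) * Complex.I) ∂avg T‖
      ≤ 2 * T ^ (-(1 / 4) : ℝ) + ‖v‖ * (Real.sqrt ((1 + 4 * M * (1 + Real.log M) / T) * B)
        + (32 * K * ((M : ℝ) + α) ^ (-σ) + 2 * ((M : ℝ) + α) ^ (1 - σ) / T ^ (3 / 4 : ℝ))) := by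
  have hT0 : 0 < T := by linarith
  have := isProbabilityMeasure_avg hT0
  have hK1 : 1 ≤ K := (one_le_lamBound lam).trans hK
  set L : ℝ → ℂ := fun t => lerchZeta lam α ((σ : ℂ) + (t : ℂ) * Complex.I) with hL
  set D : ℝ → ℂ := fun t => ∑ n ∈ Finset.range N,
    lerchTerm lam α ((σ : ℂ) + (t : ℂ) * Complex.I) n with hD
  set S : ℝ → ℂ := fun t => ∑ n ∈ Finset.Ico N M,
    lerchTerm lam α ((σ : ℂ) + (t : ℂ) * Complex.I) n with hS
  set E : ℝ := 32 * K * ((M : ℝ) + α) ^ (-σ) + 2 * ((M : ℝ) + α) ^ (1 - σ) / T ^ (3 / 4 : ℝ) with hE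
  have hx : 0 < (M : ℝ) + α := by positivity
  have hE0 : 0 ≤ E := by positivity
  have hLm : AEStronglyMeasurable L (avg T) := aestronglyMeasurable_lerchZeta hα (by linarith) T
  have hDc : Continuous D := continuous_sum_lerchTerm hα σ _
  have hSc : Continuous S := continuous_sum_lerchTerm hα σ _
  -- The range t < T^{3/4} is discarded at the cost 2T^{-1/4}. Beyond it the error (M+α)^{1-σ}/t is
  -- small, as M^{1-σ} is about T^{1/2} at most when M is near T.
  have hcut1 : 1 ≤ T ^ (3 / 4 : ℝ) := Real.one_le_rpow hT (by norm_num)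
  have happrox : ∀ t ∈ Set.Ioc 0 T, T ^ (3 / 4 : ℝ) ≤ t → ‖L t - D t‖ ≤ ‖S t‖ + E := by
    intro t ht htc
    have h1 := norm_lerchZeta_sub_sum_le hα hα1 hK (s := (σ : ℂ) + (t : ℂ) * Complex.I)
      (by simpa using hσ) (by simpa using hcut1.trans htc) hM1 (by
        refine le_trans ?_ hM
        gcongr
        refine (norm_add_le _ _).trans ?_
        rw [norm_mul, Complex.norm_I, mul_one, Complex.norm_real, Complex.norm_real,
          Real.norm_of_nonneg (by linarith), Real.norm_of_nonneg ht.1.le]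
        linarith [ht.2])
    simp only [Complex.add_re, Complex.ofReal_re, Complex.mul_re, Complex.I_re, mul_zero,
      Complex.ofReal_im, Complex.I_im, sub_self, add_zero, Complex.add_im, Complex.mul_im,
      mul_one, zero_add] at h1
    have h2 : L t - D t = (L t - ∑ n ∈ Finset.range M,
        lerchTerm lam α ((σ : ℂ) + (t : ℂ) * Complex.I) n) + S t := by
      simp only [hD, hS]
      rw [Finset.sum_Ico_eq_sub _ hNM]; ring
    rw [h2, add_comm ‖S t‖]
    refine (norm_add_le _ _).trans (add_le_add (h1.trans ?_) le_rfl)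
    rw [hE]
    gcongr
  have hSint : ∫ t, ‖S t‖ ∂avg T ≤ Real.sqrt ((1 + 4 * M * (1 + Real.log M) / T) * B) := by
    refine (integral_le_sqrt_integral_sq _ (integrable_avg_of_continuous hSc.norm)
      (integrable_avg_of_continuous (hSc.norm.pow 2))).trans (Real.sqrt_le_sqrt ?_)
    have h1 := integral_normSq_dirichlet_le hα hα1 hT0 N M (fun n =>
      Complex.exp (2 * Real.pi * Complex.I * lam) ^ n * (radius σ α n : ℂ))
    simp only [← lerchTerm_vertical hα, norm_mul, norm_pow, norm_exp_two_pi, one_pow, one_mul,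
      Complex.norm_real, Real.norm_of_nonneg (radius_pos hα σ _).le] at h1
    refine h1.trans (mul_le_mul_of_nonneg_left hB ?_)
    have : 0 ≤ Real.log M := Real.log_natCast_nonneg M
    positivity
  rw [← integral_sub (integrable_exp_inner _ hLm v)
    (integrable_exp_inner _ hDc.aestronglyMeasurable v)]
  have hind : Integrable ((Set.Iio (T ^ (3 / 4 : ℝ))).indicator fun _ : ℝ => (2 : ℝ)) (avg T) :=
    (integrable_const _).indicator measurableSet_Iio
  have hSE : Integrable (fun t => ‖v‖ * (‖S t‖ + E)) (avg T) :=
    ((integrable_avg_of_continuous hSc.norm).add (integrable_const _)).const_mul _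
  have hmaj : Integrable (fun t => (Set.Iio (T ^ (3 / 4 : ℝ))).indicator (fun _ : ℝ => (2 : ℝ)) t
      + ‖v‖ * (‖S t‖ + E)) (avg T) :=
    hind.add hSE
  refine (norm_integral_le_of_norm_le hmaj ?_).trans ?_
  · filter_upwards [ae_avg_pos T] with t ht
    rcases lt_or_ge t (T ^ (3 / 4 : ℝ)) with h | h
    · rw [Set.indicator_of_mem (Set.mem_Iio.2 h)]
      have h1 : ‖Complex.exp ((⟪L t, v⟫ : ℝ) * Complex.I) - Complex.exp ((⟪D t, v⟫ : ℝ) * Complex.I)‖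
          ≤ 2 := by
        refine (norm_sub_le _ _).trans ?_
        rw [Complex.norm_exp_ofReal_mul_I, Complex.norm_exp_ofReal_mul_I]
        norm_num
      have h2 : 0 ≤ ‖v‖ * (‖S t‖ + E) := by positivity
      linarith
    · rw [Set.indicator_of_notMem (by simpa using h), zero_add]
      refine (norm_exp_inner_sub_le v _ _).trans ?_
      gcongr
      exact happrox t ht h
  · rw [integral_add hind hSE, integral_const_mul,
      integral_add (integrable_avg_of_continuous hSc.norm) (integrable_const _), integral_const,
      probReal_univ, one_smul, integral_indicator_const _ measurableSet_Iio, smul_eq_mul]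
    have h1 := avg_real_Iio_le hT0 (a := T ^ (3 / 4 : ℝ)) (by positivity)
    have h2 : T ^ (3 / 4 : ℝ) / T = T ^ (-(1 / 4) : ℝ) := by
      rw [← Real.rpow_sub_one hT0.ne']; norm_num
    rw [h2] at h1
    have h3 : ‖v‖ * (∫ t, ‖S t‖ ∂avg T + E)
        ≤ ‖v‖ * (Real.sqrt ((1 + 4 * M * (1 + Real.log M) / T) * B) + E) := by gcongr
    linarith

/-- The vector v and the phases e^{2πiλn} both go into the coefficients, whose moduli are ‖v‖ times
the radii. -/
lemma inner_sum_lerchTerm_eq {lam α : ℝ} (hα : 0 < α) (σ t : ℝ) (N : ℕ) (v : ℂ) :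
    ⟪∑ n ∈ Finset.range N, lerchTerm lam α ((σ : ℂ) + (t : ℂ) * Complex.I) n, v⟫
      = trigSum (fun n : Fin N => (starRingEnd ℂ) v *
          (Complex.exp (2 * Real.pi * Complex.I * lam) ^ (n : ℕ) * (radius σ α n : ℂ)))
        (fun n : Fin N => Real.log (n + α)) t := by
  rw [sum_inner, trigSum, Finset.sum_range]
  refine Finset.sum_congr rfl fun n _ => ?_
  rw [lerchTerm_vertical hα, real_inner_comm, Complex.inner]
  congr 1
  ring

/-- The spacing condition with exponent `Ω` for the numbers `log (n + α)`, `n ≤ X`. -/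
def SpacedAt (α Ω X : ℝ) : Prop :=
  ∀ (N : ℕ) (n : Fin N → ℕ) (ε : Fin N → ℝ),
    (∀ j, (n j : ℝ) ≤ X) → (∀ j, ε j = 1 ∨ ε j = -1) →
    ∑ j, ε j * Real.log (n j + α) ≠ 0 →
    X ^ (-(Ω * (N : ℝ) ^ 2)) ≤ |∑ j, ε j * Real.log (n j + α)|

/-- The characteristic function of the Lerch zeta function on a vertical line, compared with that
of the limit distribution. -/
lemma norm_integral_exp_lerch_sub_charFun_le {lam α K σ T B Ω A V : ℝ} (hα : 0 < α) (hα1 : α ≤ 1)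
    (hind : LinearIndependent ℚ (fun n : ℕ => Real.log (n + α))) (hΩ : 0 < Ω)
    (hK : lamBound lam ≤ K) (hσ : 1 / 2 < σ) (hT : 1 ≤ T) {N M : ℕ} (hN : 1 ≤ N) (hNM : N ≤ M)
    (hspace : SpacedAt α Ω N)
    (hM : 2 * (σ + T) * K ≤ M + α) (hB : ∀ M, ∑ n ∈ Finset.Ico N M, radius σ α n ^ 2 ≤ B)
    (v : ℂ) (k : ℕ) (hA1 : 1 ≤ A) (hA : ‖v‖ * ∑ n ∈ Finset.range N, radius σ α n ≤ A)
    (hV : ‖v‖ ^ 2 * ∑ n ∈ Finset.range N, radius σ α n ^ 2 ≤ V)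
    {φ : ProbabilityMeasure ℂ} (hφ : Tendsto (partialConv σ α) atTop (𝓝 φ)) :
    ‖∫ t, Complex.exp ((⟪lerchZeta lam α ((σ : ℂ) + (t : ℂ) * Complex.I), v⟫ : ℝ) * Complex.I) ∂avg T
      - charFun (φ : Measure ℂ) v‖
      ≤ (2 * T ^ (-(1 / 4) : ℝ) + ‖v‖ * (Real.sqrt ((1 + 4 * M * (1 + Real.log M) / T) * B)
        + (32 * K * ((M : ℝ) + α) ^ (-σ) + 2 * ((M : ℝ) + α) ^ (1 - σ) / T ^ (3 / 4 : ℝ))))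
      + (6 * A ^ (2 * k) / (T * (N : ℝ) ^ (-(Ω * (2 * k : ℝ) ^ 2))) + 2 * Real.exp (4 * V - 2 * k))
      + ‖v‖ ^ 2 / 2 * B := by
  have hT0 : 0 < T := by linarith
  have hN1 : (1 : ℝ) ≤ N := by exact_mod_cast hN
  have h1 := norm_integral_exp_lerch_sub_le hα hα1 hK hσ hT (hN.trans hNM) hNM hM (hB M) v
  have h3 := norm_charFun_limit_sub_prod_le hα hφ hB v
  simp only [inner_sum_lerchTerm_eq hα] at h1
  set c : Fin N → ℂ := fun n : Fin N => (starRingEnd ℂ) v *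
    (Complex.exp (2 * Real.pi * Complex.I * lam) ^ (n : ℕ) * (radius σ α n : ℂ)) with hc
  have hcn : ∀ n, ‖c n‖ = ‖v‖ * radius σ α n := fun n => by
    simp only [hc]
    rw [norm_mul, norm_mul, norm_pow, norm_exp_two_pi, one_pow, one_mul, RCLike.norm_conj,
      Complex.norm_real, Real.norm_of_nonneg (radius_pos hα σ _).le]
  have hω : LinearIndependent ℚ (fun n : Fin N => Real.log ((n : ℕ) + α)) :=
    hind.comp (fun n : Fin N => (n : ℕ)) Fin.val_injective
  -- The gap η is the spacing bound for 2k terms; it also serves all m ≤ 2k because N ≥ 1.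
  have h2 := norm_integral_exp_trigSum_sub_le hω c (T := T)
    (η := (N : ℝ) ^ (-(Ω * (2 * k : ℝ) ^ 2))) (A := A) (V := V) hT0 (by positivity) k
    (fun m hm p hp => by
      have hs := hspace m (fun j => ((p j).1 : ℕ)) (fun j => (sgn (p j).2 : ℝ))
        (fun j => by exact_mod_cast (p j).1.2.le)
        (fun j => by unfold sgn; split_ifs <;> simp) hp
      refine le_trans ?_ hs
      refine Real.rpow_le_rpow_of_exponent_le hN1 ?_
      have : (m : ℝ) ≤ 2 * k := by exact_mod_cast hm
      have h0 : (0 : ℝ) ≤ m := m.cast_nonneg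
      have : (m : ℝ) ^ 2 ≤ (2 * k) ^ 2 := by gcongr
      nlinarith)
    (by
      simp only [hcn]
      rwa [← Finset.mul_sum, ← Finset.sum_range (fun n => radius σ α n)])
    hA1
    (by
      simp only [hcn, mul_pow]
      rwa [← Finset.mul_sum, ← Finset.sum_range (fun n => radius σ α n ^ 2)])
  simp only [hcn] at h2
  rw [← Finset.prod_range (fun n => circleChar (‖v‖ * radius σ α n))] at h2
  rw [norm_sub_rev] at h3
  refine (norm_sub_le_norm_sub_add_norm_sub _ (∏ n ∈ Finset.range N,
    circleChar (‖v‖ * radius σ α n)) _).trans (add_le_add ?_ h3)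
  exact (norm_sub_le_norm_sub_add_norm_sub _ _ _).trans (add_le_add h1 h2)

end LerchMean

/-! ### Choice of parameters in terms of l = log T. -/

namespace LerchMean
open MeasureTheory Filter Topology
open scoped RealInnerProductSpace

/-- The length of the Dirichlet polynomial, as a function of `l = log T`. -/
noncomputable def polyLength (θ l : ℝ) : ℕ := ⌈Real.exp (l ^ (3 * θ / 2))⌉₊ + 1

/-- The conditions on `l = log T` under which the comparison of characteristic functions holds. -/
structure LargeEnough (α θ δ Ω l : ℝ) : Prop where
  three_le : 3 ≤ l
  log_le : Real.log (6 * l) ≤ l ^ (3 * θ / 2)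
  two_le : 2 ≤ l ^ (3 * θ / 2)
  quarter : 48 ≤ l ^ (θ / 4)
  exponent : (8 + 32 * Ω) * l ^ (4 * δ + 4 * θ) ≤ l / 2
  half_le : l ^ (θ / 2) ≤ l / 4
  cube_le : 108 * l ^ 3 ≤ Real.exp (l ^ (θ / 2) / 2)
  spaced : SpacedAt α Ω (polyLength θ l)
  log_alpha : -Real.log α ≤ θ * Real.sqrt (Real.log l)

lemma tendsto_polyLength {θ : ℝ} (hθ : 0 < θ) :
    Tendsto (fun l : ℝ => (polyLength θ l : ℝ)) atTop atTop := by
  have h1 : Tendsto (fun l : ℝ => Real.exp (l ^ (3 * θ / 2))) atTop atTop :=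
    Real.tendsto_exp_atTop.comp (tendsto_rpow_atTop (by positivity))
  refine tendsto_atTop_mono (fun l => ?_) h1
  unfold polyLength
  push_cast
  exact (Nat.le_ceil _).trans (by linarith)

lemma eventually_mul_rpow_le (c : ℝ) {p d : ℝ} (hp : p < 1) (hd : 0 < d) :
    ∀ᶠ l : ℝ in atTop, c * l ^ p ≤ d * l := by
  filter_upwards [eventually_gt_atTop 0, (tendsto_rpow_atTop (y := 1 - p)
    (by linarith)).eventually_ge_atTop (c / d)] with l hl hl1
  have h : l = l ^ (1 - p) * l ^ p := by
    rw [← Real.rpow_add hl]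
    norm_num
  rw [div_le_iff₀ hd] at hl1
  calc c * l ^ p ≤ l ^ (1 - p) * d * l ^ p := by gcongr
    _ = d * (l ^ (1 - p) * l ^ p) := by ring
    _ = d * l := by rw [← h]

/-- Neither λ nor σ enters these conditions, so the resulting T₀ depends on α, θ, δ alone. -/
lemma eventually_largeEnough {α θ δ Ω : ℝ} (hθ : 0 < θ) (hθδ : θ + δ < 1 / 4)
    (hθ1 : θ < 1 / 4)
    (hsp : ∀ᶠ X : ℝ in atTop, SpacedAt α Ω X) :
    ∀ᶠ l : ℝ in atTop, LargeEnough α θ δ Ω l := by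
  have h1 : ∀ᶠ l : ℝ in atTop, Real.log (6 * l) ≤ l ^ (3 * θ / 2) := by
    have ho := (isLittleO_log_rpow_atTop (r := 3 * θ / 2) (by positivity)).bound
      (show (0 : ℝ) < 1 / 2 by norm_num)
    filter_upwards [ho, eventually_gt_atTop 1, (tendsto_rpow_atTop (y := 3 * θ / 2)
      (by positivity)).eventually_ge_atTop (2 * Real.log 6)] with l hl hl1 hl6
    rw [Real.log_mul (by norm_num) (by positivity)]
    rw [Real.norm_of_nonneg (Real.log_nonneg hl1.le), Real.norm_of_nonneg (by positivity)] at hl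
    linarith
  -- The decisive use of θ + δ < 1/4: the exponent is less than 1.
  have h5 : ∀ᶠ l : ℝ in atTop, (8 + 32 * Ω) * l ^ (4 * δ + 4 * θ) ≤ l / 2 := by
    filter_upwards [eventually_mul_rpow_le (8 + 32 * Ω) (p := 4 * δ + 4 * θ) (by linarith)
      (show (0 : ℝ) < 1 / 2 by norm_num)] with l hl
    linarith
  have h6 : ∀ᶠ l : ℝ in atTop, l ^ (θ / 2) ≤ l / 4 := by
    filter_upwards [eventually_mul_rpow_le 1 (p := θ / 2) (by linarith)
      (show (0 : ℝ) < 1 / 4 by norm_num)] with l hl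
    linarith
  have h7 : ∀ᶠ l : ℝ in atTop, 108 * l ^ 3 ≤ Real.exp (l ^ (θ / 2) / 2) := by
    have ho := (isLittleO_log_rpow_atTop (r := θ / 2) (by positivity)).bound
      (show (0 : ℝ) < 1 / 12 by norm_num)
    filter_upwards [ho, eventually_gt_atTop 1, (tendsto_rpow_atTop (y := θ / 2)
      (by positivity)).eventually_ge_atTop (4 * Real.log 108)] with l hl hl1 hl6
    rw [Real.norm_of_nonneg (Real.log_nonneg hl1.le), Real.norm_of_nonneg (by positivity)] at hl
    rw [← Real.log_le_iff_le_exp (by positivity), Real.log_mul (by norm_num) (by positivity),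
      Real.log_pow]
    push_cast
    linarith
  have h9 : ∀ᶠ l : ℝ in atTop, -Real.log α ≤ θ * Real.sqrt (Real.log l) :=
    ((Real.tendsto_sqrt_atTop.comp Real.tendsto_log_atTop).const_mul_atTop hθ).eventually_ge_atTop _
  filter_upwards [eventually_ge_atTop 3, h1,
    (tendsto_rpow_atTop (y := 3 * θ / 2) (by positivity)).eventually_ge_atTop 2,
    (tendsto_rpow_atTop (y := θ / 4) (by positivity)).eventually_ge_atTop 48, h5, h6, h7,
    (tendsto_polyLength hθ).eventually hsp, h9] with l a1 a2 a3 a4 a5 a6 a7 a8 a9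
  exact ⟨a1, a2, a3, a4, a5, a6, a7, a8, a9⟩

lemma radius_le {α σ : ℝ} (hα : 0 < α) (hσ : 0 ≤ σ) (n : ℕ) : radius σ α n ≤ α ^ (-σ) :=
  Real.rpow_le_rpow_of_nonpos hα (by linarith [n.cast_nonneg (α := ℝ)]) (by linarith)

/-- The mean square factor and the approximation error, in terms of `l = log T`. -/
lemma truncation_error_le {l α σ y : ℝ} (hl : 3 ≤ l) (hα : 0 < α) (hα1 : α ≤ 1) (hσ : 1 / 2 ≤ σ)
    (hy : y ≤ l / 4) {M : ℕ} (hM : M = ⌈4 * Real.exp l * l⌉₊) {b : ℝ} (hb : 0 ≤ b) (hbl : b ≤ l) :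
    Real.sqrt ((1 + 4 * M * (1 + Real.log M) / Real.exp l) * (Real.exp (-2 * y) * b))
        + (32 * l * ((M : ℝ) + α) ^ (-σ)
          + 2 * ((M : ℝ) + α) ^ (1 - σ) / (Real.exp l) ^ (3 / 4 : ℝ))
      ≤ 48 * l ^ 2 * Real.exp (-y) := by
  set T := Real.exp l with hT
  have hT0 : 0 < T := Real.exp_pos l
  have hTl : l + 1 ≤ T := Real.add_one_le_exp l
  have hM1 : 4 * T * l ≤ M := by rw [hM]; exact Nat.le_ceil _
  have hM2 : (M : ℝ) ≤ 5 * T * l := by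
    have : (M : ℝ) < 4 * T * l + 1 := by rw [hM]; exact Nat.ceil_lt_add_one (by positivity)
    nlinarith
  have hM0 : 0 < (M : ℝ) := lt_of_lt_of_le (by positivity) hM1
  have hlogl : Real.log l ≤ l - 1 := Real.log_le_sub_one_of_pos (by linarith)
  have hlogM : Real.log M ≤ 3 * l := by
    have h1 : Real.log M ≤ Real.log (5 * T * l) := Real.log_le_log hM0 hM2
    rw [Real.log_mul (by positivity) (by positivity), Real.log_mul (by norm_num) hT0.ne',
      hT, Real.log_exp] at h1
    have h5 : Real.log 5 ≤ 4 := (Real.log_le_sub_one_of_pos (by norm_num)).trans (by norm_num)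
    linarith
  have hfac : 1 + 4 * M * (1 + Real.log M) / T ≤ 100 * l ^ 2 := by
    have h1 : 4 * M * (1 + Real.log M) / T ≤ 4 * (5 * T * l) * (1 + 3 * l) / T := by
      have : 0 ≤ Real.log M := Real.log_natCast_nonneg M
      gcongr
    have h2 : 4 * (5 * T * l) * (1 + 3 * l) / T = 20 * l * (1 + 3 * l) := by field_simp; norm_num
    rw [h2] at h1
    nlinarith
  have h1 : Real.sqrt ((1 + 4 * M * (1 + Real.log M) / T) * (Real.exp (-2 * y) * b))
      ≤ 10 * l ^ 2 * Real.exp (-y) := by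
    refine (Real.sqrt_le_left (by positivity)).2 ?_
    have he : Real.exp (-2 * y) = Real.exp (-y) ^ 2 := by
      rw [← Real.exp_nat_mul]; congr 1; push_cast; ring
    calc _ ≤ 100 * l ^ 2 * (Real.exp (-2 * y) * l) := by gcongr
      _ ≤ 100 * l ^ 2 * (Real.exp (-2 * y) * l ^ 2) := by
          gcongr
          nlinarith
      _ = _ := by rw [he]; ring
  have hexp4 : Real.exp (-(l / 4)) ≤ Real.exp (-y) := Real.exp_le_exp.2 (by linarith)
  have hx1 : T ≤ (M : ℝ) + α := by nlinarith
  have hx0 : 1 ≤ (M : ℝ) + α := by linarith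
  have h2 : ((M : ℝ) + α) ^ (-σ) ≤ Real.exp (-y) := by
    calc ((M : ℝ) + α) ^ (-σ) ≤ ((M : ℝ) + α) ^ (-(1 / 2) : ℝ) :=
          Real.rpow_le_rpow_of_exponent_le hx0 (by linarith)
      _ ≤ T ^ (-(1 / 2) : ℝ) := Real.rpow_le_rpow_of_nonpos hT0 hx1 (by norm_num)
      _ = Real.exp (-(l / 2)) := by rw [hT, ← Real.exp_mul]; congr 1; ring
      _ ≤ Real.exp (-(l / 4)) := Real.exp_le_exp.2 (by linarith)
      _ ≤ _ := hexp4
  have h3 : ((M : ℝ) + α) ^ (1 - σ) / T ^ (3 / 4 : ℝ) ≤ 5 / 2 * l * Real.exp (-y) := by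
    have h4 : ((M : ℝ) + α) ^ (1 - σ) ≤ l * T ^ (1 / 2 : ℝ) * (5 / 2) := by
      calc ((M : ℝ) + α) ^ (1 - σ) ≤ ((M : ℝ) + α) ^ (1 / 2 : ℝ) :=
            Real.rpow_le_rpow_of_exponent_le hx0 (by linarith)
        _ ≤ (T * (6 * l)) ^ (1 / 2 : ℝ) :=
            Real.rpow_le_rpow (by linarith) (by nlinarith) (by norm_num)
        _ = T ^ (1 / 2 : ℝ) * (6 * l) ^ (1 / 2 : ℝ) := Real.mul_rpow hT0.le (by positivity)
        _ ≤ T ^ (1 / 2 : ℝ) * (l * (5 / 2)) := by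
            gcongr
            rw [← Real.sqrt_eq_rpow]
            refine (Real.sqrt_le_left (by positivity)).2 ?_
            nlinarith
        _ = _ := by ring
    have h5 : T ^ (1 / 2 : ℝ) / T ^ (3 / 4 : ℝ) = Real.exp (-(l / 4)) := by
      rw [← Real.rpow_sub hT0, hT, ← Real.exp_mul]
      congr 1
      ring
    calc ((M : ℝ) + α) ^ (1 - σ) / T ^ (3 / 4 : ℝ)
        ≤ (l * T ^ (1 / 2 : ℝ) * (5 / 2)) / T ^ (3 / 4 : ℝ) := by gcongr
      _ = 5 / 2 * l * (T ^ (1 / 2 : ℝ) / T ^ (3 / 4 : ℝ)) := by ring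
      _ ≤ _ := by rw [h5]; gcongr
  have h6 : 32 * l * ((M : ℝ) + α) ^ (-σ) ≤ 32 * l * Real.exp (-y) := by gcongr
  have h7 : 37 * l * Real.exp (-y) ≤ 38 * l ^ 2 * Real.exp (-y) := by
    refine mul_le_mul_of_nonneg_right ?_ (Real.exp_pos _).le
    nlinarith
  rw [mul_div_assoc 2]
  linarith

lemma polyLength_le {θ l : ℝ} (h : 0 ≤ l) :
    (polyLength θ l : ℝ) ≤ 3 * Real.exp (l ^ (3 * θ / 2)) := by
  have h1 : (⌈Real.exp (l ^ (3 * θ / 2))⌉₊ : ℝ) < Real.exp (l ^ (3 * θ / 2)) + 1 :=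
    Nat.ceil_lt_add_one (Real.exp_pos _).le
  have h2 : 1 ≤ Real.exp (l ^ (3 * θ / 2)) := Real.one_le_exp (by positivity)
  unfold polyLength
  push_cast
  linarith

/-- For `σ` small compared with `√(log l)`, the first terms of the series are under control. -/
lemma rpow_neg_two_mul_le {α θ l σ : ℝ} (hα : 0 < α) (hα1 : α ≤ 1) (hl : 1 ≤ l) (hσ0 : 0 ≤ σ)
    (hσ : 2 * σ ≤ Real.sqrt (Real.log l)) (hlog : -Real.log α ≤ θ * Real.sqrt (Real.log l)) :
    α ^ (-(2 * σ)) ≤ l ^ θ := by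
  rw [Real.rpow_def_of_pos hα, Real.rpow_def_of_pos (by linarith), Real.exp_le_exp]
  have h0 : 0 ≤ -Real.log α := by linarith [Real.log_nonpos hα.le hα1]
  have hs := Real.mul_self_sqrt (Real.log_nonneg hl)
  calc Real.log α * -(2 * σ) = (-Real.log α) * (2 * σ) := by ring
    _ ≤ (θ * Real.sqrt (Real.log l)) * Real.sqrt (Real.log l) :=
        mul_le_mul hlog hσ (by positivity) (h0.trans hlog)
    _ = Real.log l * θ := by linear_combination θ * hs

/-- The error term which comes from the moments of the Dirichlet polynomial. -/
lemma moment_error_le {l g b Ω N : ℝ} (hΩ : 0 < Ω) (hg : 0 ≤ g) (hb : 1 ≤ b) (hN : 1 ≤ N)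
    (hNg : N ≤ Real.exp (2 * g)) {k : ℕ} (hk : (k : ℝ) ≤ 2 * b)
    (h : (8 + 32 * Ω) * (b ^ 2 * g) ≤ l / 2) :
    6 * Real.exp (2 * g) ^ (2 * k) / (Real.exp l * N ^ (-(Ω * (2 * k : ℝ) ^ 2)))
      ≤ 6 * Real.exp (-(l / 2)) := by
  have hk0 : (0 : ℝ) ≤ k := k.cast_nonneg
  have h1 : Real.exp (-(8 * Ω * (k : ℝ) ^ 2 * g)) ≤ N ^ (-(Ω * (2 * k : ℝ) ^ 2)) := by
    calc Real.exp (-(8 * Ω * (k : ℝ) ^ 2 * g))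
        = Real.exp (2 * g) ^ (-(Ω * (2 * k : ℝ) ^ 2)) := by
          rw [← Real.exp_mul]; congr 1; ring
      _ ≤ _ := Real.rpow_le_rpow_of_nonpos (by linarith) hNg
          (by have : 0 ≤ Ω * (2 * k : ℝ) ^ 2 := by positivity
              linarith)
  have h2 : Real.exp (2 * g) ^ (2 * k) = Real.exp (4 * k * g) := by
    rw [← Real.exp_nat_mul]; congr 1; push_cast; ring
  calc _ ≤ 6 * Real.exp (4 * k * g) / (Real.exp l * Real.exp (-(8 * Ω * (k : ℝ) ^ 2 * g))) := by
        rw [h2]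
        gcongr
    _ = 6 * Real.exp (4 * k * g - (l + -(8 * Ω * (k : ℝ) ^ 2 * g))) := by
        rw [Real.exp_sub, Real.exp_add, mul_div_assoc]
    _ ≤ _ := by
        gcongr
        have h3 : (k : ℝ) ^ 2 ≤ 4 * b ^ 2 := by nlinarith
        have h4 : (k : ℝ) ≤ 2 * b ^ 2 := by nlinarith
        have h5 : (k : ℝ) ^ 2 * g * Ω ≤ 4 * b ^ 2 * g * Ω := by gcongr
        have h6 : (k : ℝ) * g ≤ 2 * b ^ 2 * g := by gcongr
        nlinarith

set_option maxHeartbeats 1000000 in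
/-- The characteristic function of the value distribution of the Lerch zeta-function is close to
that of the limit. -/
theorem norm_integral_exp_lerch_sub_charFun_le_exp {lam α θ δ Ω l σ : ℝ} (hα : 0 < α)
    (hα1 : α ≤ 1) (hind : LinearIndependent ℚ fun n : ℕ => Real.log (n + α)) (hΩ : 0 < Ω)
    (hθ : 0 < θ) (hδ : 0 < δ) (hθδ : θ + δ < 1 / 4) (hl : LargeEnough α θ δ Ω l)
    (hlam : lamBound lam ≤ l) (hσ : 1 / 2 + l ^ (-θ) ≤ σ)
    (hσl : 2 * σ ≤ Real.sqrt (Real.log l)) {v : ℂ} (hv : ‖v‖ ≤ 2 * l ^ δ)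
    {φ : ProbabilityMeasure ℂ} (hφ : Tendsto (partialConv σ α) atTop (𝓝 φ)) :
    ‖∫ t, Complex.exp ((⟪lerchZeta lam α (σ + t * Complex.I), v⟫ : ℝ) * Complex.I)
        ∂avg (Real.exp l) - charFun (φ : Measure ℂ) v‖ ≤ Real.exp (-(1 / 2) * l ^ (θ / 2)) := by
  have hl3 := hl.three_le
  have hl0 : 0 < l := by linarith
  have hl1 : 1 ≤ l := by linarith
  have hone : ∀ {p : ℝ}, 0 ≤ p → 1 ≤ l ^ p := fun hp => Real.one_le_rpow hl1 hp
  have hle : ∀ {p : ℝ}, p ≤ 1 → l ^ p ≤ l := fun {p} hp => by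
    simpa using Real.rpow_le_rpow_of_exponent_le hl1 hp
  set T := Real.exp l with hT
  have hTl : l + 1 ≤ T := Real.add_one_le_exp l
  have hε : 0 < l ^ (-θ) := by positivity
  have hσ2 : 1 / 2 < σ := by linarith
  -- Here log N ≈ g; the tail is governed by g·l^{-θ} = y; and k = ⌈b⌉ exceeds the variance
  -- O(l^{2δ+θ}) by the factor l^{θ/4}. The product b²g = l^{4δ+4θ} measures the moment error.
  set g := l ^ (3 * θ / 2) with hg
  set y := l ^ (θ / 2) with hy
  set b := l ^ (2 * δ + 5 * θ / 4) with hb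
  have hg0 : 0 ≤ g := by positivity
  have hy4 : y ≤ l / 4 := hl.half_le
  set N := polyLength θ l with hN
  have hN3 : (N : ℝ) ≤ 3 * Real.exp g := polyLength_le hl0.le
  have hNg : (N : ℝ) ≤ Real.exp (2 * g) := by
    have h2 : 3 ≤ Real.exp g := by linarith [Real.add_one_le_exp g, hl.two_le]
    calc (N : ℝ) ≤ 3 * Real.exp g := hN3
      _ ≤ Real.exp g * Real.exp g := by gcongr
      _ = _ := by rw [← Real.exp_add]; congr 1; ring
  -- The extra 1 in `polyLength` offsets the N - 1 in the tail bound.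
  have hNexp : Real.exp g ≤ (N : ℝ) - 1 := by
    rw [hN, polyLength]
    push_cast
    linarith [Nat.le_ceil (Real.exp (l ^ (3 * θ / 2)))]
  have hN2 : 2 ≤ N := by
    have h1 : (1 : ℝ) ≤ Real.exp g := Real.one_le_exp hg0
    have h2 : (2 : ℝ) ≤ N := by linarith
    exact_mod_cast h2
  -- This length allows K = l for the bound on `lamBound lam`, since 2(σ+T)l ≤ 4Tl.
  obtain ⟨M, hM⟩ : ∃ M : ℕ, M = ⌈4 * T * l⌉₊ := ⟨_, rfl⟩
  have hM1 : 4 * T * l ≤ M := by rw [hM]; exact Nat.le_ceil _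
  have hNM : N ≤ M := by
    have h1 : Real.exp g ≤ T := Real.exp_le_exp.2 (hle (by linarith))
    have h2 : (N : ℝ) ≤ M := by nlinarith
    exact_mod_cast h2
  have hαθ : α ^ (-(2 * σ)) ≤ l ^ θ :=
    rpow_neg_two_mul_le hα hα1 hl1 (by linarith) hσl hl.log_alpha
  have hαθ' : α ^ (-σ) ≤ l ^ θ :=
    (Real.rpow_le_rpow_of_exponent_ge hα hα1 (by linarith)).trans hαθ
  have hinv : (l ^ (-θ))⁻¹ = l ^ θ := by rw [Real.rpow_neg hl0.le, inv_inv]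
  have hB : ∀ M, ∑ n ∈ Finset.Ico N M, radius σ α n ^ 2 ≤ Real.exp (-2 * y) * l ^ θ := by
    intro M
    refine (sum_radius_sq_tail_le hα hε hσ hN2 M).trans ?_
    have h1 : ((N : ℝ) - 1) ^ (-(2 * l ^ (-θ))) ≤ Real.exp (-2 * y) := by
      calc ((N : ℝ) - 1) ^ (-(2 * l ^ (-θ))) ≤ Real.exp g ^ (-(2 * l ^ (-θ))) :=
            Real.rpow_le_rpow_of_nonpos (Real.exp_pos _) hNexp (by linarith)
        _ = Real.exp (-2 * y) := by
            rw [← Real.exp_mul]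
            congr 1
            have : g * l ^ (-θ) = y := by
              rw [hg, hy, ← Real.rpow_add hl0]
              congr 1
              ring
            linear_combination (-2) * this
    have h2 : 1 / (2 * l ^ (-θ)) ≤ l ^ θ := by
      rw [one_div, mul_inv, hinv]
      have : 0 ≤ l ^ θ := by positivity
      linarith
    rw [div_eq_mul_one_div]
    gcongr
  have hA : ‖v‖ * ∑ n ∈ Finset.range N, radius σ α n ≤ Real.exp (2 * g) := by
    have h1 : ∑ n ∈ Finset.range N, radius σ α n ≤ N * l ^ θ := by
      calc _ ≤ ∑ n ∈ Finset.range N, l ^ θ :=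
            Finset.sum_le_sum fun n _ => (radius_le hα (by linarith) n).trans hαθ'
        _ = _ := by simp
    have h2 : 6 * l ≤ Real.exp g := by
      rw [← Real.log_le_iff_le_exp (by positivity)]
      exact hl.log_le
    have h3 : l ^ δ * l ^ θ ≤ l := by
      rw [← Real.rpow_add hl0]
      exact hle (by linarith)
    calc _ ≤ (2 * l ^ δ) * (3 * Real.exp g * l ^ θ) := by
          have : 0 ≤ ∑ n ∈ Finset.range N, radius σ α n :=
            Finset.sum_nonneg fun n _ => (radius_pos hα σ n).le
          gcongr
          exact h1.trans (by gcongr)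
      _ = 6 * (l ^ δ * l ^ θ) * Real.exp g := by ring
      _ ≤ 6 * l * Real.exp g := by gcongr
      _ ≤ Real.exp g * Real.exp g := by gcongr
      _ = _ := by rw [← Real.exp_add]; congr 1; ring
  have hvsq : ‖v‖ ^ 2 ≤ 4 * l ^ (2 * δ) := by
    have h1 : l ^ (2 * δ) = l ^ δ * l ^ δ := by rw [← Real.rpow_add hl0]; congr 1; ring
    rw [h1]
    nlinarith [norm_nonneg v]
  have hV : ‖v‖ ^ 2 * ∑ n ∈ Finset.range N, radius σ α n ^ 2 ≤ 12 * l ^ (2 * δ + θ) := by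
    have h1 : ∑ n ∈ Finset.range N, radius σ α n ^ 2 ≤ 3 * l ^ θ := by
      refine (sum_radius_sq_le hα hε hσ hN2).trans ?_
      have h2 : 1 / (2 * l ^ (-θ)) = l ^ θ / 2 := by
        rw [one_div, mul_inv, hinv]; ring
      rw [h2]
      linarith [hone hθ.le]
    calc _ ≤ (4 * l ^ (2 * δ)) * (3 * l ^ θ) := by
          have : 0 ≤ ∑ n ∈ Finset.range N, radius σ α n ^ 2 :=
            Finset.sum_nonneg fun n _ => sq_nonneg _
          gcongr
      _ = _ := by rw [Real.rpow_add hl0]; ring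
  have hb1 : 1 ≤ b := hone (by positivity)
  have hk1 : b ≤ (⌈b⌉₊ : ℝ) := Nat.le_ceil b
  have hk2 : (⌈b⌉₊ : ℝ) ≤ 2 * b := by
    linarith [Nat.ceil_lt_add_one (show 0 ≤ b by linarith)]
  -- The spare factor l^{θ/4} ≥ 48 makes 4V ≤ b, so that 4V - 2k ≤ -b ≤ -y.
  have hVb : 4 * (12 * l ^ (2 * δ + θ)) ≤ b := by
    have h1 : b = l ^ (2 * δ + θ) * l ^ (θ / 4) := by
      rw [hb, ← Real.rpow_add hl0]; congr 1; ring
    have h2 : l ^ (2 * δ + θ) * 48 ≤ l ^ (2 * δ + θ) * l ^ (θ / 4) := by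
      gcongr
      exact hl.quarter
    linarith
  have hσT : 2 * (σ + T) * l ≤ (M : ℝ) + α := by
    have h1 : Real.sqrt (Real.log l) ≤ l := by
      refine (Real.sqrt_le_left hl0.le).2 ?_
      nlinarith [Real.log_le_sub_one_of_pos hl0]
    nlinarith
  have hmain := norm_integral_exp_lerch_sub_charFun_le (lam := lam) (T := T) hα hα1 hind hΩ hlam
    hσ2 (by linarith) (by omega) hNM hl.spaced hσT hB v ⌈b⌉₊
    (Real.one_le_exp (by positivity)) hA hV hφ
  refine hmain.trans ?_
  have e1 : T ^ (-(1 / 4) : ℝ) ≤ Real.exp (-y) := by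
    rw [hT, ← Real.exp_mul]
    exact Real.exp_le_exp.2 (by linarith)
  have e2 := truncation_error_le hl3 hα hα1 hσ2.le hy4 hM (b := l ^ θ) (by positivity)
    (hle (by linarith))
  have e3 : 6 * Real.exp (2 * g) ^ (2 * ⌈b⌉₊)
      / (T * (N : ℝ) ^ (-(Ω * (2 * (⌈b⌉₊ : ℝ)) ^ 2))) ≤ 6 * Real.exp (-y) := by
    refine (moment_error_le hΩ hg0 hb1 (by exact_mod_cast (by omega : 1 ≤ N)) hNg hk2 ?_).trans ?_
    · have h1 : b ^ 2 * g = l ^ (4 * δ + 4 * θ) := by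
        rw [hb, hg, sq, ← Real.rpow_add hl0, ← Real.rpow_add hl0]; congr 1; ring
      rw [h1]
      exact hl.exponent
    · gcongr
      linarith
  have e4 : Real.exp (4 * (12 * l ^ (2 * δ + θ)) - 2 * (⌈b⌉₊ : ℝ)) ≤ Real.exp (-y) := by
    have h1 : y ≤ b := Real.rpow_le_rpow_of_exponent_le hl1 (by linarith)
    exact Real.exp_le_exp.2 (by linarith)
  have hl23 : l ^ 2 ≤ l ^ 3 := pow_le_pow_right₀ hl1 (by norm_num)
  have hl13 : 1 ≤ l ^ 3 := one_le_pow₀ hl1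
  have e5 : ‖v‖ ^ 2 / 2 * (Real.exp (-2 * y) * l ^ θ) ≤ 2 * l ^ 3 * Real.exp (-y) := by
    have h1 : l ^ (2 * δ) * l ^ θ ≤ l := by
      rw [← Real.rpow_add hl0]
      exact hle (by linarith)
    have h2 : Real.exp (-2 * y) ≤ Real.exp (-y) := by
      have : 0 ≤ y := by positivity
      exact Real.exp_le_exp.2 (by linarith)
    calc _ ≤ 4 * l ^ (2 * δ) / 2 * (Real.exp (-y) * l ^ θ) := by gcongr
      _ = 2 * (l ^ (2 * δ) * l ^ θ) * Real.exp (-y) := by ring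
      _ ≤ 2 * l * Real.exp (-y) := by gcongr
      _ ≤ _ := by
          gcongr
          nlinarith
  have e6 : ‖v‖ * (48 * l ^ 2 * Real.exp (-y)) ≤ 96 * l ^ 3 * Real.exp (-y) := by
    calc _ ≤ 2 * l * (48 * l ^ 2 * Real.exp (-y)) := by
          gcongr
          exact hv.trans (by gcongr; exact hle (by linarith))
      _ = _ := by ring
  have e7 : Real.exp (-y) ≤ l ^ 3 * Real.exp (-y) := le_mul_of_one_le_left (Real.exp_pos _).le hl13
  have e8 := mul_le_mul_of_nonneg_left e2 (norm_nonneg v)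
  -- 108 = 2 + 96 + 6 + 2 + 2, from the small t, the truncation, the moments, the Taylor remainder
  -- and the truncated product. The polynomial factor costs half of the exponent.
  have e9 : 108 * l ^ 3 * Real.exp (-y) ≤ Real.exp (-(1 / 2) * y) := by
    calc _ ≤ Real.exp (y / 2) * Real.exp (-y) := by
          gcongr
          exact hl.cube_le
      _ = _ := by rw [← Real.exp_add]; congr 1; ring
  linarith

end LerchMean

/-! ### From characteristic functions to test functions. -/

namespace LerchMean
open MeasureTheory Filter Topology
open scoped RealInnerProductSpace

/-- The kernel of Fourier inversion is the integrand of a characteristic function at -w. -/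
lemma psi_neg_eq (z w : ℂ) : psi (-z) w = Complex.exp ((⟪z, -w⟫ : ℝ) * Complex.I) := by
  rw [psi, mul_comm]
  congr 3
  rw [Complex.inner]
  simp [mul_comm]

instance : SFinite dz := by
  unfold dz
  infer_instance

/-- Averaging a Fourier integral over the values of a random variable. -/
lemma integral_fourier_inversion {X : Type*} [MeasurableSpace X] (μ : Measure X)
    [IsFiniteMeasure μ] {f : X → ℂ} (hf : AEStronglyMeasurable f μ) {g : ℂ → ℂ}
    (hg : Integrable g dz) :
    ∫ x, ∫ w, g w * psi (-f x) w ∂dz ∂μ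
      = ∫ w, g w * ∫ x, Complex.exp ((⟪f x, -w⟫ : ℝ) * Complex.I) ∂μ ∂dz := by
  simp only [psi_neg_eq]
  rw [integral_integral_swap]
  · simp only [integral_const_mul]
  · have hc : Continuous fun p : ℂ × ℂ => Complex.exp ((⟪p.1, -p.2⟫ : ℝ) * Complex.I) := by
      fun_prop
    refine Integrable.mul_bdd (c := 1) (hg.comp_snd μ) ?_ (ae_of_all _ fun p => ?_)
    · exact hc.comp_aestronglyMeasurable (f := fun p : X × ℂ => (f p.1, p.2))
        (hf.comp_fst.prodMk aestronglyMeasurable_id.comp_snd)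
    · rw [Complex.norm_exp_ofReal_mul_I]

lemma continuous_integral_exp_inner {X : Type*} [MeasurableSpace X] (μ : Measure X)
    [IsFiniteMeasure μ] {f : X → ℂ} (hf : AEStronglyMeasurable f μ) :
    Continuous fun w : ℂ => ∫ x, Complex.exp ((⟪f x, -w⟫ : ℝ) * Complex.I) ∂μ := by
  refine continuous_of_dominated (bound := fun _ => 1)
    (fun w => (integrable_exp_inner μ hf (-w)).aestronglyMeasurable)
    (fun w => ae_of_all _ fun x => ?_) (integrable_const _) (ae_of_all _ fun x => by fun_prop)
  rw [Complex.norm_exp_ofReal_mul_I]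

lemma norm_integral_exp_inner_le_one {X : Type*} [MeasurableSpace X] (μ : Measure X)
    [IsProbabilityMeasure μ] (f : X → ℂ) (v : ℂ) :
    ‖∫ x, Complex.exp ((⟪f x, v⟫ : ℝ) * Complex.I) ∂μ‖ ≤ 1 := by
  refine (norm_integral_le_of_norm_le_const (C := 1) (ae_of_all _ fun x => ?_)).trans (by simp)
  rw [Complex.norm_exp_ofReal_mul_I]

lemma integral_mul_density_eq {M : ℂ → ℝ} (hM : Continuous M) (hM0 : ∀ z, 0 ≤ M z) {φ : Measure ℂ}
    (hφ : φ = dz.withDensity fun z => ENNReal.ofReal (M z)) (Φ : ℂ → ℂ) :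
    ∫ z, Φ z * (M z : ℂ) ∂dz = ∫ z, Φ z ∂φ := by
  rw [hφ, integral_withDensity_eq_integral_toReal_smul hM.measurable.ennreal_ofReal
    (ae_of_all _ fun z => ENNReal.ofReal_lt_top)]
  refine integral_congr_ae (ae_of_all _ fun z => ?_)
  simp only [ENNReal.toReal_ofReal (hM0 z), Complex.real_smul, mul_comm]

lemma measurableSet_squareΩ (δ T : ℝ) : MeasurableSet (squareΩ δ T) := by
  have h : IsClosed (squareΩ δ T) :=
    (isClosed_le (continuous_abs.comp Complex.continuous_re) continuous_const).inter
      (isClosed_le (continuous_abs.comp Complex.continuous_im) continuous_const)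
  exact h.measurableSet

/-- A weighted integral, bounded separately on a set and on its complement. -/
lemma norm_integral_mul_le_split {g D : ℂ → ℂ} (hg : Integrable g dz) (hD : Continuous D)
    {s : Set ℂ} (hs : MeasurableSet s) {a c : ℝ} (h1 : ∀ w ∈ s, ‖D w‖ ≤ a)
    (h2 : ∀ w, ‖D w‖ ≤ c) :
    ‖∫ w, g w * D w ∂dz‖ ≤ a * ∫ w in s, ‖g w‖ ∂dz + c * ∫ w in sᶜ, ‖g w‖ ∂dz := by
  have hInt : Integrable (fun w => g w * D w) dz :=
    hg.mul_bdd (c := c) hD.aestronglyMeasurable (ae_of_all _ h2)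
  refine (norm_integral_le_integral_norm _).trans ?_
  rw [← integral_add_compl hs hInt.norm, ← integral_const_mul, ← integral_const_mul]
  refine add_le_add ?_ ?_
  · refine setIntegral_mono_on hInt.norm.integrableOn (hg.norm.const_mul a).integrableOn hs
      fun w hw => ?_
    rw [norm_mul, mul_comm]
    exact mul_le_mul_of_nonneg_right (h1 w hw) (norm_nonneg _)
  · refine setIntegral_mono_on hInt.norm.integrableOn (hg.norm.const_mul c).integrableOn hs.compl
      fun w _ => ?_
    rw [norm_mul, mul_comm]
    exact mul_le_mul_of_nonneg_right (h2 w) (norm_nonneg _)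

/-- Bounds for the difference of the characteristic functions yield bounds for the difference of
the mean values of a test function. -/
lemma norm_mean_sub_integral_density_le {lam α σ T : ℝ} (hα : 0 < α) (hσ : 1 / 2 < σ) (hT : 0 < T)
    {Φ : ℂ → ℂ} (hΦ : ClassLambda Φ) {s : Set ℂ} (hs : MeasurableSet s) {a c : ℝ}
    (h1 : ∀ φ : ProbabilityMeasure ℂ, Tendsto (partialConv σ α) atTop (𝓝 φ) → ∀ w ∈ s,
      ‖∫ t, Complex.exp ((⟪lerchZeta lam α (σ + t * Complex.I), -w⟫ : ℝ) * Complex.I) ∂avg T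
        - charFun (φ : Measure ℂ) (-w)‖ ≤ a) (hc : 2 ≤ c) :
    ‖(1 / (T : ℂ)) * (∫ t in (0 : ℝ)..T, Φ (lerchZeta lam α ((σ : ℂ) + (t : ℂ) * Complex.I)))
        - ∫ z, Φ z * (densityM σ α z : ℂ) ∂dz‖
      ≤ a * ∫ w in s, ‖fourierT Φ w‖ ∂dz + c * ∫ w in sᶜ, ‖fourierT Φ w‖ ∂dz := by
  have := isProbabilityMeasure_avg hT
  have hM := isLimitDensity_densityM hα hσ
  obtain ⟨φ, hφ, hφd⟩ := hM.isLimit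
  have hg : Integrable (fourierT Φ) dz := memLp_one_iff_integrable.1 hΦ.fourier_memL1
  set f : ℝ → ℂ := fun t => lerchZeta lam α ((σ : ℂ) + (t : ℂ) * Complex.I) with hf
  have hfm : AEStronglyMeasurable f (avg T) := aestronglyMeasurable_lerchZeta hα (by linarith) T
  have hidm : AEStronglyMeasurable (fun z : ℂ => z) (φ : Measure ℂ) := aestronglyMeasurable_id
  have e1 : (1 / (T : ℂ)) * (∫ t in (0 : ℝ)..T, Φ (f t))
      = ∫ w, fourierT Φ w * ∫ t, Complex.exp ((⟪f t, -w⟫ : ℝ) * Complex.I) ∂avg T ∂dz := by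
    rw [← integral_fourier_inversion (avg T) hfm hg]
    -- Inversion holds at every point, so it may be applied along the curve t ↦ L(σ+it), which is a
    -- null set of the plane.
    simp only [← hΦ.inversion]
    rw [integral_avg hT, Complex.real_smul]
    push_cast
    rw [one_div]
  have e2 : ∫ z, Φ z * (densityM σ α z : ℂ) ∂dz
      = ∫ w, fourierT Φ w * ∫ z, Complex.exp ((⟪z, -w⟫ : ℝ) * Complex.I) ∂(φ : Measure ℂ) ∂dz := by
    rw [integral_mul_density_eq hM.continuous hM.nonneg hφd Φ,
      ← integral_fourier_inversion (φ : Measure ℂ) hidm hg]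
    simp only [← hΦ.inversion]
  have c1 := continuous_integral_exp_inner (avg T) hfm
  have c2 := continuous_integral_exp_inner (φ : Measure ℂ) hidm
  have b1 := norm_integral_exp_inner_le_one (avg T) f
  have b2 := norm_integral_exp_inner_le_one (φ : Measure ℂ) fun z => z
  rw [e1, e2, ← integral_sub]
  · simp only [← mul_sub]
    refine norm_integral_mul_le_split hg (c1.sub c2) hs (fun w hw => ?_) fun w => ?_
    · simpa only [charFun_apply, Pi.sub_apply] using h1 φ hφ w hw
    · exact (norm_sub_le _ _).trans (by linarith [b1 (-w), b2 (-w)])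
  · exact hg.mul_bdd (c := 1) c1.aestronglyMeasurable (ae_of_all _ fun w => b1 (-w))
  · exact hg.mul_bdd (c := 1) c2.aestronglyMeasurable (ae_of_all _ fun w => b2 (-w))

lemma norm_neg_le_of_mem_squareΩ {δ T : ℝ} {w : ℂ} (hw : w ∈ squareΩ δ T) :
    ‖-w‖ ≤ 2 * Real.log T ^ δ := by
  rw [norm_neg]
  linarith [Complex.norm_le_abs_re_add_abs_im w, hw.1, hw.2]

/-- The threshold for `log T`, beyond which the sharp bound for characteristic functions holds. -/
noncomputable def logThreshold (lam σ₁ : ℝ) : ℝ := max (lamBound lam) (Real.exp (4 * σ₁ ^ 2))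

/-- The constant in the main inequality. -/
noncomputable def meanConst (lam σ₁ : ℝ) : ℝ := 2 * Real.exp (logThreshold lam σ₁ / 2)

lemma two_le_meanConst (lam σ₁ : ℝ) : 2 ≤ meanConst lam σ₁ := by
  have h1 : 1 ≤ logThreshold lam σ₁ := (one_le_lamBound lam).trans (le_max_left _ _)
  have h2 : 1 ≤ Real.exp (logThreshold lam σ₁ / 2) := Real.one_le_exp (by linarith)
  unfold meanConst
  linarith

/-- The condition on `T` under which the main inequality holds. -/
def IsThreshold (α θ δ T₀ : ℝ) : Prop :=
  0 < T₀ ∧ ∃ Ω : ℝ, 0 < Ω ∧ ∀ T, T₀ ≤ T → LargeEnough α θ δ Ω (Real.log T)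

lemma exists_isThreshold {α θ δ : ℝ} (hα : α ∈ admissibleSet) (hθ : 0 < θ) (hδ : 0 < δ)
    (hθδ : θ + δ < 1 / 4) : ∃ T₀, IsThreshold α θ δ T₀ := by
  obtain ⟨-, -, Ω, hΩ, hsp⟩ := hα
  have h := Real.tendsto_log_atTop.eventually
    (eventually_largeEnough (δ := δ) hθ hθδ (by linarith) hsp)
  obtain ⟨T₁, hT₁⟩ := eventually_atTop.1 h
  exact ⟨max T₁ 1, lt_of_lt_of_le one_pos (le_max_right _ _), Ω, hΩ,
    fun T hT => hT₁ T ((le_max_left _ _).trans hT)⟩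

/-- The difference of the characteristic functions, with a constant which is uniform in `T`. -/
lemma norm_integral_exp_lerch_sub_charFun_le_meanConst {lam α θ δ Ω T σ σ₁ : ℝ} (hα : 0 < α)
    (hα1 : α ≤ 1) (hind : LinearIndependent ℚ fun n : ℕ => Real.log (n + α)) (hΩ : 0 < Ω)
    (hθ : 0 < θ) (hδ : 0 < δ) (hθδ : θ + δ < 1 / 4) (hT : 0 < T)
    (hl : LargeEnough α θ δ Ω (Real.log T)) (hσ : 1 / 2 + Real.log T ^ (-θ) ≤ σ) (hσ₁ : σ ≤ σ₁)
    {v : ℂ} (hv : ‖v‖ ≤ 2 * Real.log T ^ δ)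
    {φ : ProbabilityMeasure ℂ} (hφ : Tendsto (partialConv σ α) atTop (𝓝 φ)) :
    ‖∫ t, Complex.exp ((⟪lerchZeta lam α (σ + t * Complex.I), v⟫ : ℝ) * Complex.I) ∂avg T
        - charFun (φ : Measure ℂ) v‖
      ≤ meanConst lam σ₁ * Real.exp (-(1 / 2) * Real.log T ^ (θ / 2)) := by
  have := isProbabilityMeasure_avg hT
  have hl3 := hl.three_le
  have hl0 : 0 < Real.log T := by linarith
  -- Above the threshold, log T ≥ `lamBound lam` and 2σ ≤ √(log log T), as the sharp bound requires.
  -- Below it, (log T)^{θ/2} ≤ log T makes the right side at least 2, and the trivial bound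
  -- suffices.
  rcases le_or_gt (logThreshold lam σ₁) (Real.log T) with h | h
  · have h1 : 2 * σ ≤ Real.sqrt (Real.log (Real.log T)) := by
      refine Real.le_sqrt_of_sq_le ?_
      have hσ0 : 0 < σ := by
        have : 0 < Real.log T ^ (-θ) := by positivity
        linarith
      have h2 : 4 * σ₁ ^ 2 ≤ Real.log (Real.log T) := by
        rw [Real.le_log_iff_exp_le hl0]
        exact (le_max_right _ _).trans h
      nlinarith
    have hkey := norm_integral_exp_lerch_sub_charFun_le_exp hα hα1 hind hΩ hθ hδ hθδ hl
      ((le_max_left _ _).trans h) hσ h1 hv hφ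
    rw [Real.exp_log hT] at hkey
    refine hkey.trans (le_mul_of_one_le_left (Real.exp_pos _).le ?_)
    linarith [two_le_meanConst lam σ₁]
  · have h1 : 2 ≤ meanConst lam σ₁ * Real.exp (-(1 / 2) * Real.log T ^ (θ / 2)) := by
      have h2 : Real.log T ^ (θ / 2) ≤ Real.log T := by linarith [hl.half_le]
      rw [meanConst, mul_assoc, ← Real.exp_add]
      have : 1 ≤ Real.exp (logThreshold lam σ₁ / 2 + -(1 / 2) * Real.log T ^ (θ / 2)) :=
        Real.one_le_exp (by linarith)
      linarith
    refine le_trans ((norm_sub_le _ _).trans ?_) h1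
    have h3 := norm_integral_exp_inner_le_one (avg T)
      (fun t : ℝ => lerchZeta lam α (σ + t * Complex.I)) v
    have h4 := norm_charFun_le_one (μ := (φ : Measure ℂ)) v
    linarith

end LerchMean

theorem mainTheorem3 :
    ∃ (C : ℝ → ℝ → ℝ) (T₀ : ℝ → ℝ → ℝ → ℝ),
      (∀ lam σ₁, 0 < C lam σ₁) ∧ (∀ α θ δ, 0 < T₀ α θ δ) ∧
      ∀ (lam α σ₁ θ δ : ℝ), α ∈ LerchMean.admissibleSet → 0 < σ₁ →
        0 < θ → 0 < δ → θ + δ < 1 / 4 →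
        ∀ T : ℝ, T₀ α θ δ ≤ T →
        ∀ σ ∈ Set.Icc (1 / 2 + Real.log T ^ (-θ)) σ₁,
        -- the density in the main term is the one it is meant to be
        LerchMean.IsLimitDensity σ α (LerchMean.densityM σ α) ∧
        ∀ Φ : ℂ → ℂ, LerchMean.ClassLambda Φ →
          ‖(1 / (T : ℂ)) * (∫ t in (0 : ℝ)..T,
                Φ (LerchMean.lerchZeta lam α ((σ : ℂ) + (t : ℂ) * Complex.I)))
              - ∫ z, Φ z * (LerchMean.densityM σ α z : ℂ) ∂LerchMean.dz‖
            ≤ C lam σ₁ *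
              (Real.exp (-(1 / 2) * Real.log T ^ (θ / 2)) *
                  (∫ z in LerchMean.squareΩ δ T, ‖LerchMean.fourierT Φ z‖ ∂LerchMean.dz)
                + ∫ z in (LerchMean.squareΩ δ T)ᶜ, ‖LerchMean.fourierT Φ z‖ ∂LerchMean.dz) := by
  classical
  refine ⟨LerchMean.meanConst, fun α θ δ =>
    -- T₀ must be a function of all α, θ, δ; the value 1 only serves triples without a threshold,
    -- which the hypotheses exclude.
    if h : ∃ T₀, LerchMean.IsThreshold α θ δ T₀ then h.choose else 1,
    fun lam σ₁ => two_pos.trans_le (LerchMean.two_le_meanConst lam σ₁), fun α θ δ => ?_, ?_⟩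
  · dsimp only
    split_ifs with h
    · exact h.choose_spec.1
    · exact one_pos
  intro lam α σ₁ θ δ hα _ hθ hδ hθδ T hT σ hσ
  have hex := LerchMean.exists_isThreshold hα hθ hδ hθδ
  simp only [dif_pos hex] at hT
  obtain ⟨hT₀, Ω, hΩ, hlarge⟩ := hex.choose_spec
  have hTpos : 0 < T := hT₀.trans_le hT
  have hl := hlarge T hT
  have hl3 := hl.three_le
  have hσ2 : 1 / 2 < σ := by
    have : 0 < Real.log T ^ (-θ) := Real.rpow_pos_of_pos (by linarith) _
    linarith [hσ.1]
  obtain ⟨⟨hα0, hα1⟩, hind, -⟩ := hα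
  refine ⟨LerchMean.isLimitDensity_densityM hα0 hσ2, fun Φ hΦ => ?_⟩
  rw [mul_add, ← mul_assoc]
  exact LerchMean.norm_mean_sub_integral_density_le hα0 hσ2 hTpos hΦ
    (LerchMean.measurableSet_squareΩ δ T)
    (fun φ hφ w hw => LerchMean.norm_integral_exp_lerch_sub_charFun_le_meanConst hα0 hα1 hind hΩ
      hθ hδ hθδ hTpos hl hσ.1 hσ.2 (LerchMean.norm_neg_le_of_mem_squareΩ hw) hφ)
    (LerchMean.two_le_meanConst lam σ₁)
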